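/- Throughout, $\gamma>0$ is a constant, $u:\mathbb R\to\mathbb R$ is bounded and Lebesgue measurable, $\Gamma:=(-\infty,0]\cup[1,\infty)$, and $V_0(0),V_0(1)\ge 0$. We write $a\wedge b=\min(a,b)$, $a\vee b=\max(a,b)$, $L^\pm=\max(\pm L,0)$. **Equilibria.** Let $\mathcal Y$ be the set of $1$-Lipschitz paths $y:[0,\infty)\to\mathbb R$ such that $\theta:=\inf\{t\ge0: y_t\in\Gamma\}<\infty$ and $y_t=y_\theta$ for $t\ge\theta$, with the metric $\|y-\hat y\|_\infty+|\theta-\hat\theta|$. For $T\in(0,\infty)$, a triple $(\kappa,\mathbb Q,L)$ with $\kappa\in(0,\infty)$, $\mathbb Q$ a Borel probability measure on $\mathcal Y\times[0,\infty)=\{(y,\beta)\}$ and $L:\mathbb R\to\mathbb R\setminus\{0\}$ upper semicontinuous and locally integrable is an equilibrium capped at $T$ if - $\mathbb Q$ minimizes $\mathbb E^{\hat{\mathbb Q}}\big[\int_0^\theta L^+(y_t)\,dt\big]$ over all Borel probability measures $\hat{\mathbb Q}$ on $\mathcal Y\times[0,\infty)$ with $\hat{\mathbb Q}\circ y_0^{-1}=\mathbb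 Q\circ y_0^{-1}$; - $\mathbb Q$-a.s. $\int_0^\theta L^+(y_t)\,dt\le T$ and $\beta\le\theta$, and $y_\theta\in\partial_*\Gamma=\{0,1\}$ (the measure theoretic boundary of $\Gamma$) a.s. on $\{\beta=\theta\}$; - for all $\phi\in C_c^\infty(\mathbb R)$: $\kappa\,\mathbb E^{\mathbb Q}\big[\int_0^\beta\phi(y_t)L^+(y_t)\,dt\big]=\int_{\mathbb R}\phi(x)(1+\gamma L(x))\,dx$ and $\mathbb E^{\mathbb Q}\big[\int_0^\beta\phi(y_t)L^-(y_t)\,dt\big]=0$. An equilibrium is an equilibrium capped at some $T\in(0,\infty)$. For an equilibrium let $$\iota(L,t)=\inf\Big\{r\in[0,\theta]:\int_r^\theta L^+(y_z)\,dz<t\Big\},\qquad \overline{\mathbb Q}_t(dx)=\mathbb E^{\mathbb Q}\Big[\int_{\iota(L,t)}^{\beta\vee\iota(L,t)}\mathbf 1_{\{y_r\in dx\}}\,dr\Big],$$ $D_0^{\mathbb Q,L}=\Gamma$, $D_t^{\mathbb Q,L}=\Gamma\cup\operatorname{supp}\overline{\mathbb Q}_t$ for $t>0$, and $w^{\mathbb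 Q,L}(x)=\inf\{t\ge0:x\in D_t^{\mathbb Q,L}\}\in[0,\infty]$. Further, let $$\mathbf e^{\kappa,\mathbb Q,L}(dx)=\kappa\,\mathbb Q(y_0\in dx,\theta=0)+\mathbf 1_{\{w^{\mathbb Q,L}<\infty\}\setminus\Gamma}(x)\big(\kappa\,\mathbb Q(y_0\in dx)-\kappa\,\mathbb Q(y_\beta\in dx)-(1+u(x))\,dx\big)$$ and $\mathbf E_t^{\kappa,\mathbb Q,L}=\mathbf e^{\kappa,\mathbb Q,L}(\{w^{\mathbb Q,L}\le t\})$. The equilibrium is admissible if $\mathbf e^{\kappa,\mathbb Q,L}\ge0$. **Minimal solutions.** Let $\pi:=(\gamma+V_0(0))\,\delta_0+(\gamma+V_0(1))\,\delta_1$. A Lebesgue measurable $w:\mathbb R\to[0,\infty]$ is a minimal solution (of the cascade equation with initial domain $\Gamma$ and initial velocity $V_0$) if there are equilibria $(\kappa^n,\mathbb Q^n,L^n)_{n\in\mathbb N}$ such that, for every $T\in(0,\infty)$: 1. for each $n$ the equilibrium is admissible and $\kappa^n\mathbb Q^n(y_\theta\in B,\beta=\theta)>\pi(B)$ for every Borel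 set $B$ with $\pi(B)>0$; moreover $w^{\mathbb Q^n,L^n}\wedge T\to w\wedge T$ in $L^1_{\mathrm{loc}}(\mathbb R)$ and $\kappa^n\mathbb Q^n(\beta=\theta)\to\pi(\mathbb R)$ as $n\to\infty$; 2. for every sequence of admissible equilibria $(\hat\kappa^n,\hat{\mathbb Q}^n,\hat L^n)$ such that, for all $n$, $\hat\kappa^n\hat{\mathbb Q}^n(y_\theta\in dx,\beta=\theta)=\kappa^n\mathbb Q^n(y_\theta\in dx,\beta=\theta)$ and $\mathbf E_t^{\hat\kappa^n,\hat{\mathbb Q}^n,\hat L^n}\le\mathbf E_t^{\kappa^n,\mathbb Q^n,L^n}$ for all $t\in[0,T]$, one has $$\liminf_{n\to\infty}\big(\mathbf E_t^{\hat\kappa^n,\hat{\mathbb Q}^n,\hat L^n}-\mathbf E_r^{\kappa^n,\mathbb Q^n,L^n}\big)\ge0\qquad\text{for all }0\le r<t<T.$$ **Proposition.** The function $w:=w_0\wedge w_1$ is a minimal solution, and every minimal solution equals $w$ Lebesgue-almost everywhere, where $$w_0(x)=\int_0^x\frac{dz}{V_0(0)-\int_0^z(u(r)+1)\,dr}\,\mathbf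 1_{(0,x_0^*]}(x)+\infty\,\mathbf 1_{(x_0^*,1)}(x),\quad x_0^*=\inf\Big\{x\in(0,1):\int_0^x(u(z)+1)\,dz>V_0(0)\Big\}\wedge1,$$ $$w_1(x)=\int_x^1\frac{dz}{V_0(1)-\int_z^1(u(r)+1)\,dr}\,\mathbf 1_{[x_1^*,1)}(x)+\infty\,\mathbf 1_{(0,x_1^*)}(x),\quad x_1^*=\sup\Big\{x\in(0,1):\int_x^1(u(z)+1)\,dz>V_0(1)\Big\}\vee0,$$ with $1/0=\infty$, $\infty\cdot0=0$, $\inf\emptyset=\infty$, $\sup\emptyset=-\infty$. (In particular $w=0$ on $\Gamma$.) -/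

import Mathlib

open Set Filter Topology MeasureTheory
open scoped NNReal ENNReal ContDiff

noncomputable section

namespace Cascade

section Paths

variable {E : Type*} [NormedAddCommGroup E]

/-- The path space `𝒴` of the solid domain `Γ`: paths `y : [0, ∞) → E` which are Lipschitz with
constant `1` (that is, absolutely continuous with `‖ẏ‖_∞ ≤ 1`), reach the closure of `Γ` in
finite time, and stay where they are from the hitting time `θ` on. -/
@[ext]
structure StoppedPath (Γ : Set E) where
  toFun : ℝ≥0 → E
  lipschitz : LipschitzWith 1 toFun
  hits : ∃ t, toFun t ∈ closure Γ
  stops : ∀ t, sInf {s | toFun s ∈ closure Γ} ≤ t →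
    toFun t = toFun (sInf {s | toFun s ∈ closure Γ})

namespace StoppedPath

variable {Γ : Set E}

/-- The hitting time `θ = inf {t ≥ 0 : y_t ∈ closure Γ}`. -/
def θ (y : StoppedPath Γ) : ℝ≥0 := sInf {s | y.toFun s ∈ closure Γ}

/-- The position `y_t` at a real time `t ≥ 0` (only such times are ever used). -/
def pos (y : StoppedPath Γ) (t : ℝ) : E := y.toFun t.toNNReal

theorem toFun_eq_min (y : StoppedPath Γ) (t : ℝ≥0) : y.toFun t = y.toFun (min t y.θ) := by
  rcases le_total t y.θ with h | h
  · rw [min_eq_left h]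
  · rw [min_eq_right h]
    exact y.stops t h

theorem dist_le_θ (y : StoppedPath Γ) (s t : ℝ≥0) : dist (y.toFun s) (y.toFun t) ≤ y.θ := by
  rw [y.toFun_eq_min s, y.toFun_eq_min t]
  refine (y.lipschitz.dist_le_mul _ _).trans ?_
  rw [NNReal.coe_one, one_mul, NNReal.dist_eq, abs_le]
  have h1 : ((min s y.θ : ℝ≥0) : ℝ) ≤ y.θ := NNReal.coe_le_coe.2 (min_le_right _ _)
  have h2 : ((min t y.θ : ℝ≥0) : ℝ) ≤ y.θ := NNReal.coe_le_coe.2 (min_le_right _ _)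
  have h3 := (min s y.θ).coe_nonneg
  have h4 := (min t y.θ).coe_nonneg
  constructor <;> linarith

/-- A path of `𝒴` as a bounded continuous function, so that `‖y - ŷ‖_∞` makes sense. -/
def toBCF (y : StoppedPath Γ) : BoundedContinuousFunction ℝ≥0 E :=
  BoundedContinuousFunction.mkOfBound ⟨y.toFun, y.lipschitz.continuous⟩ y.θ y.dist_le_θ

/-- The metric `d(y, ŷ) = ‖y - ŷ‖_∞ + |θ - θ̂|`. -/
instance : MetricSpace (StoppedPath Γ) where
  dist y z := dist y.toBCF z.toBCF + dist y.θ z.θ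
  dist_self y := by simp
  dist_comm y z := by simp only [dist_comm]
  dist_triangle x y z := by
    have h1 := dist_triangle x.toBCF y.toBCF z.toBCF
    have h2 := dist_triangle x.θ y.θ z.θ
    linarith
  eq_of_dist_eq_zero {y z} h := by
    have h1 : dist y.toBCF z.toBCF = 0 :=
      le_antisymm (by linarith [dist_nonneg (x := y.θ) (y := z.θ)]) dist_nonneg
    have h2 : y.toBCF = z.toBCF := eq_of_dist_eq_zero h1
    ext t
    exact congrArg (fun f : BoundedContinuousFunction ℝ≥0 E => f t) h2

instance : MeasurableSpace (StoppedPath Γ) := borel _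

instance : BorelSpace (StoppedPath Γ) := ⟨rfl⟩

/-- The remaining cost `∫_r^θ L⁺(y_z) dz`. -/
def tailCost (L : E → ℝ) (y : StoppedPath Γ) (r : ℝ≥0) : ℝ≥0∞ :=
  ∫⁻ z in Ioc (r : ℝ) (y.θ : ℝ), ENNReal.ofReal (L (y.pos z))

/-- The full cost `∫_0^θ L⁺(y_z) dz`. -/
def cost (L : E → ℝ) (y : StoppedPath Γ) : ℝ≥0∞ := y.tailCost L 0

/-- `ι(L, t) = inf {r ∈ [0, θ] : ∫_r^θ L⁺(y_z) dz < t}`, with `inf ∅ = ∞` (which occurs only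
for `t = 0`). -/
def ι (L : E → ℝ) (t : ℝ≥0) (y : StoppedPath Γ) : ℝ≥0∞ :=
  ⨅ (r : ℝ≥0) (_ : r ≤ y.θ ∧ y.tailCost L r < t), (r : ℝ≥0∞)

end StoppedPath

end Paths

variable {E : Type*} [NormedAddCommGroup E] [NormedSpace ℝ E] [MeasureSpace E] [BorelSpace E]

/-- The measure theoretic boundary `∂_*Γ`: the points at which both `Γ` and its complement have
positive upper density. -/
def essBoundary (Γ : Set E) : Set E :=
  {x | 0 < limsup (fun r : ℝ => volume (Metric.closedBall x r ∩ Γ) /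
        ENNReal.ofReal r ^ Module.finrank ℝ E) (𝓝[>] 0) ∧
      0 < limsup (fun r : ℝ => volume (Metric.closedBall x r \ Γ) /
        ENNReal.ofReal r ^ Module.finrank ℝ E) (𝓝[>] 0)}

/-- The initial boundary energy `π(dx) = (γ + V₀(x)) 1_{∂_*Γ}(x) ℋ^{d-1}(dx)`. -/
def boundaryEnergy (γ : ℝ) (Γ : Set E) (V₀ : E → ℝ) : Measure E :=
  ((Measure.hausdorffMeasure ((Module.finrank ℝ E : ℝ) - 1)).restrict
    (essBoundary Γ)).withDensity (fun x => ENNReal.ofReal (γ + V₀ x))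

/-- `P > R` for measures: `P` charges every set that is charged by `R` strictly more than `R`.
In particular `R ≤ P` on all measurable sets. -/
def StrictlyAbove (P R : Measure E) : Prop :=
  ∀ B : Set E, MeasurableSet B → 0 < R B → R B < P B

/-- A triple `(κ, ℚ, L)`; the generic element of `𝒴 × ℝ₊` is a pair `(y, β)`. -/
structure Triple (Γ : Set E) where
  κ : ℝ
  Q : Measure (StoppedPath Γ × ℝ≥0)
  L : E → ℝ

namespace Triple

variable {Γ : Set E}

/-- `(κ, ℚ, L)` is an equilibrium capped at `T`. -/
structure IsCappedEquilibrium (γ : ℝ) (T : ℝ≥0) (X : Triple Γ) : Prop where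
  κ_pos : 0 < X.κ
  isProbability : IsProbabilityMeasure X.Q
  usc : UpperSemicontinuous X.L
  ne_zero : ∀ x, X.L x ≠ 0
  /-- `ℚ` minimizes the expected cost for its own initial distribution. -/
  optimal : ∀ P : Measure (StoppedPath Γ × ℝ≥0), IsProbabilityMeasure P →
    P.map (fun p => p.1.pos 0) = X.Q.map (fun p => p.1.pos 0) →
    ∫⁻ p, p.1.cost X.L ∂X.Q ≤ ∫⁻ p, p.1.cost X.L ∂P
  capped : ∀ᵐ p : StoppedPath Γ × ℝ≥0 ∂X.Q, p.1.cost X.L ≤ (T : ℝ≥0∞) ∧ p.2 ≤ p.1.θ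
  /-- `ℚ(y_θ ∈ ∂_*Γ | β = θ) = 1`. -/
  exit : ∀ᵐ p : StoppedPath Γ × ℝ≥0 ∂X.Q, p.2 = p.1.θ → p.1.pos p.1.θ ∈ essBoundary Γ
  /-- The right side of the fixed point equation is meaningful for all test functions. -/
  locallyIntegrable : LocallyIntegrable X.L volume
  fixedPoint : ∀ φ : E → ℝ, ContDiff ℝ ∞ φ → HasCompactSupport φ →
    X.κ * ∫ p, (∫ t in (0 : ℝ)..(p.2 : ℝ), φ (p.1.pos t) * max (X.L (p.1.pos t)) 0) ∂X.Q
      = ∫ x, φ x * (1 + γ * X.L x)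
  /-- `𝔼[∫_0^β φ(y_t) L⁻(y_t) dt] = 0`, including the absolute convergence of the integral. -/
  negPart : ∀ φ : E → ℝ, ContDiff ℝ ∞ φ → HasCompactSupport φ →
    ∫⁻ p, (∫⁻ t in Ioc (0 : ℝ) (p.2 : ℝ),
      ENNReal.ofReal (|φ (p.1.pos t)| * max (-X.L (p.1.pos t)) 0)) ∂X.Q = 0

/-- `(κ, ℚ, L) ∈ ℰ = ⋃_{T > 0} ℰ_T`. -/
def IsEquilibrium (γ : ℝ) (X : Triple Γ) : Prop :=
  ∃ T : ℝ≥0, 0 < T ∧ X.IsCappedEquilibrium γ T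

/-- The occupation measure `ℚ̄_t(A) = 𝔼[∫_{ι(L,t)}^{β ∨ ι(L,t)} 1_{y_r ∈ A} dr]`. -/
def occupation (X : Triple Γ) (t : ℝ≥0) (A : Set E) : ℝ≥0∞ :=
  ∫⁻ p, volume {r : ℝ | 0 ≤ r ∧ p.1.ι X.L t ≤ ENNReal.ofReal r ∧ r ≤ p.2 ∧ p.1.pos r ∈ A} ∂X.Q

/-- The time-`t` cascade `D_t = Γ ∪ supp ℚ̄_t`. -/
def aggregate (X : Triple Γ) (t : ℝ≥0) : Set E :=
  Γ ∪ {x | ∀ ε > 0, 0 < X.occupation t (Metric.ball x ε)}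

/-- The arrival time function `w^{ℚ,L}(x) = inf {t ≥ 0 : x ∈ D_t}`, with `inf ∅ = ∞`. -/
def arrival (X : Triple Γ) (x : E) : ℝ≥0∞ :=
  ⨅ (t : ℝ≥0) (_ : x ∈ X.aggregate t), (t : ℝ≥0∞)

/-- The region `{w^{ℚ,L} < ∞} \ closure Γ` swept by the cascade. -/
def swept (X : Triple Γ) : Set E := {x | X.arrival x < ⊤} \ closure Γ

/-- The excess loss of energy `e(B)`, where
`e(dx) = κ ℚ(y_0 ∈ dx, θ = 0)
  + 1_{swept}(x) (κ ℚ(y_0 ∈ dx) - κ ℚ(y_β ∈ dx) - (1 + u(x)) dx)`. -/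
def excess (u : E → ℝ) (X : Triple Γ) (B : Set E) : ℝ :=
  X.κ * X.Q.real {p | p.1.pos 0 ∈ B ∧ p.1.θ = 0}
    + (X.κ * X.Q.real {p | p.1.pos 0 ∈ B ∩ X.swept}
      - X.κ * X.Q.real {p | p.1.pos p.2 ∈ B ∩ X.swept}
      - ∫ x in B ∩ X.swept, (1 + u x))

/-- Admissibility: `e` is a (well-defined) non-negative measure. -/
def IsAdmissible (u : E → ℝ) (X : Triple Γ) : Prop :=
  IntegrableOn (fun x => 1 + u x) X.swept volume ∧
    ∀ B : Set E, MeasurableSet B → 0 ≤ X.excess u B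

/-- The cumulative excess loss of energy `𝐄_t = e({w^{ℚ,L} ≤ t})`. -/
def cumulativeExcess (u : E → ℝ) (X : Triple Γ) (t : ℝ≥0) : ℝ :=
  X.excess u {x | X.arrival x ≤ t}

/-- The measure `κ ℚ(y_θ ∈ dx, β = θ)`. -/
def exitMeasure (X : Triple Γ) : Measure E :=
  ENNReal.ofReal X.κ • (X.Q.restrict {p | p.2 = p.1.θ}).map (fun p => p.1.pos p.1.θ)

end Triple

/-- Convergence of `[0, ∞]`-valued functions capped at `T` in `L¹_loc`: the sequence `f n ∧ T`
tends to `g ∧ T` in `L¹(K)` for all compact `K`. -/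
def CappedL1LocTendsto (T : ℝ≥0) (f : ℕ → E → ℝ≥0∞) (g : E → ℝ≥0∞) : Prop :=
  ∀ K : Set E, IsCompact K →
    Tendsto (fun n => ∫⁻ x in K, ‖(min (f n x) T).toReal - (min (g x) T).toReal‖ₑ) atTop (𝓝 0)

/-- `w` is a minimal solution of the cascade equation with surface tension `γ`, temperature `u`,
initial domain `Γ` and initial velocity `V₀`. -/
def IsMinimalSolution (γ : ℝ) (Γ : Set E) (u V₀ : E → ℝ) (w : E → ℝ≥0∞) : Prop :=
  AEMeasurable w volume ∧
  ∃ X : ℕ → Triple Γ, (∀ n, (X n).IsEquilibrium γ) ∧ ∀ T : ℝ≥0, 0 < T →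
    ((∀ n, StrictlyAbove (X n).exitMeasure (boundaryEnergy γ Γ V₀)) ∧
      (∀ n, (X n).IsAdmissible u) ∧
      CappedL1LocTendsto T (fun n => (X n).arrival) w ∧
      Tendsto (fun n => ENNReal.ofReal (X n).κ * (X n).Q {p | p.2 = p.1.θ}) atTop
        (𝓝 (boundaryEnergy γ Γ V₀ univ))) ∧
    (∀ Y : ℕ → Triple Γ, (∀ n, (Y n).IsEquilibrium γ) →
      (∀ n, (Y n).exitMeasure = (X n).exitMeasure) →
      (∀ n, (Y n).IsAdmissible u) →
      (∀ n, ∀ t ≤ T, (Y n).cumulativeExcess u t ≤ (X n).cumulativeExcess u t) →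
      ∀ r t : ℝ≥0, r < t → t < T →
        0 ≤ liminf (fun n =>
          (((Y n).cumulativeExcess u t - (X n).cumulativeExcess u r : ℝ) : EReal)) atTop)

section TwoInterfaces

/-- `x₀* = inf {x ∈ (0,1) : ∫_0^x (u + 1) > v} ∧ 1`, with `inf ∅ = ∞`. -/
def stop₀ (u : ℝ → ℝ) (v : ℝ) : ℝ :=
  sInf ({x | x ∈ Ioo (0 : ℝ) 1 ∧ v < ∫ z in (0 : ℝ)..x, (u z + 1)} ∪ {1})

/-- `x₁* = sup {x ∈ (0,1) : ∫_x^1 (u + 1) > v} ∨ 0`, with `sup ∅ = -∞`. -/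
def stop₁ (u : ℝ → ℝ) (v : ℝ) : ℝ :=
  sSup ({x | x ∈ Ioo (0 : ℝ) 1 ∧ v < ∫ z in x..(1 : ℝ), (u z + 1)} ∪ {0})

/-- `w₀(x) = ∫_0^x dz / (v - ∫_0^z (u + 1)) 1_{(0, x₀*]}(x) + ∞ 1_{(x₀*, 1)}(x)`, where the
integrand is `∞` at the zeros of the denominator. -/
def arrival₀ (u : ℝ → ℝ) (v : ℝ) (x : ℝ) : ℝ≥0∞ :=
  (Ioc 0 (stop₀ u v)).indicator
      (fun x => ∫⁻ z in Ioc 0 x, (ENNReal.ofReal (v - ∫ r in (0 : ℝ)..z, (u r + 1)))⁻¹) x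
    + (Ioo (stop₀ u v) 1).indicator (fun _ => ⊤) x

/-- `w₁(x) = ∫_x^1 dz / (v - ∫_z^1 (u + 1)) 1_{[x₁*, 1)}(x) + ∞ 1_{(0, x₁*)}(x)`, where the
integrand is `∞` at the zeros of the denominator. -/
def arrival₁ (u : ℝ → ℝ) (v : ℝ) (x : ℝ) : ℝ≥0∞ :=
  (Ico (stop₁ u v) 1).indicator
      (fun x => ∫⁻ z in Ioc x 1, (ENNReal.ofReal (v - ∫ r in z..(1 : ℝ), (u r + 1)))⁻¹) x
    + (Ioo 0 (stop₁ u v)).indicator (fun _ => ⊤) x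

/-- `w = w₀ ∧ w₁`. Outside of `(0, 1)` one of the two summands vanishes, so that `w = 0` there. -/
def twoInterfaceArrival (u : ℝ → ℝ) (v₀ v₁ : ℝ) (x : ℝ) : ℝ≥0∞ :=
  min (arrival₀ u v₀ x) (arrival₁ u v₁ x)

end TwoInterfaces

end Cascade

end

/-! In dimension one the game can be solved almost explicitly. The cheapest way from `x` to the
solid is a straight run, so the optimal cost is `minCost L x`, the smaller of `∫_0^x L⁺` and `∫_x^1
L⁺`. Under an equilibrium almost every path attains it, and since `L > 0` along the path up to `β`,
every detour or pause before `β` would be paid for. Hence paths run straight at unit speed until `β`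
(`ae_isTight`, `abs_finish_sub_start`). The fixed point equation then becomes pointwise: `L⁺ · flux
= 1 + γ L`, where `flux x` is `κ` times the probability that `x` is crossed (`ae_posPart_mul_flux`).
So `L = (flux - γ)⁻¹` wherever `L > 0`. The arrival time is `minCost` on the swept set, and `flux -
γ` is the velocity of the interface.

Let `c` be a point where both costs agree. Conservation of mass to the left of `x < c`
(`excess_Iic`) gives `flux x = P - e((-∞, x]) - ∫ (u + 1)`, the integral being over the swept part
of `(0, x]` and `P` being the exit mass at `0`. Admissibility says `e ≥ 0`. Thus the interface from
`0` has at most the velocity `P - γ - ∫_0^x (u + 1)`, and it loses at most `δ` of this as long as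
the cumulative excess is at most `δ`. By reflection the same holds at `1`. This sandwiches the
arrival time between two front times (`twoFrontTime_le_arrival`, `arrival_le_twoFrontTime`).

Conversely, for exit masses `P₀, P₁ > γ` there is an explicit equilibrium whose excess vanishes
until the two fronts collide, or until a prescribed horizon (`exists_triple`). It sends the sources
`(u + 1)⁺` to the sinks `(u + 1)⁻` and to the boundary through a quantile coupling; the remaining
mass starts at the final positions of the fronts.

With exit masses decreasing to `γ + V₀`, these equilibria yield existence. Before the collision no
competitor has smaller excess than `0`; after it everything is swept and the total excess is
determined by the exit masses (`cumulativeExcess_eq`). For uniqueness they serve as competitors: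
minimality forces the excess of any approximating sequence to vanish before the last arrival, and
the sandwich identifies the limit (`ae_tendsto_arrival`). -/

namespace Cascade

noncomputable section

/-! ### Stopped paths: elementary properties and joint measurability. -/

section

/-- The complement of the unit interval `(0, 1)`. -/
abbrev solid : Set ℝ := Iic (0 : ℝ) ∪ Ici 1

theorem isClosed_solid : IsClosed solid := isClosed_Iic.union isClosed_Ici

theorem closure_solid : closure solid = solid := isClosed_solid.closure_eq

theorem notMem_solid {x : ℝ} : x ∉ solid ↔ x ∈ Ioo (0 : ℝ) 1 := by
  simp [solid]

theorem measurableSet_solid : MeasurableSet solid := isClosed_solid.measurableSet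

namespace StoppedPath

section General

variable {E : Type*} [NormedAddCommGroup E] {Γ : Set E}

theorem lipschitz_pos (y : StoppedPath Γ) : LipschitzWith 1 y.pos := by
  have h := y.lipschitz.comp Real.lipschitzWith_toNNReal
  rw [one_mul] at h
  exact h

theorem pos_coe (y : StoppedPath Γ) (t : ℝ≥0) : y.pos t = y.toFun t := by
  simp [pos]

theorem toFun_θ_mem (y : StoppedPath Γ) : y.toFun y.θ ∈ closure Γ := by
  have hc : IsClosed {s | y.toFun s ∈ closure Γ} := isClosed_closure.preimage y.lipschitz.continuous
  exact hc.csInf_mem y.hits (OrderBot.bddBelow _)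

theorem pos_θ_mem (y : StoppedPath Γ) : y.pos y.θ ∈ closure Γ := by
  rw [pos_coe]; exact y.toFun_θ_mem

theorem notMem_of_lt_θ (y : StoppedPath Γ) {t : ℝ≥0} (ht : t < y.θ) :
    y.toFun t ∉ closure Γ := fun h =>
  notMem_of_lt_csInf (s := {s | y.toFun s ∈ closure Γ}) ht (OrderBot.bddBelow _) h

theorem pos_of_θ_le (y : StoppedPath Γ) {t : ℝ} (ht : (y.θ : ℝ) ≤ t) :
    y.pos t = y.pos y.θ := by
  have h : y.θ ≤ t.toNNReal := by
    rw [← NNReal.coe_le_coe]; exact ht.trans (Real.le_coe_toNNReal t)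
  rw [pos_coe, pos]
  exact y.stops _ h

theorem θ_eq_zero_iff (y : StoppedPath Γ) : y.θ = 0 ↔ y.pos 0 ∈ closure Γ := by
  constructor
  · intro h
    have := y.toFun_θ_mem
    rw [h] at this
    simpa [pos] using this
  · intro h
    by_contra h0
    exact y.notMem_of_lt_θ (pos_iff_ne_zero.2 h0) (by simpa [pos] using h)

theorem continuous_toFun_apply (t : ℝ≥0) :
    Continuous fun y : StoppedPath Γ => y.toFun t := by
  have : LipschitzWith 1 fun y : StoppedPath Γ => y.toFun t := by
    refine LipschitzWith.of_dist_le_mul fun y z => ?_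
    have h1 : dist (y.toBCF t) (z.toBCF t) ≤ dist y.toBCF z.toBCF :=
      BoundedContinuousFunction.dist_coe_le_dist t
    have h2 : dist y z = dist y.toBCF z.toBCF + dist y.θ z.θ := rfl
    rw [NNReal.coe_one, one_mul, h2]
    exact h1.trans (le_add_of_nonneg_right dist_nonneg)
  exact this.continuous

theorem continuous_θ : Continuous fun y : StoppedPath Γ => y.θ := by
  have : LipschitzWith 1 fun y : StoppedPath Γ => y.θ := by
    refine LipschitzWith.of_dist_le_mul fun y z => ?_
    have h2 : dist y z = dist y.toBCF z.toBCF + dist y.θ z.θ := rfl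
    rw [NNReal.coe_one, one_mul, h2]
    exact le_add_of_nonneg_left dist_nonneg
  exact this.continuous

@[fun_prop]
theorem measurable_θ : Measurable fun y : StoppedPath Γ => y.θ := continuous_θ.measurable

theorem tailCost_eq_add (L : E → ℝ) (y : StoppedPath Γ) {r s : ℝ≥0} (h : r ≤ s) (hs : s ≤ y.θ) :
    y.tailCost L r = (∫⁻ z in Ioc (r : ℝ) s, ENNReal.ofReal (L (y.pos z))) + y.tailCost L s := by
  have h1 : (r : ℝ) ≤ s := NNReal.coe_le_coe.2 h
  have h2 : (s : ℝ) ≤ y.θ := NNReal.coe_le_coe.2 hs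
  rw [tailCost, tailCost, ← Ioc_union_Ioc_eq_Ioc h1 h2, lintegral_union measurableSet_Ioc]
  exact Ioc_disjoint_Ioc_of_le le_rfl

/-- A path given by a trajectory, its hitting time and the relevant properties. -/
def ofHitting (f : ℝ≥0 → E) (hf : LipschitzWith 1 f) (τ : ℝ≥0) (h1 : f τ ∈ closure Γ)
    (h2 : ∀ s < τ, f s ∉ closure Γ) (h3 : ∀ t, τ ≤ t → f t = f τ) : StoppedPath Γ where
  toFun := f
  lipschitz := hf
  hits := ⟨τ, h1⟩
  stops := by
    have : sInf {s | f s ∈ closure Γ} = τ :=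
      IsLeast.csInf_eq ⟨h1, fun s hs => not_lt.1 fun h => h2 s h hs⟩
    rwa [this]

theorem θ_ofHitting (f : ℝ≥0 → E) (hf : LipschitzWith 1 f) (τ : ℝ≥0) (h1 : f τ ∈ closure Γ)
    (h2 : ∀ s < τ, f s ∉ closure Γ) (h3 : ∀ t, τ ≤ t → f t = f τ) :
    (ofHitting f hf τ h1 h2 h3).θ = τ :=
  IsLeast.csInf_eq ⟨h1, fun s hs => not_lt.1 fun h => h2 s h hs⟩

variable [MeasurableSpace E] [BorelSpace E]

@[fun_prop]
theorem measurable_pos (t : ℝ) : Measurable fun y : StoppedPath Γ => y.pos t :=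
  (continuous_toFun_apply t.toNNReal).measurable

/-- A Carathéodory function: continuous in time and measurable in the path. -/
theorem measurable_uncurry_pos :
    Measurable fun p : ℝ × StoppedPath Γ => p.2.pos p.1 :=
  measurable_uncurry_of_continuous_of_measurable (u := fun (t : ℝ) (y : StoppedPath Γ) => y.pos t)
    (fun y => y.lipschitz_pos.continuous) measurable_pos

theorem measurable_pos_comp {α : Type*} [MeasurableSpace α] {f : α → ℝ} {g : α → StoppedPath Γ}
    (hf : Measurable f) (hg : Measurable g) : Measurable fun a => (g a).pos (f a) :=
  measurable_uncurry_pos.comp (hf.prodMk hg)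

/-- The variable limits are moved into an indicator on the product space, so that Tonelli's
measurability theorem applies. This covers costs (upper limit `θ`) as well as integrals up to `β`.
-/
theorem measurable_lintegral_Ioc {α : Type*} [MeasurableSpace α] {F : α → StoppedPath Γ}
    {a b : α → ℝ} {g : E → ℝ≥0∞} (hF : Measurable F) (ha : Measurable a) (hb : Measurable b)
    (hg : Measurable g) : Measurable fun q => ∫⁻ z in Ioc (a q) (b q), g ((F q).pos z) := by
  have h : (fun q => ∫⁻ z in Ioc (a q) (b q), g ((F q).pos z)) = fun q => ∫⁻ z : ℝ,
      ({q : α × ℝ | a q.1 < q.2 ∧ q.2 ≤ b q.1}).indicator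
        (fun q => g ((F q.1).pos q.2)) (q, z) := by
    funext y
    rw [← lintegral_indicator measurableSet_Ioc]
    rfl
  rw [h]
  refine Measurable.lintegral_prod_right' (ν := volume)
    (f := ({q : α × ℝ | a q.1 < q.2 ∧ q.2 ≤ b q.1}).indicator
        (fun q => g ((F q.1).pos q.2))) ?_
  refine Measurable.indicator ?_ ?_
  · exact hg.comp (measurable_pos_comp measurable_snd (hF.comp measurable_fst))
  · exact (measurableSet_lt (ha.comp measurable_fst) measurable_snd).inter
      (measurableSet_le measurable_snd (hb.comp measurable_fst))

theorem measurable_cost {L : E → ℝ} (hL : Measurable L) :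
    Measurable fun y : StoppedPath Γ => y.cost L :=
  measurable_lintegral_Ioc measurable_id measurable_const measurable_θ.coe_nnreal_real
    hL.ennreal_ofReal

end General

section Line

variable (y : StoppedPath solid)

theorem pos_mem_Ioo {t : ℝ} (h0 : 0 ≤ t) (h : t < y.θ) : y.pos t ∈ Ioo (0 : ℝ) 1 := by
  have h1 : t.toNNReal < y.θ := by
    rw [← NNReal.coe_lt_coe, Real.coe_toNNReal t h0]
    exact h
  have := y.notMem_of_lt_θ h1
  rw [closure_solid, notMem_solid] at this
  exact this

theorem θ_eq_zero_iff_mem_solid : y.θ = 0 ↔ y.pos 0 ∈ solid := by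
  rw [θ_eq_zero_iff, closure_solid]

theorem pos_zero_mem_Ioo_iff : y.pos 0 ∈ Ioo (0 : ℝ) 1 ↔ 0 < y.θ := by
  rw [← notMem_solid, ← θ_eq_zero_iff_mem_solid, pos_iff_ne_zero]

/-- The path is in `(0, 1)` before `θ`, in the closure at `θ`, and constant from then on. -/
theorem pos_mem_Icc (h : 0 < y.θ) (t : ℝ) : y.pos t ∈ Icc (0 : ℝ) 1 := by
  have hθ : (0 : ℝ) < y.θ := NNReal.coe_pos.2 h
  have key : ∀ s ∈ Icc (0 : ℝ) y.θ, y.pos s ∈ Icc (0 : ℝ) 1 := by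
    have hc : IsClosed (y.pos ⁻¹' Icc (0 : ℝ) 1) := isClosed_Icc.preimage y.lipschitz_pos.continuous
    have hsub : Ico (0 : ℝ) y.θ ⊆ y.pos ⁻¹' Icc (0 : ℝ) 1 := fun s hs =>
      Ioo_subset_Icc_self (y.pos_mem_Ioo hs.1 hs.2)
    have := hc.closure_subset_iff.2 hsub
    rwa [closure_Ico hθ.ne] at this
  rcases le_total t 0 with h0 | h0
  -- Negative times are truncated to `0` by `pos`.
  · have : y.pos t = y.pos 0 := by simp [pos, Real.toNNReal_of_nonpos h0]
    rw [this]
    exact key 0 ⟨le_rfl, hθ.le⟩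
  · rcases le_total t y.θ with h1 | h1
    · exact key t ⟨h0, h1⟩
    · rw [y.pos_of_θ_le h1]
      exact key _ ⟨hθ.le, le_rfl⟩

end Line

end StoppedPath

/-! ### One-dimensional area inequality for Lipschitz motions. -/

section Area

/-- A `1`-Lipschitz motion spends at least as much time in a set as the length of the part of the
set which lies between its endpoints. -/
theorem restrict_uIcc_le_map {f : ℝ → ℝ} (hf : LipschitzWith 1 f) {s r : ℝ} (h : s ≤ r) :
    (volume.restrict (uIcc (f s) (f r))) ≤ (volume.restrict (Ioc s r)).map f := by
  have hm : Measurable f := hf.continuous.measurable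
  refine Measure.le_iff.2 fun B hB => ?_
  rw [Measure.restrict_apply hB, Measure.map_apply hm hB, Measure.restrict_congr_set
    Ioc_ae_eq_Icc, Measure.restrict_apply (hm hB)]
  -- By the intermediate value theorem every point between the endpoints is visited.
  have hsub : B ∩ uIcc (f s) (f r) ⊆ f '' (f ⁻¹' B ∩ Icc s r) := by
    rintro x ⟨hx, hx'⟩
    have := intermediate_value_uIcc (f := f) (a := s) (b := r) hf.continuous.continuousOn hx'
    rw [uIcc_of_le h] at this
    obtain ⟨t, ht, rfl⟩ := this
    exact ⟨t, ⟨hx, ht⟩, rfl⟩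
  refine (measure_mono hsub).trans ?_
  -- A `1`-Lipschitz map does not increase one-dimensional Hausdorff measure, which is Lebesgue
  -- measure on the line.
  have := hf.hausdorffMeasure_image_le (d := 1) zero_le_one (f ⁻¹' B ∩ Icc s r)
  rw [hausdorffMeasure_real] at this
  simpa using this

theorem lintegral_uIcc_le {f : ℝ → ℝ} (hf : LipschitzWith 1 f) {s r : ℝ} (h : s ≤ r)
    {g : ℝ → ℝ≥0∞} (hg : Measurable g) :
    ∫⁻ x in uIcc (f s) (f r), g x ≤ ∫⁻ t in Ioc s r, g (f t) := by
  rw [← lintegral_map hg hf.continuous.measurable]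
  exact lintegral_mono' (restrict_uIcc_le_map hf h) le_rfl

end Area

/-! ### Straight paths to the endpoints, measurable in the starting point. -/

section Straight

namespace StoppedPath

/-- The path resting at a point of the solid. -/
def rest (x : ℝ) (hx : x ∈ solid) : StoppedPath solid :=
  ofHitting (fun _ => x) (LipschitzWith.const' x) 0 (subset_closure hx)
    (fun _ hs => absurd hs not_lt_zero) (fun _ _ => rfl)

/-- The path running from `x ∈ (0, 1)` straight to `0`. -/
def runLeft (x : ℝ) (hx : x ∈ Ioo (0 : ℝ) 1) : StoppedPath solid :=
  ofHitting (fun t => max (x - t) 0)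
    (by
      refine LipschitzWith.of_dist_le_mul fun s t => ?_
      rw [NNReal.coe_one, one_mul, NNReal.dist_eq, Real.dist_eq]
      refine (abs_max_sub_max_le_abs _ _ _).trans ?_
      rw [abs_sub_comm]
      exact le_of_eq (by congr 1; ring))
    x.toNNReal
    (subset_closure (Or.inl (by simp [hx.1.le])))
    (fun s hs => by
      rw [closure_solid, notMem_solid]
      have : (s : ℝ) < x := by rwa [← Real.lt_toNNReal_iff_coe_lt]
      have h0 := s.coe_nonneg
      have := hx.2
      exact ⟨lt_max_of_lt_left (by linarith), max_lt (by linarith) one_pos⟩)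
    (fun t ht => by
      have : x ≤ t := Real.toNNReal_le_iff_le_coe.1 ht
      rw [max_eq_right (by linarith), max_eq_right (by simp [hx.1.le])])

/-- The path running from `x ∈ (0, 1)` straight to `1`. -/
def runRight (x : ℝ) (hx : x ∈ Ioo (0 : ℝ) 1) : StoppedPath solid :=
  ofHitting (fun t => min (x + t) 1)
    (by
      refine LipschitzWith.of_dist_le_mul fun s t => ?_
      rw [NNReal.coe_one, one_mul, NNReal.dist_eq, Real.dist_eq]
      refine (abs_min_sub_min_le_max _ _ _ _).trans ?_
      simp)
    (1 - x).toNNReal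
    (subset_closure (Or.inr (by simp [hx.2.le])))
    (fun s hs => by
      rw [closure_solid, notMem_solid]
      have : (s : ℝ) < 1 - x := by rwa [← Real.lt_toNNReal_iff_coe_lt]
      have h0 := s.coe_nonneg
      have := hx.1
      exact ⟨lt_min (by linarith) one_pos, min_lt_of_left_lt (by linarith)⟩)
    (fun t ht => by
      have : 1 - x ≤ t := Real.toNNReal_le_iff_le_coe.1 ht
      rw [min_eq_right (by linarith), min_eq_right (by simp [hx.2.le])])

open Classical in
/-- The straight path to `0` from points of `(0, 1)`, at rest elsewhere. -/
def toLeft (x : ℝ) : StoppedPath solid :=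
  if h : x ∈ Ioo (0 : ℝ) 1 then runLeft x h else rest x (by
    by_contra h'; exact h (notMem_solid.1 h'))

open Classical in
/-- The straight path to `1` from points of `(0, 1)`, at rest elsewhere. -/
def toRight (x : ℝ) : StoppedPath solid :=
  if h : x ∈ Ioo (0 : ℝ) 1 then runRight x h else rest x (by
    by_contra h'; exact h (notMem_solid.1 h'))

theorem toLeft_of_mem {x : ℝ} (h : x ∈ Ioo (0 : ℝ) 1) : toLeft x = runLeft x h := dif_pos h

theorem toRight_of_mem {x : ℝ} (h : x ∈ Ioo (0 : ℝ) 1) : toRight x = runRight x h := dif_pos h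

theorem toLeft_pos {x : ℝ} (h : x ∈ Ioo (0 : ℝ) 1) {t : ℝ} (ht : 0 ≤ t) :
    (toLeft x).pos t = max (x - t) 0 := by
  rw [toLeft_of_mem h]
  change max (x - (t.toNNReal : ℝ)) 0 = _
  rw [Real.coe_toNNReal t ht]

theorem toRight_pos {x : ℝ} (h : x ∈ Ioo (0 : ℝ) 1) {t : ℝ} (ht : 0 ≤ t) :
    (toRight x).pos t = min (x + t) 1 := by
  rw [toRight_of_mem h]
  change min (x + (t.toNNReal : ℝ)) 1 = _
  rw [Real.coe_toNNReal t ht]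

theorem toLeft_θ {x : ℝ} (h : x ∈ Ioo (0 : ℝ) 1) : (toLeft x).θ = x.toNNReal := by
  rw [toLeft_of_mem h, runLeft, θ_ofHitting]

theorem toRight_θ {x : ℝ} (h : x ∈ Ioo (0 : ℝ) 1) : (toRight x).θ = (1 - x).toNNReal := by
  rw [toRight_of_mem h, runRight, θ_ofHitting]

theorem toLeft_of_notMem {x : ℝ} (h : x ∉ Ioo (0 : ℝ) 1) :
    toLeft x = rest x (by by_contra h'; exact h (notMem_solid.1 h')) := dif_neg h

theorem toRight_of_notMem {x : ℝ} (h : x ∉ Ioo (0 : ℝ) 1) :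
    toRight x = rest x (by by_contra h'; exact h (notMem_solid.1 h')) := dif_neg h

theorem toLeft_pos_zero (x : ℝ) : (toLeft x).pos 0 = x := by
  by_cases h : x ∈ Ioo (0 : ℝ) 1
  · rw [toLeft_pos h le_rfl, sub_zero, max_eq_left h.1.le]
  · rw [toLeft_of_notMem h]; rfl

theorem toRight_pos_zero (x : ℝ) : (toRight x).pos 0 = x := by
  by_cases h : x ∈ Ioo (0 : ℝ) 1
  · rw [toRight_pos h le_rfl, add_zero, min_eq_left h.2.le]
  · rw [toRight_of_notMem h]; rfl

theorem dist_le_of_forall {y z : StoppedPath solid} {d : ℝ} (hd : 0 ≤ d)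
    (h : ∀ t, dist (y.toFun t) (z.toFun t) ≤ d) (hθ : dist y.θ z.θ ≤ d) : dist y z ≤ d + d := by
  have h2 : dist y z = dist y.toBCF z.toBCF + dist y.θ z.θ := rfl
  rw [h2]
  exact add_le_add ((BoundedContinuousFunction.dist_le hd).2 h) hθ

theorem dist_rest_le {x x' : ℝ} (h : x ∈ solid) (h' : x' ∈ solid) :
    dist (rest x h) (rest x' h') ≤ dist x x' + dist x x' := by
  refine dist_le_of_forall dist_nonneg (fun t => le_rfl) ?_
  rw [rest, rest, θ_ofHitting, θ_ofHitting, dist_self]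
  exact dist_nonneg

/-- The straight paths jump at one endpoint: a run to `0` from near `1` takes time about `1`,
whereas the path resting at `1` has `θ = 0`. So the Lipschitz estimate holds only on `(0, 1)` and on
its complement separately, and measurability is glued. -/
theorem measurable_of_dist_le {F : ℝ → StoppedPath solid}
    (h1 : ∀ x ∈ Ioo (0 : ℝ) 1, ∀ x' ∈ Ioo (0 : ℝ) 1, dist (F x) (F x') ≤ dist x x' + dist x x')
    (h2 : ∀ x ∈ (Ioo (0 : ℝ) 1)ᶜ, ∀ x' ∈ (Ioo (0 : ℝ) 1)ᶜ,
      dist (F x) (F x') ≤ dist x x' + dist x x') : Measurable F := by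
  classical
  have key : ∀ s : Set ℝ, (∀ x ∈ s, ∀ x' ∈ s, dist (F x) (F x') ≤ dist x x' + dist x x') →
      ContinuousOn F s := fun s hs => by
    refine (LipschitzOnWith.of_dist_le_mul (K := 2) fun x hx x' hx' => ?_).continuousOn
    refine (hs x hx x' hx').trans (le_of_eq ?_)
    simp [two_mul]
  have := (key _ h1).measurable_piecewise (key _ h2) measurableSet_Ioo
  rwa [piecewise_same] at this

theorem measurable_toLeft : Measurable toLeft := by
  refine measurable_of_dist_le (fun x hx x' hx' => ?_) (fun x hx x' hx' => ?_)
  · rw [toLeft_of_mem hx, toLeft_of_mem hx']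
    refine dist_le_of_forall dist_nonneg (fun t => ?_) ?_
    · change dist (max (x - (t : ℝ)) 0) (max (x' - (t : ℝ)) 0) ≤ _
      rw [Real.dist_eq, Real.dist_eq]
      refine (abs_max_sub_max_le_abs _ _ _).trans (le_of_eq ?_)
      congr 1; ring
    · rw [runLeft, runLeft, θ_ofHitting, θ_ofHitting]
      simpa using Real.lipschitzWith_toNNReal.dist_le_mul x x'
  · rw [toLeft_of_notMem hx, toLeft_of_notMem hx']
    exact dist_rest_le _ _

theorem measurable_toRight : Measurable toRight := by
  refine measurable_of_dist_le (fun x hx x' hx' => ?_) (fun x hx x' hx' => ?_)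
  · rw [toRight_of_mem hx, toRight_of_mem hx']
    refine dist_le_of_forall dist_nonneg (fun t => ?_) ?_
    · change dist (min (x + (t : ℝ)) 1) (min (x' + (t : ℝ)) 1) ≤ _
      rw [Real.dist_eq, Real.dist_eq]
      refine (abs_min_sub_min_le_max _ _ _ _).trans (le_of_eq ?_)
      simp
    · rw [runRight, runRight, θ_ofHitting, θ_ofHitting]
      refine (Real.lipschitzWith_toNNReal.dist_le_mul _ _).trans (le_of_eq ?_)
      rw [NNReal.coe_one, one_mul, Real.dist_eq, Real.dist_eq, abs_sub_comm]
      congr 1; ring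
  · rw [toRight_of_notMem hx, toRight_of_notMem hx']
    exact dist_rest_le _ _

end StoppedPath

end Straight

end

section

/-! ### The minimal cost of reaching the solid. -/

section Cost

/-- The cost `∫_0^x L⁺` of running from `x` to `0`. -/
def costLeft (L : ℝ → ℝ) (x : ℝ) : ℝ := ∫ t in (0 : ℝ)..x, max (L t) 0

/-- The cost `∫_x^1 L⁺` of running from `x` to `1`. -/
def costRight (L : ℝ → ℝ) (x : ℝ) : ℝ := ∫ t in x..(1 : ℝ), max (L t) 0

/-- The minimal cost of reaching the solid from `x`. -/
def minCost (L : ℝ → ℝ) (x : ℝ) : ℝ := min (costLeft L x) (costRight L x)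

variable {L : ℝ → ℝ}

theorem locallyIntegrable_posPart (hi : LocallyIntegrable L volume) :
    LocallyIntegrable (fun t => max (L t) 0) volume := by
  intro x
  obtain ⟨s, hs, h⟩ := hi x
  exact ⟨s, hs, h.pos_part⟩

theorem intervalIntegrable_posPart (hi : LocallyIntegrable L volume) (a b : ℝ) :
    IntervalIntegrable (fun t => max (L t) 0) volume a b :=
  (LocallyIntegrable.integrableOn_isCompact (locallyIntegrable_posPart hi) isCompact_uIcc).intervalIntegrable

theorem lintegral_Ioc_ofReal (hi : LocallyIntegrable L volume) {a b : ℝ} (h : a ≤ b) :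
    ∫⁻ x in Ioc a b, ENNReal.ofReal (L x) = ENNReal.ofReal (∫ x in a..b, max (L x) 0) := by
  rw [intervalIntegral.integral_of_le h, ofReal_integral_eq_lintegral_ofReal
    ((intervalIntegrable_iff_integrableOn_Ioc_of_le h).1 (intervalIntegrable_posPart hi a b))
    (ae_of_all _ fun x => le_max_right _ _)]
  simp [ENNReal.ofReal_max]

theorem lintegral_uIcc_ofReal (hi : LocallyIntegrable L volume) (a b : ℝ) :
    ∫⁻ x in uIcc a b, ENNReal.ofReal (L x) = ENNReal.ofReal |∫ x in a..b, max (L x) 0| := by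
  have key : ∀ a b : ℝ, a ≤ b →
      ∫⁻ x in uIcc a b, ENNReal.ofReal (L x) = ENNReal.ofReal |∫ x in a..b, max (L x) 0| := by
    intro a b h
    rw [uIcc_of_le h, ← Measure.restrict_congr_set (Ioc_ae_eq_Icc (μ := volume)),
      lintegral_Ioc_ofReal hi h, abs_of_nonneg]
    exact intervalIntegral.integral_nonneg h fun x _ => le_max_right _ _
  rcases le_total a b with h | h
  · exact key a b h
  · rw [uIcc_comm, intervalIntegral.integral_symm, abs_neg]
    exact key b a h

theorem costLeft_sub (hi : LocallyIntegrable L volume) (x z : ℝ) :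
    costLeft L x - costLeft L z = ∫ t in z..x, max (L t) 0 :=
  intervalIntegral.integral_interval_sub_left (intervalIntegrable_posPart hi _ _)
    (intervalIntegrable_posPart hi _ _)

theorem costRight_sub (hi : LocallyIntegrable L volume) (x z : ℝ) :
    costRight L z - costRight L x = ∫ t in z..x, max (L t) 0 := by
  have h := intervalIntegral.integral_add_adjacent_intervals (intervalIntegrable_posPart hi z x)
    (intervalIntegrable_posPart hi x 1)
  rw [costRight, costRight, ← h]
  ring

theorem integral_posPart_nonneg {a b : ℝ} (h : a ≤ b) : 0 ≤ ∫ t in a..b, max (L t) 0 :=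
  intervalIntegral.integral_nonneg h fun _ _ => le_max_right _ _

theorem costLeft_mono (hi : LocallyIntegrable L volume) : Monotone (costLeft L) := fun x z h => by
  have := costLeft_sub hi z x
  have := integral_posPart_nonneg (L := L) h
  linarith

theorem costRight_anti (hi : LocallyIntegrable L volume) : Antitone (costRight L) := fun x z h => by
  have := costRight_sub hi z x
  have := integral_posPart_nonneg (L := L) h
  linarith

theorem continuous_costLeft (hi : LocallyIntegrable L volume) : Continuous (costLeft L) :=
  intervalIntegral.continuous_primitive (fun a b => intervalIntegrable_posPart hi a b) 0

theorem continuous_costRight (hi : LocallyIntegrable L volume) : Continuous (costRight L) := by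
  have h : costRight L = fun x => costRight L 0 - costLeft L x := by
    funext x
    have := costRight_sub hi x 0
    rw [costLeft]
    linarith
  rw [h]
  exact continuous_const.sub (continuous_costLeft hi)

theorem continuous_minCost (hi : LocallyIntegrable L volume) : Continuous (minCost L) :=
  (continuous_costLeft hi).min (continuous_costRight hi)

theorem costLeft_zero : costLeft L 0 = 0 := intervalIntegral.integral_same

theorem costRight_one : costRight L 1 = 0 := intervalIntegral.integral_same

/-- Interval integrals are oriented, so to the left of `0` or to the right of `1` one of the two
costs has the wrong sign. `ENNReal.ofReal` later turns this into the correct cost `0`. -/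
theorem minCost_nonpos (hi : LocallyIntegrable L volume) {x : ℝ} (hx : x ∈ solid) :
    minCost L x ≤ 0 := by
  rcases hx with hx | hx
  · exact (min_le_left _ _).trans ((costLeft_mono hi hx).trans costLeft_zero.le)
  · exact (min_le_right _ _).trans ((costRight_anti hi hx).trans costRight_one.le)

theorem minCost_le_add (hi : LocallyIntegrable L volume) (x z : ℝ) :
    minCost L x ≤ |∫ t in x..z, max (L t) 0| + minCost L z := by
  rw [minCost, minCost, ← min_add_add_left]
  have h1 := costLeft_sub hi z x
  have h2 := costRight_sub hi z x
  have h3 := neg_abs_le (∫ t in x..z, max (L t) 0)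
  have h4 := le_abs_self (∫ t in x..z, max (L t) 0)
  exact min_le_min (by linarith) (by linarith)

namespace StoppedPath

/-- Between times `r` and `θ` the path sweeps the interval from `y_r` to a point of the solid, where
`minCost` is at most `0`; the area inequality bounds the cost below by that of the interval. -/
theorem minCost_le_tailCost (hm : Measurable L) (hi : LocallyIntegrable L volume)
    (y : StoppedPath solid) {r : ℝ≥0} (hr : r ≤ y.θ) :
    ENNReal.ofReal (minCost L (y.pos r)) ≤ y.tailCost L r := by
  have h1 := lintegral_uIcc_le y.lipschitz_pos (NNReal.coe_le_coe.2 hr) hm.ennreal_ofReal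
  have h2 : minCost L (y.pos y.θ) ≤ 0 := by
    refine minCost_nonpos hi ?_
    have := y.pos_θ_mem
    rwa [closure_solid] at this
  rw [lintegral_uIcc_ofReal hi] at h1
  refine le_trans (ENNReal.ofReal_le_ofReal ?_) h1
  have := minCost_le_add hi (y.pos r) (y.pos y.θ)
  linarith

theorem minCost_le_cost (hm : Measurable L) (hi : LocallyIntegrable L volume)
    (y : StoppedPath solid) : ENNReal.ofReal (minCost L (y.pos 0)) ≤ y.cost L := by
  simpa [cost] using y.minCost_le_tailCost hm hi (r := 0) zero_le

theorem cost_of_notMem_Ioo (y : StoppedPath solid) (h : y.pos 0 ∉ Ioo (0 : ℝ) 1) :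
    y.cost L = 0 := by
  have h0 : y.θ = 0 := by
    rw [pos_zero_mem_Ioo_iff] at h
    simpa using h
  simp [cost, tailCost, h0]

theorem cost_toLeft (hi : LocallyIntegrable L volume) {x : ℝ}
    (hx : x ∈ Ioo (0 : ℝ) 1) : (toLeft x).cost L = ENNReal.ofReal (costLeft L x) := by
  rw [costLeft, ← lintegral_Ioc_ofReal hi hx.1.le, cost, tailCost, toLeft_θ hx, NNReal.coe_zero,
    Real.coe_toNNReal x hx.1.le]
  have h : ∀ t ∈ Ioc (0 : ℝ) x, ENNReal.ofReal (L ((toLeft x).pos t)) = ENNReal.ofReal (L (x - t)) := by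
    intro t ht
    rw [toLeft_pos hx ht.1.le, max_eq_left (by linarith [ht.2])]
  rw [setLIntegral_congr_fun measurableSet_Ioc h, Measure.restrict_congr_set Ioc_ae_eq_Icc]
  have hp := (Measure.measurePreserving_sub_left (volume : Measure ℝ) x).setLIntegral_comp_preimage_emb
    (MeasurableEquiv.subLeft x).measurableEmbedding (fun t => ENNReal.ofReal (L t)) (Icc 0 x)
  simpa using hp

theorem cost_toRight (hi : LocallyIntegrable L volume) {x : ℝ}
    (hx : x ∈ Ioo (0 : ℝ) 1) : (toRight x).cost L = ENNReal.ofReal (costRight L x) := by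
  have h1 : (0 : ℝ) ≤ 1 - x := by linarith [hx.2]
  rw [costRight, ← lintegral_Ioc_ofReal hi hx.2.le, cost, tailCost, toRight_θ hx, NNReal.coe_zero,
    Real.coe_toNNReal _ h1]
  have h : ∀ t ∈ Ioc (0 : ℝ) (1 - x),
      ENNReal.ofReal (L ((toRight x).pos t)) = ENNReal.ofReal (L (x + t)) := by
    intro t ht
    rw [toRight_pos hx ht.1.le, min_eq_left (by linarith [ht.2])]
  rw [setLIntegral_congr_fun measurableSet_Ioc h]
  have hp := (measurePreserving_add_left volume x).setLIntegral_comp_preimage_emb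
    (measurableEmbedding_addLeft x) (fun t => ENNReal.ofReal (L t)) (Ioc x 1)
  simpa using hp

end StoppedPath

end Cost

end

section

/-! ### Cost-minimizing paths are straight until `β`. -/

section Tight

/-- If `μ ≤ ν` and `∫ f dμ = ∫ f dν < ∞`, then `μ` and `ν` agree on `{f ≠ 0}`. -/
theorem measure_eq_of_lintegral_eq {α : Type*} [MeasurableSpace α] {μ ν : Measure α}
    [IsFiniteMeasure μ] (h : μ ≤ ν) {f : α → ℝ≥0∞} (hf : Measurable f)
    (hfi : ∫⁻ x, f x ∂μ ≠ ⊤) (heq : ∫⁻ x, f x ∂ν ≤ ∫⁻ x, f x ∂μ) :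
    ν {x | f x ≠ 0} = μ {x | f x ≠ 0} := by
  have h1 : ν - μ + μ = ν := Measure.sub_add_cancel_of_le h
  have h2 : ∫⁻ x, f x ∂(ν - μ) = 0 := by
    have : ∫⁻ x, f x ∂(ν - μ) + ∫⁻ x, f x ∂μ ≤ 0 + ∫⁻ x, f x ∂μ := by
      rw [← lintegral_add_measure, h1, zero_add]
      exact heq
    exact le_antisymm ((ENNReal.add_le_add_iff_right hfi).1 this) zero_le
  have h3 : (ν - μ) {x | f x ≠ 0} = 0 := by
    have := (lintegral_eq_zero_iff hf).1 h2
    exact this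
  rw [← h1, Measure.add_apply, h3, zero_add]

/-- The almost sure properties of a pair `(y, β)` under an equilibrium. -/
structure IsTight (L : ℝ → ℝ) (p : StoppedPath solid × ℝ≥0) : Prop where
  cost_eq : p.1.cost L = ENNReal.ofReal (minCost L (p.1.pos 0))
  le_θ : p.2 ≤ p.1.θ
  exit : p.2 = p.1.θ → p.1.pos p.1.θ = 0 ∨ p.1.pos p.1.θ = 1
  pos_ae : ∀ᵐ t : ℝ, t ∈ Ioc (0 : ℝ) p.2 → 0 < L (p.1.pos t)

/-- The initial point of a pair `(y, β)`. -/
def start (p : StoppedPath solid × ℝ≥0) : ℝ := p.1.pos 0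

/-- The point `y_β` of a pair `(y, β)`. -/
def finish (p : StoppedPath solid × ℝ≥0) : ℝ := p.1.pos p.2

theorem measurable_start : Measurable start :=
  (StoppedPath.measurable_pos 0).comp measurable_fst

theorem measurable_finish : Measurable finish :=
  StoppedPath.measurable_pos_comp measurable_snd.coe_nnreal_real measurable_fst

namespace IsTight

variable {L : ℝ → ℝ} {p : StoppedPath solid × ℝ≥0}

/-- The cost splits at `r` into a running and a tail part. The first is at least the cost of the
interval swept, the second at least `minCost (y_r)`, and the sum of these lower bounds is at least
`minCost (y_0)`. For a tight path the two ends of this chain agree and are finite, hence every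
inequality is an equality. -/
theorem tailCost_aux (h : IsTight L p) (hm : Measurable L) (hi : LocallyIntegrable L volume)
    {r : ℝ≥0} (hr : r ≤ p.1.θ) :
    p.1.tailCost L r = ENNReal.ofReal (minCost L (p.1.pos r)) ∧
      ∫⁻ t in Ioc (0 : ℝ) r, ENNReal.ofReal (L (p.1.pos t)) =
        ∫⁻ x in uIcc (p.1.pos 0) (p.1.pos r), ENNReal.ofReal (L x) ∧
      ENNReal.ofReal (minCost L (p.1.pos 0)) =
        ENNReal.ofReal |∫ x in p.1.pos 0..p.1.pos r, max (L x) 0| +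
          ENNReal.ofReal (minCost L (p.1.pos r)) := by
  have h1 := p.1.tailCost_eq_add L (zero_le (a := r)) hr
  have h2 := p.1.minCost_le_tailCost hm hi hr
  have h3 := lintegral_uIcc_le p.1.lipschitz_pos r.coe_nonneg hm.ennreal_ofReal
  have h4 : ENNReal.ofReal (minCost L (p.1.pos 0)) ≤
      ENNReal.ofReal |∫ x in p.1.pos 0..p.1.pos r, max (L x) 0| +
          ENNReal.ofReal (minCost L (p.1.pos r)) :=
    (ENNReal.ofReal_le_ofReal (minCost_le_add hi _ _)).trans ENNReal.ofReal_add_le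
  have h5 := h.cost_eq
  rw [StoppedPath.cost, h1, NNReal.coe_zero] at h5
  rw [← lintegral_uIcc_ofReal hi] at h4 ⊢
  set a := ∫⁻ t in Ioc (0 : ℝ) r, ENNReal.ofReal (L (p.1.pos t))
  set a' := ∫⁻ x in uIcc (p.1.pos 0) (p.1.pos r), ENNReal.ofReal (L x)
  have h6 : a + p.1.tailCost L r ≤ a' + ENNReal.ofReal (minCost L (p.1.pos r)) := h5 ▸ h4
  have h7 : a + p.1.tailCost L r ≠ ⊤ := h5 ▸ ENNReal.ofReal_ne_top
  have ha : a ≠ ⊤ := fun h => h7 (by rw [h, top_add])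
  have ha' : a' ≠ ⊤ := fun h => ha (top_le_iff.1 (h ▸ h3))
  have e1 : p.1.tailCost L r = ENNReal.ofReal (minCost L (p.1.pos r)) := by
    refine le_antisymm ?_ h2
    exact (ENNReal.add_le_add_iff_left ha').1 ((add_le_add_left h3 _).trans h6)
  have e2 : a = a' := by
    refine le_antisymm ?_ h3
    rw [e1] at h6
    exact (ENNReal.add_le_add_iff_right ENNReal.ofReal_ne_top).1 h6
  exact ⟨e1, e2, by rw [← h5, e1, e2]⟩

theorem tailCost_eq (h : IsTight L p) (hm : Measurable L) (hi : LocallyIntegrable L volume)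
    {r : ℝ≥0} (hr : r ≤ p.1.θ) :
    p.1.tailCost L r = ENNReal.ofReal (minCost L (p.1.pos r)) := (h.tailCost_aux hm hi hr).1

/-- The occupation measure of the path on `(0, β]` dominates Lebesgue measure on the interval
between start and finish, and both have the same finite integral of `L⁺`. Hence they agree on `{L >
0}`. There the first has its full mass `β`, and the second at most the length of the interval. -/
theorem abs_finish_sub_start (h : IsTight L p) (hm : Measurable L)
    (hi : LocallyIntegrable L volume) : |finish p - start p| = p.2 := by
  have hle : |finish p - start p| ≤ p.2 := by
    have := p.1.lipschitz_pos.dist_le_mul p.2 0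
    simpa [finish, start, Real.dist_eq] using this
  refine le_antisymm hle ?_
  have h1 := restrict_uIcc_le_map p.1.lipschitz_pos p.2.coe_nonneg
  have hpm : Measurable p.1.pos := p.1.lipschitz_pos.continuous.measurable
  have h2 : ∫⁻ x, ENNReal.ofReal (L x) ∂((volume.restrict (Ioc (0 : ℝ) p.2)).map p.1.pos) ≤
      ∫⁻ x in uIcc (p.1.pos 0) (p.1.pos p.2), ENNReal.ofReal (L x) := by
    rw [lintegral_map hm.ennreal_ofReal hpm, (h.tailCost_aux hm hi h.le_θ).2.1]
  have : IsFiniteMeasure (volume.restrict (uIcc (p.1.pos 0) (p.1.pos p.2))) :=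
    ⟨by rw [Measure.restrict_apply_univ]; exact isCompact_uIcc.measure_lt_top⟩
  have h3 := measure_eq_of_lintegral_eq h1 hm.ennreal_ofReal
    (by rw [lintegral_uIcc_ofReal hi]; exact ENNReal.ofReal_ne_top) h2
  have hset : {x | ENNReal.ofReal (L x) ≠ 0} = {x | 0 < L x} := by
    ext x; simp
  rw [hset] at h3
  have hms : MeasurableSet {x | 0 < L x} := measurableSet_lt measurable_const hm
  rw [Measure.map_apply hpm hms, Measure.restrict_apply (hpm hms)] at h3
  have h4 : volume (p.1.pos ⁻¹' {x | 0 < L x} ∩ Ioc (0 : ℝ) p.2) = ENNReal.ofReal p.2 := by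
    rw [← sub_zero (p.2 : ℝ), ← Real.volume_Ioc, sub_zero]
    refine measure_congr ?_
    filter_upwards [h.pos_ae] with t ht
    exact propext ⟨fun h => h.2, fun h => ⟨ht h, h⟩⟩
  have h5 : volume.restrict (uIcc (p.1.pos 0) (p.1.pos p.2)) {x | 0 < L x} ≤
      ENNReal.ofReal |finish p - start p| := by
    refine (measure_mono (subset_univ _)).trans ?_
    rw [Measure.restrict_apply_univ, Real.volume_interval]
    rfl
  rw [← h3, h4] at h5
  exact (ENNReal.ofReal_le_ofReal_iff (abs_nonneg _)).1 h5

/-- A `1`-Lipschitz motion which covers the distance `β` in time `β` has no slack at intermediate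
times. -/
theorem pos_eq_sub (h : IsTight L p) (hm : Measurable L) (hi : LocallyIntegrable L volume)
    (hle : finish p ≤ start p) {t : ℝ} (h0 : 0 ≤ t) (ht : t ≤ p.2) :
    p.1.pos t = start p - t := by
  have h1 := h.abs_finish_sub_start hm hi
  rw [abs_of_nonpos (by linarith)] at h1
  have h2 := p.1.lipschitz_pos.dist_le_mul t 0
  have h3 := p.1.lipschitz_pos.dist_le_mul p.2 t
  rw [NNReal.coe_one, one_mul, Real.dist_eq, Real.dist_eq] at h2 h3
  rw [sub_zero, abs_of_nonneg h0] at h2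
  rw [abs_of_nonneg (sub_nonneg.2 ht)] at h3
  change _ = p.1.pos 0 - t
  change -(p.1.pos p.2 - p.1.pos 0) = _ at h1
  have h4 := (abs_le.1 h2).1
  have h5 := (abs_le.1 h3).1
  linarith

theorem pos_eq_add (h : IsTight L p) (hm : Measurable L) (hi : LocallyIntegrable L volume)
    (hle : start p ≤ finish p) {t : ℝ} (h0 : 0 ≤ t) (ht : t ≤ p.2) :
    p.1.pos t = start p + t := by
  have h1 := h.abs_finish_sub_start hm hi
  rw [abs_of_nonneg (by linarith)] at h1
  have h2 := p.1.lipschitz_pos.dist_le_mul t 0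
  have h3 := p.1.lipschitz_pos.dist_le_mul p.2 t
  rw [NNReal.coe_one, one_mul, Real.dist_eq, Real.dist_eq] at h2 h3
  rw [sub_zero, abs_of_nonneg h0] at h2
  rw [abs_of_nonneg (sub_nonneg.2 ht)] at h3
  change _ = p.1.pos 0 + t
  change (p.1.pos p.2 - p.1.pos 0) = _ at h1
  have h4 := (abs_le.1 h2).2
  have h5 := (abs_le.1 h3).2
  linarith

theorem ae_pos_left (h : IsTight L p) (hm : Measurable L) (hi : LocallyIntegrable L volume)
    (hle : finish p ≤ start p) : ∀ᵐ x : ℝ, x ∈ Ioo (finish p) (start p) → 0 < L x := by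
  have h1 := h.abs_finish_sub_start hm hi
  rw [abs_of_nonpos (by linarith)] at h1
  have hq := (Measure.measurePreserving_sub_left (volume : Measure ℝ)
    (start p)).quasiMeasurePreserving
  filter_upwards [hq.ae h.pos_ae] with x hx hx'
  have h2 : start p - x ∈ Ioc (0 : ℝ) p.2 := ⟨by linarith [hx'.2], by linarith [hx'.1]⟩
  have := hx h2
  rwa [h.pos_eq_sub hm hi hle h2.1.le h2.2, sub_sub_cancel] at this

theorem ae_pos_right (h : IsTight L p) (hm : Measurable L) (hi : LocallyIntegrable L volume)
    (hle : start p ≤ finish p) : ∀ᵐ x : ℝ, x ∈ Ioo (start p) (finish p) → 0 < L x := by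
  have h1 := h.abs_finish_sub_start hm hi
  rw [abs_of_nonneg (by linarith)] at h1
  have hq := (measurePreserving_sub_right (volume : Measure ℝ) (start p)).quasiMeasurePreserving
  filter_upwards [hq.ae h.pos_ae] with x hx hx'
  have h2 : x - start p ∈ Ioc (0 : ℝ) p.2 := ⟨by linarith [hx'.1], by linarith [hx'.2]⟩
  have := hx h2
  rwa [h.pos_eq_add hm hi hle h2.1.le h2.2, add_sub_cancel] at this

end IsTight

theorem integral_posPart_pos {L : ℝ → ℝ} (hi : LocallyIntegrable L volume) {a b : ℝ} (h : a < b)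
    (hae : ∀ᵐ x : ℝ, x ∈ Ioo a b → 0 < L x) : 0 < ∫ x in a..b, max (L x) 0 := by
  have hnn : 0 ≤ᵐ[volume] fun x => max (L x) 0 := ae_of_all _ fun x => le_max_right _ _
  rw [intervalIntegral.integral_pos_iff_support_of_nonneg_ae hnn
    (intervalIntegrable_posPart hi a b)]
  refine ⟨h, ?_⟩
  have : volume (Ioo a b) ≤ volume (Function.support (fun x => max (L x) 0) ∩ Ioc a b) := by
    refine measure_mono_ae ?_
    filter_upwards [hae] with x hx hx'
    exact ⟨(lt_max_of_lt_left (hx hx')).ne', Ioo_subset_Ioc_self hx'⟩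
  refine lt_of_lt_of_le ?_ this
  simpa using h

namespace IsTight

variable {L : ℝ → ℝ} {p : StoppedPath solid × ℝ≥0}

theorem minCost_start (h : IsTight L p) (hm : Measurable L) (hi : LocallyIntegrable L volume)
    (hθ : 0 < p.1.θ) :
    minCost L (start p) = |∫ x in start p..finish p, max (L x) 0| + minCost L (finish p) := by
  have nn : ∀ t, 0 ≤ minCost L (p.1.pos t) := fun t => by
    have := p.1.pos_mem_Icc hθ t
    exact le_min (integral_posPart_nonneg this.1) (integral_posPart_nonneg this.2)
  have h1 := (h.tailCost_aux hm hi h.le_θ).2.2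
  rw [← ENNReal.ofReal_add (abs_nonneg _) (nn _), ENNReal.ofReal_eq_ofReal_iff (nn _)
    (add_nonneg (abs_nonneg _) (nn _))] at h1
  exact h1

theorem θ_pos_of_ne (h : IsTight L p) (hne : start p ≠ finish p) : 0 < p.1.θ := by
  rw [pos_iff_ne_zero]
  intro h0
  have : p.2 = 0 := le_antisymm (h0 ▸ h.le_θ) zero_le
  exact hne (by simp [start, finish, this])

/-- Moving left across an interval of cost `I > 0` lowers `costLeft` by `I` and raises `costRight`
by `I`, while tightness says that `minCost` drops by exactly `I`. If `costRight` were strictly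
smaller at the start, neither cost at the finish could be that small. -/
theorem costLeft_le_costRight (h : IsTight L p) (hm : Measurable L)
    (hi : LocallyIntegrable L volume) (hlt : finish p < start p) :
    costLeft L (start p) ≤ costRight L (start p) := by
  have h1 := h.minCost_start hm hi (h.θ_pos_of_ne hlt.ne')
  have h2 := integral_posPart_pos hi hlt (h.ae_pos_left hm hi hlt.le)
  rw [intervalIntegral.integral_symm, abs_neg, abs_of_pos h2] at h1
  have h3 := costLeft_sub hi (start p) (finish p)
  have h4 := costRight_sub hi (start p) (finish p)
  by_contra! hc
  have h5 : minCost L (start p) = costRight L (start p) := min_eq_right hc.le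
  rcases min_choice (costLeft L (finish p)) (costRight L (finish p)) with h6 | h6 <;>
  · rw [h5, minCost, h6] at h1
    linarith

theorem costRight_le_costLeft (h : IsTight L p) (hm : Measurable L)
    (hi : LocallyIntegrable L volume) (hlt : start p < finish p) :
    costRight L (start p) ≤ costLeft L (start p) := by
  have h1 := h.minCost_start hm hi (h.θ_pos_of_ne hlt.ne)
  have h2 := integral_posPart_pos hi hlt (h.ae_pos_right hm hi hlt.le)
  rw [abs_of_pos h2] at h1
  have h3 := costLeft_sub hi (finish p) (start p)
  have h4 := costRight_sub hi (finish p) (start p)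
  by_contra! hc
  have h5 : minCost L (start p) = costLeft L (start p) := min_eq_left hc.le
  rcases min_choice (costLeft L (finish p)) (costRight L (finish p)) with h6 | h6 <;>
  · rw [h5, minCost, h6] at h1
    linarith

/-- Paths moving left start on the left of a point at which both costs agree. -/
theorem start_le (h : IsTight L p) (hm : Measurable L) (hi : LocallyIntegrable L volume)
    {c : ℝ} (hc : costLeft L c = costRight L c) (hlt : finish p < start p) : start p ≤ c := by
  by_contra! hlt'
  have h1 := h.costLeft_le_costRight hm hi hlt
  -- The path may finish on either side of `c`; the part of the run which stays to the right of `c`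
  -- already makes `costLeft` strictly decrease. With `costLeft ≤ costRight` at the start this
  -- contradicts equality at `c`.
  have h2 : costLeft L (max c (finish p)) < costLeft L (start p) := by
    have := costLeft_sub hi (start p) (max c (finish p))
    have h3 := integral_posPart_pos hi (max_lt hlt' hlt) ((h.ae_pos_left hm hi hlt.le).mono
      fun x hx hx' => hx ⟨(le_max_right _ _).trans_lt hx'.1, hx'.2⟩)
    linarith
  have h3 := costLeft_mono hi (le_max_left c (finish p))
  have h4 := costRight_anti hi hlt'.le
  linarith

theorem le_start (h : IsTight L p) (hm : Measurable L) (hi : LocallyIntegrable L volume)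
    {c : ℝ} (hc : costLeft L c = costRight L c) (hlt : start p < finish p) : c ≤ start p := by
  by_contra! hlt'
  have h1 := h.costRight_le_costLeft hm hi hlt
  have h2 : costRight L (min c (finish p)) < costRight L (start p) := by
    have := costRight_sub hi (min c (finish p)) (start p)
    have h3 := integral_posPart_pos hi (lt_min hlt' hlt) ((h.ae_pos_right hm hi hlt.le).mono
      fun x hx hx' => hx ⟨hx'.1, hx'.2.trans_le (min_le_right _ _)⟩)
    linarith
  have h3 := costRight_anti hi (min_le_left c (finish p))
  have h4 := costLeft_mono hi hlt'.le
  linarith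

theorem finish_mem_Icc (h : 0 < p.1.θ) : finish p ∈ Icc (0 : ℝ) 1 := p.1.pos_mem_Icc h _

theorem finish_mem_solid_iff (h : IsTight L p) : finish p ∈ solid ↔ p.2 = p.1.θ := by
  constructor
  · intro hf
    refine le_antisymm h.le_θ (not_lt.1 fun hlt => ?_)
    exact notMem_solid.2 (p.1.pos_mem_Ioo p.2.coe_nonneg (NNReal.coe_lt_coe.2 hlt)) hf
  · intro hf
    have := p.1.pos_θ_mem
    rwa [closure_solid, ← hf] at this

/-- Here `β = θ = 0`, so the exit condition constrains the starting point: mass at rest sits only at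
`0` and `1`. -/
theorem start_of_θ_eq_zero (h : IsTight L p) (h0 : p.1.θ = 0) :
    finish p = start p ∧ (start p = 0 ∨ start p = 1) := by
  have h1 : p.2 = 0 := le_antisymm (h0 ▸ h.le_θ) zero_le
  refine ⟨by simp [start, finish, h1], ?_⟩
  have := h.exit (h1.trans h0.symm)
  simpa [h0, start] using this

end IsTight

end Tight

end

section

/-! ### The measure theoretic boundary and the initial boundary energy. -/

section Boundary

/-- A one-sided interval of length `r` inside the ball of radius `r` suffices for positive density
at `0` and `1`. -/
theorem one_le_limsup_of_subset {f : ℝ → Set ℝ} {a b : ℝ → ℝ} (hab : ∀ r, b r - a r = r)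
    (h : ∀ r ∈ Ioo (0 : ℝ) 1, Ioo (a r) (b r) ⊆ f r) :
    (1 : ℝ≥0∞) ≤ limsup (fun r : ℝ => volume (f r) /
        ENNReal.ofReal r ^ Module.finrank ℝ ℝ) (𝓝[>] 0) := by
  refine le_trans ?_ liminf_le_limsup
  refine le_liminf_of_le isCobounded_ge_of_top ?_
  filter_upwards [Ioo_mem_nhdsGT (zero_lt_one (α := ℝ))] with r hr
  rw [Module.finrank_self, pow_one, ENNReal.le_div_iff_mul_le
    (Or.inl (ENNReal.ofReal_pos.2 hr.1).ne') (Or.inl ENNReal.ofReal_ne_top), one_mul]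
  refine le_trans (le_of_eq ?_) (measure_mono (h r hr))
  rw [Real.volume_Ioo, hab]

theorem limsup_eq_zero_of_disjoint {f : ℝ → Set ℝ} {s : ℝ} (hs : 0 < s)
    (h : ∀ r ∈ Ioo (0 : ℝ) s, f r = ∅) :
    limsup (fun r : ℝ => volume (f r) / ENNReal.ofReal r ^ Module.finrank ℝ ℝ) (𝓝[>] 0) = 0 := by
  have : (fun r : ℝ => volume (f r) / ENNReal.ofReal r ^ Module.finrank ℝ ℝ) =ᶠ[𝓝[>] 0]
      fun _ => 0 := by
    filter_upwards [Ioo_mem_nhdsGT hs] with r hr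
    rw [h r hr, measure_empty, ENNReal.zero_div]
  rw [limsup_congr this, limsup_const]

theorem essBoundary_solid : essBoundary solid = {0, 1} := by
  ext x
  have h01 : x ∉ ({0, 1} : Set ℝ) → x ∉ essBoundary solid := by
    intro hx hmem
    simp only [mem_insert_iff, mem_singleton_iff, not_or] at hx
    by_cases hs : x ∈ Ioo (0 : ℝ) 1
    -- The radius is the distance from `x` to the solid.
    · refine hmem.1.ne' (limsup_eq_zero_of_disjoint (lt_min hs.1 (sub_pos.2 hs.2)) fun r hr => ?_)
      rw [← disjoint_iff_inter_eq_empty, disjoint_left]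
      intro z hz hz'
      rw [Metric.mem_closedBall, Real.dist_eq, abs_le] at hz
      have h1 := hr.2.trans_le (min_le_left _ _)
      have h2 := hr.2.trans_le (min_le_right _ _)
      rcases hz' with hz' | hz' <;> simp only [mem_Iic, mem_Ici] at hz' <;> linarith
    · have hsolid : x ∈ solid := by
        by_contra h; exact hs (notMem_solid.1 h)
      -- This is the distance from `x` to the interval `(0, 1)`.
      have hpos : 0 < max (-x) (x - 1) := by
        rcases hsolid with h | h
        · exact lt_max_of_lt_left (neg_pos.2 (lt_of_le_of_ne h hx.1))
        · exact lt_max_of_lt_right (sub_pos.2 (lt_of_le_of_ne h (Ne.symm hx.2)))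
      refine hmem.2.ne' (limsup_eq_zero_of_disjoint hpos fun r hr => ?_)
      rw [sdiff_eq_empty]
      intro z hz
      rw [Metric.mem_closedBall, Real.dist_eq, abs_le] at hz
      rcases lt_max_iff.1 hr.2 with h | h
      · left; simp only [mem_Iic]; linarith
      · right; simp only [mem_Ici]; linarith
  constructor
  · intro h
    by_contra hx
    exact h01 hx h
  · rintro (rfl | rfl)
    · refine ⟨one_pos.trans_le (one_le_limsup_of_subset (a := fun r => -r) (b := fun _ => 0)
        (fun r => by ring) fun r hr z hz => ⟨?_, Or.inl hz.2.le⟩),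
        one_pos.trans_le (one_le_limsup_of_subset (a := fun _ => 0) (b := fun r => r)
        (fun r => by ring) fun r hr z hz => ⟨?_, ?_⟩)⟩
      · rw [Metric.mem_closedBall, Real.dist_eq, abs_le]
        constructor <;> linarith [hz.1, hz.2, hr.1]
      · rw [Metric.mem_closedBall, Real.dist_eq, abs_le]
        constructor <;> linarith [hz.1, hz.2, hr.1]
      · exact notMem_solid.2 ⟨hz.1, hz.2.trans hr.2⟩
    · refine ⟨one_pos.trans_le (one_le_limsup_of_subset (a := fun _ => 1) (b := fun r => 1 + r)
        (fun r => by ring) fun r hr z hz => ⟨?_, Or.inr hz.1.le⟩),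
        one_pos.trans_le (one_le_limsup_of_subset (a := fun r => 1 - r) (b := fun _ => 1)
        (fun r => by ring) fun r hr z hz => ⟨?_, ?_⟩)⟩
      · rw [Metric.mem_closedBall, Real.dist_eq, abs_le]
        constructor <;> linarith [hz.1, hz.2, hr.1]
      · rw [Metric.mem_closedBall, Real.dist_eq, abs_le]
        constructor <;> linarith [hz.1, hz.2, hr.1]
      · exact notMem_solid.2 ⟨by linarith [hz.1, hr.2], hz.2⟩

/-- For `d = 1` the measure `ℋ^{d-1}` is `ℋ⁰`, which gives each of the two boundary points mass one.
-/
theorem boundaryEnergy_solid (γ : ℝ) (V₀ : ℝ → ℝ) :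
    boundaryEnergy γ solid V₀ = ENNReal.ofReal (γ + V₀ 0) • Measure.dirac 0 +
      ENNReal.ofReal (γ + V₀ 1) • Measure.dirac 1 := by
  have h0 : ((Module.finrank ℝ ℝ : ℝ) - 1) = 0 := by simp
  have h1 : (Measure.hausdorffMeasure (0 : ℝ) : Measure ℝ).restrict {0, 1} =
      Measure.dirac 0 + Measure.dirac 1 := by
    rw [insert_eq, Measure.restrict_union (by simp) (measurableSet_singleton _),
      Measure.restrict_singleton, Measure.restrict_singleton,
      Measure.hausdorffMeasure_zero_singleton, Measure.hausdorffMeasure_zero_singleton,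
      one_smul, one_smul]
  rw [boundaryEnergy, h0, essBoundary_solid, h1]
  ext s hs
  rw [withDensity_apply _ hs, ← lintegral_indicator hs, lintegral_add_measure, lintegral_dirac,
    lintegral_dirac]
  simp only [Measure.coe_add, Measure.coe_smul, Pi.add_apply, Pi.smul_apply, smul_eq_mul,
    Measure.dirac_apply' _ hs]
  by_cases h : (0 : ℝ) ∈ s <;> by_cases h' : (1 : ℝ) ∈ s <;> simp [h, h']

end Boundary

/-! ### Optimality is equivalent to almost sure minimal cost. -/

section Optimality

variable {L : ℝ → ℝ}

open Classical in
/-- A straight path of minimal cost from `x`. -/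
def bestPath (L : ℝ → ℝ) (x : ℝ) : StoppedPath solid :=
  if costLeft L x ≤ costRight L x then StoppedPath.toLeft x else StoppedPath.toRight x

theorem measurable_bestPath (hi : LocallyIntegrable L volume) : Measurable (bestPath L) := by
  classical
  exact Measurable.ite (measurableSet_le (continuous_costLeft hi).measurable
    (continuous_costRight hi).measurable) StoppedPath.measurable_toLeft StoppedPath.measurable_toRight

theorem bestPath_pos_zero (x : ℝ) : (bestPath L x).pos 0 = x := by
  unfold bestPath
  split_ifs
  · exact StoppedPath.toLeft_pos_zero x
  · exact StoppedPath.toRight_pos_zero x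

theorem cost_bestPath (hi : LocallyIntegrable L volume) (x : ℝ) :
    (bestPath L x).cost L = ENNReal.ofReal (minCost L x) := by
  by_cases hx : x ∈ Ioo (0 : ℝ) 1
  · unfold bestPath minCost
    split_ifs with h
    · rw [StoppedPath.cost_toLeft hi hx, min_eq_left h]
    · rw [StoppedPath.cost_toRight hi hx, min_eq_right (not_le.1 h).le]
  · rw [StoppedPath.cost_of_notMem_Ioo _ (by rwa [bestPath_pos_zero]),
      ENNReal.ofReal_of_nonpos (minCost_nonpos hi (by by_contra h; exact hx (notMem_solid.1 h)))]

theorem minCost_le (hi : LocallyIntegrable L volume) (x : ℝ) : minCost L x ≤ costLeft L 1 := by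
  rcases le_total x 1 with h | h
  · exact (min_le_left _ _).trans (costLeft_mono hi h)
  · refine (min_le_right _ _).trans ((costRight_anti hi h).trans ?_)
    rw [costRight_one]
    exact integral_posPart_nonneg zero_le_one

theorem lintegral_minCost_le_lintegral_cost (hm : Measurable L)
    (hi : LocallyIntegrable L volume) (P : Measure (StoppedPath solid × ℝ≥0)) :
    ∫⁻ p, ENNReal.ofReal (minCost L (start p)) ∂P ≤ ∫⁻ p, p.1.cost L ∂P :=
  lintegral_mono fun p => p.1.minCost_le_cost hm hi

/-- A law whose paths have minimal cost is optimal for its initial distribution. -/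
theorem optimal_of_ae_cost_eq (hm : Measurable L) (hi : LocallyIntegrable L volume)
    {Q : Measure (StoppedPath solid × ℝ≥0)}
    (hQ : ∀ᵐ p ∂Q, p.1.cost L = ENNReal.ofReal (minCost L (start p)))
    {P : Measure (StoppedPath solid × ℝ≥0)} (h : P.map start = Q.map start) :
    ∫⁻ p, p.1.cost L ∂Q ≤ ∫⁻ p, p.1.cost L ∂P := by
  have hmc : Measurable fun x => ENNReal.ofReal (minCost L x) :=
    (continuous_minCost hi).measurable.ennreal_ofReal
  refine le_trans (le_of_eq ?_) (lintegral_minCost_le_lintegral_cost hm hi P)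
  rw [lintegral_congr_ae hQ, ← lintegral_map hmc measurable_start,
    ← lintegral_map hmc measurable_start, h]

/-- Replacing each path by the best straight one from the same point is a competitor with expected
cost `𝔼[minCost (y_0)]`. Every path costs at least `minCost (y_0)`, and the expectation is finite,
so optimality forces equality almost surely. -/
theorem ae_cost_eq_of_optimal (hm : Measurable L) (hi : LocallyIntegrable L volume)
    {Q : Measure (StoppedPath solid × ℝ≥0)} [IsProbabilityMeasure Q]
    (hopt : ∀ P : Measure (StoppedPath solid × ℝ≥0), IsProbabilityMeasure P →
      P.map start = Q.map start → ∫⁻ p, p.1.cost L ∂Q ≤ ∫⁻ p, p.1.cost L ∂P) :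
    ∀ᵐ p ∂Q, p.1.cost L = ENNReal.ofReal (minCost L (start p)) := by
  have hmc : Measurable fun x => ENNReal.ofReal (minCost L x) :=
    (continuous_minCost hi).measurable.ennreal_ofReal
  -- The cost does not involve `β`, so the competitor may take `β = 0`.
  have hF : Measurable fun p : StoppedPath solid × ℝ≥0 => (bestPath L (start p), (0 : ℝ≥0)) :=
    ((measurable_bestPath hi).comp measurable_start).prodMk measurable_const
  have h1 := hopt (Q.map fun p => (bestPath L (start p), (0 : ℝ≥0)))
    (Measure.isProbabilityMeasure_map hF.aemeasurable) (by
      rw [Measure.map_map measurable_start hF]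
      congr 1
      funext p
      exact bestPath_pos_zero _)
  have hc : Measurable fun p : StoppedPath solid × ℝ≥0 => p.1.cost L :=
    (StoppedPath.measurable_cost hm).comp measurable_fst
  rw [lintegral_map hc hF] at h1
  simp only [cost_bestPath hi] at h1
  have h2 : ∫⁻ p, ENNReal.ofReal (minCost L (start p)) ∂Q ≠ ⊤ := by
    refine ne_top_of_le_ne_top (b := ENNReal.ofReal (costLeft L 1)) ENNReal.ofReal_ne_top ?_
    refine (lintegral_mono fun p => ENNReal.ofReal_le_ofReal (minCost_le hi _)).trans ?_
    simp
  have h3 := ae_eq_of_ae_le_of_lintegral_le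
    (ae_of_all Q fun p => p.1.minCost_le_cost hm hi) h2
    hc.aemeasurable h1
  filter_upwards [h3] with p hp
  exact hp.symm

end Optimality

/-! ### Paths of an equilibrium are almost surely tight. -/

namespace Triple.IsCappedEquilibrium

variable {γ : ℝ} {T : ℝ≥0} {X : Triple solid}

theorem measurable (h : X.IsCappedEquilibrium γ T) : Measurable X.L := h.usc.measurable

theorem ae_isTight (h : X.IsCappedEquilibrium γ T) : ∀ᵐ p ∂X.Q, IsTight X.L p := by
  have := h.isProbability
  have hm := h.measurable
  have h1 := ae_cost_eq_of_optimal hm h.locallyIntegrable h.optimal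
  -- This bump equals `1` on `[-2, 2]`, hence along every path started in `(0, 1)`, so one test
  -- function recovers `L⁻ = 0` along the path up to `β`.
  let φ : ContDiffBump (0 : ℝ) := ⟨2, 3, by norm_num, by norm_num⟩
  have h2 := h.negPart φ φ.contDiff φ.hasCompactSupport
  have hg : Measurable fun x : ℝ => ENNReal.ofReal (|φ x| * max (-X.L x) 0) :=
    ((φ.continuous.measurable.norm).mul (hm.neg.max measurable_const)).ennreal_ofReal
  rw [lintegral_eq_zero_iff (StoppedPath.measurable_lintegral_Ioc measurable_fst measurable_const
    measurable_snd.coe_nnreal_real hg)] at h2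
  filter_upwards [h1, h.capped, h.exit, h2] with p hp1 hp2 hp3 hp4
  refine ⟨hp1, hp2.2, fun hp => ?_, ?_⟩
  · have := hp3 hp
    rw [essBoundary_solid] at this
    simpa using this
  · rcases eq_or_ne p.1.θ 0 with h0 | h0
    · have : p.2 = 0 := le_antisymm (h0 ▸ hp2.2) zero_le
      refine ae_of_all _ fun t ht => ?_
      rw [this, NNReal.coe_zero] at ht
      exact absurd ht.1 (not_lt.2 ht.2)
    · have hmeas : Measurable fun t : ℝ =>
          ENNReal.ofReal (|φ (p.1.pos t)| * max (-X.L (p.1.pos t)) 0) :=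
        hg.comp p.1.lipschitz_pos.continuous.measurable
      have h5 := (lintegral_eq_zero_iff hmeas).1 hp4
      rw [EventuallyEq, ae_restrict_iff' measurableSet_Ioc] at h5
      filter_upwards [h5] with t ht ht'
      have h6 := ht ht'
      have h7 : φ (p.1.pos t) = 1 := by
        refine φ.one_of_mem_closedBall ?_
        have := p.1.pos_mem_Icc (pos_iff_ne_zero.2 h0) t
        rw [Metric.mem_closedBall, Real.dist_eq, abs_le]
        change -2 ≤ _ ∧ _ ≤ 2
        constructor <;> linarith [this.1, this.2]
      simp only [h7, abs_one, one_mul, Pi.zero_apply, ENNReal.ofReal_eq_zero, max_le_iff,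
        Left.neg_nonpos_iff, le_refl, and_true] at h6
      -- Since `L` has no zeros, `L ≥ 0` improves to `L > 0`.
      exact lt_of_le_of_ne h6 (h.ne_zero _).symm

end Triple.IsCappedEquilibrium

end

section

/-! ### Occupation measures expressed through crossings. -/

section Crossing

/-- The points swept by a pair `(y, β)` moving straight, with the finish included. -/
def crossed (p : StoppedPath solid × ℝ≥0) : Set ℝ :=
  Ico (finish p) (start p) ∪ Ioc (start p) (finish p)

theorem measurableSet_crossed_prod :
    MeasurableSet {q : (StoppedPath solid × ℝ≥0) × ℝ | q.2 ∈ crossed q.1} := by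
  have h1 : Measurable fun q : (StoppedPath solid × ℝ≥0) × ℝ => start q.1 :=
    measurable_start.comp measurable_fst
  have h2 : Measurable fun q : (StoppedPath solid × ℝ≥0) × ℝ => finish q.1 :=
    measurable_finish.comp measurable_fst
  exact ((measurableSet_le h2 measurable_snd).inter (measurableSet_lt measurable_snd h1)).union
    ((measurableSet_lt h1 measurable_snd).inter (measurableSet_le measurable_snd h2))

theorem measurableSet_crossed (p : StoppedPath solid × ℝ≥0) : MeasurableSet (crossed p) :=
  measurableSet_Ico.union measurableSet_Ioc

theorem measurableSet_mem_crossed (x : ℝ) :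
    MeasurableSet {p : StoppedPath solid × ℝ≥0 | x ∈ crossed p} :=
  measurable_prodMk_right (y := x) measurableSet_crossed_prod

theorem measurable_measure_crossed (Q : Measure (StoppedPath solid × ℝ≥0)) [SFinite Q] :
    Measurable fun x => Q {p | x ∈ crossed p} :=
  measurable_measure_prodMk_right measurableSet_crossed_prod

namespace IsTight

variable {L : ℝ → ℝ} {p : StoppedPath solid × ℝ≥0}

/-- Straight motion at unit speed is a translation or a reflection of time, so it carries Lebesgue
measure to Lebesgue measure on the interval crossed. -/
theorem map_pos (h : IsTight L p) (hm : Measurable L) (hi : LocallyIntegrable L volume) :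
    (volume.restrict (Ioc (0 : ℝ) p.2)).map p.1.pos = volume.restrict (crossed p) := by
  have h1 := h.abs_finish_sub_start hm hi
  rcases le_total (finish p) (start p) with hle | hle
  · rw [abs_of_nonpos (by linarith)] at h1
    have h2 : p.1.pos =ᵐ[volume.restrict (Ioc (0 : ℝ) p.2)] fun t => start p - t :=
      (ae_restrict_iff' measurableSet_Ioc).2
        (ae_of_all _ fun t ht => h.pos_eq_sub hm hi hle ht.1.le ht.2)
    have h3 : (fun t => start p - t) ⁻¹' Ico (finish p) (start p) = Ioc 0 (p.2 : ℝ) := by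
      rw [preimage_const_sub_Ico]
      congr 1 <;> linarith
    have h4 := (Measure.measurePreserving_sub_left (volume : Measure ℝ)
      (start p)).restrict_preimage (s := Ico (finish p) (start p)) measurableSet_Ico
    rw [Measure.map_congr h2, crossed, Ioc_eq_empty_of_le hle, union_empty, ← h4.map_eq, h3]
  · rw [abs_of_nonneg (by linarith)] at h1
    have h2 : p.1.pos =ᵐ[volume.restrict (Ioc (0 : ℝ) p.2)] fun t => start p + t :=
      (ae_restrict_iff' measurableSet_Ioc).2
        (ae_of_all _ fun t ht => h.pos_eq_add hm hi hle ht.1.le ht.2)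
    have h3 : (fun t => start p + t) ⁻¹' Ioc (start p) (finish p) = Ioc 0 (p.2 : ℝ) := by
      rw [preimage_const_add_Ioc]
      congr 1
      linarith
    have h4 := (measurePreserving_add_left (volume : Measure ℝ)
      (start p)).restrict_preimage (s := Ioc (start p) (finish p)) measurableSet_Ioc
    rw [Measure.map_congr h2, crossed, Ico_eq_empty_of_le hle, empty_union, ← h4.map_eq, h3]

theorem mem_Icc_of_mem_crossed (h : IsTight L p) {x : ℝ} (hx : x ∈ crossed p) :
    x ∈ Icc (0 : ℝ) 1 := by
  have hθ : 0 < p.1.θ := by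
    refine h.θ_pos_of_ne fun he => ?_
    rw [crossed, he, Ico_self, Ioc_self, union_self] at hx
    exact hx
  have h1 : start p ∈ Icc (0 : ℝ) 1 := p.1.pos_mem_Icc hθ 0
  have h2 := finish_mem_Icc (p := p) hθ
  rcases hx with hx | hx
  · exact ⟨h2.1.trans hx.1, hx.2.le.trans h1.2⟩
  · exact ⟨h1.1.trans hx.1.le, hx.2.trans h2.2⟩

end IsTight

variable {L : ℝ → ℝ} {Q : Measure (StoppedPath solid × ℝ≥0)}

/-- By `map_pos` and Fubini, the density of the expected occupation time at `x` is the probability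
that `x` is crossed. -/
theorem integral_occupation [IsProbabilityMeasure Q] (hm : Measurable L)
    (hi : LocallyIntegrable L volume)
    (hQ : ∀ᵐ p ∂Q, IsTight L p) {g : ℝ → ℝ} (hg : Measurable g) (hgi : Integrable g volume) :
    ∫ p, (∫ t in (0 : ℝ)..(p.2 : ℝ), g (p.1.pos t)) ∂Q = ∫ x, g x * Q.real {p | x ∈ crossed p} := by
  have h1 : ∀ᵐ p ∂Q, ∫ t in (0 : ℝ)..(p.2 : ℝ), g (p.1.pos t) =
      ∫ x, (crossed p).indicator g x := by
    filter_upwards [hQ] with p hp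
    rw [intervalIntegral.integral_of_le p.2.coe_nonneg,
      ← integral_map (φ := p.1.pos) p.1.lipschitz_pos.continuous.measurable.aemeasurable
        hg.aestronglyMeasurable, hp.map_pos hm hi, integral_indicator (measurableSet_crossed p)]
  rw [integral_congr_ae h1]
  have h2 : Integrable (fun q : (StoppedPath solid × ℝ≥0) × ℝ => (crossed q.1).indicator g q.2)
      (Q.prod volume) := by
    have := (hgi.comp_snd Q).indicator measurableSet_crossed_prod
    refine this.congr (ae_of_all _ fun q => ?_)
    rfl
  rw [integral_integral_swap h2]
  refine integral_congr_ae (ae_of_all _ fun x => ?_)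
  have h3 : (fun p => (crossed p).indicator g x) = {p | x ∈ crossed p}.indicator fun _ => g x := by
    funext p
    by_cases hx : x ∈ crossed p
    · rw [indicator_of_mem hx, indicator_of_mem (by exact hx)]
    · rw [indicator_of_notMem hx, indicator_of_notMem (by exact hx)]
  change ∫ p, (crossed p).indicator g x ∂Q = _
  rw [h3, integral_indicator_const _ (measurableSet_mem_crossed x), smul_eq_mul, mul_comm]

end Crossing

/-! ### The support of `{L > 0}` in the unit interval. -/

section Active

variable {L : ℝ → ℝ}

/-- The points of `(0, 1)` in the support of Lebesgue measure on `{L > 0}`. -/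
def active (L : ℝ → ℝ) : Set ℝ :=
  Ioo 0 1 ∩ (volume.restrict {t | 0 < L t}).support

theorem measurableSet_active : MeasurableSet (active L) :=
  measurableSet_Ioo.inter Measure.isClosed_support.measurableSet

theorem active_subset : active L ⊆ Ioo 0 1 := inter_subset_left

/-- Upper semicontinuity makes `{L < 0}` open, and this set is null for Lebesgue measure on `{L >
0}`. So `L ≥ 0` on the support, and `L` does not vanish. Passing to the support thus loses no
positivity. -/
theorem pos_of_mem_active (hu : UpperSemicontinuous L) (h0 : ∀ x, L x ≠ 0) {x : ℝ}
    (hx : x ∈ active L) : 0 < L x := by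
  by_contra! hL
  have h1 : IsOpen (L ⁻¹' Iio 0) := upperSemicontinuous_iff_isOpen_preimage.1 hu 0
  have h2 := (Measure.mem_support_iff_forall x).1 hx.2 _
    (h1.mem_nhds (lt_of_le_of_ne hL (h0 x)))
  rw [Measure.restrict_apply h1.measurableSet] at h2
  refine h2.ne' ?_
  convert measure_empty (μ := (volume : Measure ℝ))
  ext t
  simp only [mem_inter_iff, mem_preimage, mem_Iio, mem_ofPred_eq, mem_empty_iff_false, iff_false,
    not_and, not_lt]
  exact fun h => h.le

theorem ae_mem_active (hm : Measurable L) :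
    ∀ᵐ x : ℝ, x ∈ Ioo (0 : ℝ) 1 → 0 < L x → x ∈ active L := by
  have h := Measure.support_mem_ae (μ := volume.restrict {t | 0 < L t})
  have h' := (ae_restrict_iff' (measurableSet_lt measurable_const hm)).1 h
  filter_upwards [h'] with x hx h1 h2
  exact ⟨h1, hx h2⟩

theorem mem_active_of_ae_pos {a b x : ℝ} (hab : a < b) (hx : x ∈ Icc a b)
    (hx' : x ∈ Ioo (0 : ℝ) 1) (h : ∀ᵐ t : ℝ, t ∈ Ioo a b → 0 < L t) : x ∈ active L := by
  refine ⟨hx', (Measure.mem_support_iff_forall x).2 fun U hU => ?_⟩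
  obtain ⟨V, hVU, hV, hxV⟩ := mem_nhds_iff.1 hU
  have h1 : (V ∩ Ioo a b).Nonempty := by
    rw [← closure_Ioo hab.ne] at hx
    exact mem_closure_iff.1 hx V hV hxV
  have h2 := (hV.inter isOpen_Ioo).measure_pos volume h1
  refine h2.trans_le ?_
  have h3 : volume (V ∩ Ioo a b) ≤ volume (V ∩ {t | 0 < L t}) := by
    refine measure_mono_ae ?_
    filter_upwards [h] with t ht ht'
    exact ⟨ht'.1, ht ht'.2⟩
  exact h3.trans ((Measure.le_restrict_apply _ _).trans (measure_mono hVU))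

theorem mem_active_of_subset {a b x : ℝ} (hab : a < b) (hx : x ∈ Icc a b)
    (hx' : x ∈ Ioo (0 : ℝ) 1) (hu : UpperSemicontinuous L) (h0 : ∀ x, L x ≠ 0)
    (h : Ioo a b ⊆ active L) : x ∈ active L :=
  mem_active_of_ae_pos hab hx hx' (ae_of_all _ fun _ ht => pos_of_mem_active hu h0 (h ht))

namespace IsTight

variable {p : StoppedPath solid × ℝ≥0}

theorem mem_active (h : IsTight L p) (hm : Measurable L) (hi : LocallyIntegrable L volume)
    {x : ℝ} (hne : start p ≠ finish p) (hx : x ∈ uIcc (start p) (finish p))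
    (hx' : x ∈ Ioo (0 : ℝ) 1) : x ∈ active L := by
  rcases lt_or_gt_of_ne hne with hlt | hlt
  · rw [uIcc_of_le hlt.le] at hx
    exact mem_active_of_ae_pos hlt hx hx' (h.ae_pos_right hm hi hlt.le)
  · rw [uIcc_of_ge hlt.le] at hx
    exact mem_active_of_ae_pos hlt hx hx' (h.ae_pos_left hm hi hlt.le)

theorem mem_active_of_mem_crossed (h : IsTight L p) (hm : Measurable L)
    (hi : LocallyIntegrable L volume) {x : ℝ} (hx : x ∈ crossed p) (hx' : x ∈ Ioo (0 : ℝ) 1) :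
    x ∈ active L := by
  have hne : start p ≠ finish p := fun he => by
    rw [crossed, he, Ico_self, Ioc_self, union_self] at hx
    exact hx
  refine h.mem_active hm hi hne ?_ hx'
  rcases hx with hx | hx
  · exact mem_uIcc.2 (Or.inr ⟨hx.1, hx.2.le⟩)
  · exact mem_uIcc.2 (Or.inl ⟨hx.1.le, hx.2⟩)

end IsTight

end Active

/-! ### The fixed point equation in terms of the flux. -/

namespace Triple

/-- The flux `κ ℚ(y crosses x before β)`. -/
def flux (X : Triple solid) (x : ℝ) : ℝ := X.κ * X.Q.real {p | x ∈ crossed p}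

namespace IsCappedEquilibrium

variable {γ : ℝ} {T : ℝ≥0} {X : Triple solid}

theorem flux_nonneg (h : X.IsCappedEquilibrium γ T) (x : ℝ) : 0 ≤ X.flux x :=
  mul_nonneg h.κ_pos.le measureReal_nonneg

theorem flux_eq_zero (h : X.IsCappedEquilibrium γ T) {x : ℝ} (hx : x ∈ Ioo (0 : ℝ) 1)
    (hx' : x ∉ active X.L) : X.flux x = 0 := by
  have : X.Q {p | x ∈ crossed p} = 0 := by
    rw [measure_eq_zero_iff_ae_notMem]
    filter_upwards [h.ae_isTight] with p hp hxp
    exact hx' (hp.mem_active_of_mem_crossed h.measurable h.locallyIntegrable hxp hx)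
  rw [flux, measureReal_def, this, ENNReal.toReal_zero, mul_zero]

/-- With the occupation density inserted, both sides of the fixed point equation are integrals of
the test function against locally integrable functions, which therefore agree almost everywhere. -/
theorem ae_posPart_mul_flux (h : X.IsCappedEquilibrium γ T) :
    ∀ᵐ x : ℝ, max (X.L x) 0 * X.flux x = 1 + γ * X.L x := by
  have := h.isProbability
  have hLp := locallyIntegrable_posPart h.locallyIntegrable
  have hmeas : Measurable X.flux :=
    measurable_const.mul (measurable_measure_crossed X.Q).ennreal_toReal
  have hle : ∀ x, |X.flux x| ≤ X.κ := fun x => by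
    rw [abs_of_nonneg (h.flux_nonneg x)]
    exact mul_le_of_le_one_right h.κ_pos.le measureReal_le_one
  have hl1 : LocallyIntegrable (fun x => max (X.L x) 0 * X.flux x) volume := by
    -- The flux is at most `κ`, so `κ L⁺` dominates the left side.
    have hb : LocallyIntegrable (fun x => X.κ * max (X.L x) 0) volume := hLp.smul X.κ
    refine hb.mono ((h.measurable.max measurable_const).mul hmeas).aestronglyMeasurable
      (ae_of_all _ fun x => ?_)
    rw [norm_mul, norm_mul, mul_comm, Real.norm_eq_abs, Real.norm_eq_abs X.κ,
      abs_of_pos h.κ_pos]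
    exact mul_le_mul_of_nonneg_right (hle x) (norm_nonneg _)
  have hl2 : LocallyIntegrable (fun x => 1 + γ * X.L x) volume :=
    (locallyIntegrable_const 1).add (h.locallyIntegrable.smul γ)
  refine ae_eq_of_integral_contDiff_smul_eq hl1 hl2 fun φ hφ hφ' => ?_
  have hfp := h.fixedPoint φ hφ hφ'
  have hgi : Integrable (fun x => φ x * max (X.L x) 0) volume :=
    hLp.integrable_smul_left_of_hasCompactSupport hφ.continuous hφ'
  have hgm : Measurable fun x => φ x * max (X.L x) 0 :=
    hφ.continuous.measurable.mul (h.measurable.max measurable_const)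
  rw [integral_occupation h.measurable h.locallyIntegrable h.ae_isTight hgm hgi, ← integral_const_mul] at hfp
  simp only [smul_eq_mul]
  rw [← hfp]
  refine integral_congr_ae (ae_of_all _ fun x => ?_)
  simp only [flux]
  ring

end IsCappedEquilibrium

end Triple

end

/-! ### The arrival time is the minimal cost on the swept set. -/

section

theorem minCost_nonneg {L : ℝ → ℝ} {x : ℝ} (hx : x ∈ Icc (0 : ℝ) 1) : 0 ≤ minCost L x :=
  le_min (integral_posPart_nonneg hx.1) (integral_posPart_nonneg hx.2)

namespace IsTight

variable {L : ℝ → ℝ} {p : StoppedPath solid × ℝ≥0}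

theorem tailCost_anti (y : StoppedPath solid) {r s : ℝ≥0} (h : r ≤ s) :
    y.tailCost L s ≤ y.tailCost L r :=
  lintegral_mono_set (Ioc_subset_Ioc_left (NNReal.coe_le_coe.2 h))

/-- Being past `ι(L, t)` means having a tail cost below `t`, and along a tight path the tail cost at
time `r` is `minCost (y_r)`. Hence the time constraint becomes the spatial constraint `minCost < t`.
-/
theorem volume_occupied (h : IsTight L p) (hm : Measurable L) (hi : LocallyIntegrable L volume)
    {t : ℝ≥0} (ht : 0 < t) {A : Set ℝ} (hA : MeasurableSet A) :
    volume {r : ℝ | 0 ≤ r ∧ p.1.ι L t ≤ ENNReal.ofReal r ∧ r ≤ p.2 ∧ p.1.pos r ∈ A} =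
      volume ((A ∩ {x | minCost L x < t}) ∩ crossed p) := by
  have hB : MeasurableSet (A ∩ {x | minCost L x < t}) :=
    hA.inter (measurableSet_lt (continuous_minCost hi).measurable measurable_const)
  have hpm := p.1.lipschitz_pos.continuous.measurable
  have h1 := congrArg (fun μ => μ (A ∩ {x | minCost L x < t})) (h.map_pos hm hi)
  simp only [Measure.map_apply hpm hB, Measure.restrict_apply hB,
    Measure.restrict_apply (hpm hB)] at h1
  rw [← h1]
  refine measure_congr ?_
  have htail : ∀ r : ℝ≥0, r ≤ p.2 → p.1.tailCost L r = ENNReal.ofReal (minCost L (p.1.pos r)) :=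
    fun r hr => h.tailCost_eq hm hi (hr.trans h.le_θ)
  have hlt : ∀ a : ℝ, ENNReal.ofReal a < (t : ℝ≥0∞) ↔ a < t := fun a => by
    rw [← ENNReal.ofReal_coe_nnreal, ENNReal.ofReal_lt_ofReal_iff (NNReal.coe_pos.2 ht)]
  -- Strict and weak inequalities for the time differ only at `0` and at `ι` itself.
  have hnull : volume ({0, (p.1.ι L t).toReal} : Set ℝ) = 0 :=
    (Set.toFinite _).measure_zero _
  filter_upwards [compl_mem_ae_iff.2 hnull] with r hr
  simp only [mem_compl_iff, mem_insert_iff, mem_singleton_iff, not_or] at hr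
  refine propext ⟨fun hx => ?_, fun hx => ?_⟩
  · obtain ⟨h0, h2, h3, h4⟩ := hx
    refine ⟨⟨h4, ?_⟩, lt_of_le_of_ne h0 (Ne.symm hr.1), h3⟩
    have h5 : p.1.ι L t < ENNReal.ofReal r := by
      refine lt_of_le_of_ne h2 fun he => hr.2 ?_
      rw [he, ENNReal.toReal_ofReal h0]
    simp only [StoppedPath.ι, iInf_lt_iff] at h5
    obtain ⟨r', ⟨hr1, hr2⟩, hr3⟩ := h5
    have h6 : r' ≤ r.toNNReal := by
      rw [ENNReal.ofReal, ENNReal.coe_lt_coe] at hr3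
      exact hr3.le
    have h7 : r.toNNReal ≤ p.2 := Real.toNNReal_le_iff_le_coe.2 h3
    have h8 := (tailCost_anti (L := L) p.1 h6).trans_lt hr2
    rw [htail _ h7, Real.coe_toNNReal r h0, hlt] at h8
    exact h8
  · obtain ⟨⟨h4, h5⟩, h0, h3⟩ := hx
    refine ⟨h0.le, ?_, h3, h4⟩
    have h7 : r.toNNReal ≤ p.2 := Real.toNNReal_le_iff_le_coe.2 h3
    refine iInf₂_le (r.toNNReal) ⟨h7.trans h.le_θ, ?_⟩
    rw [htail _ h7, Real.coe_toNNReal r h0.le, hlt]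
    exact h5

end IsTight

namespace Triple.IsCappedEquilibrium

variable {γ : ℝ} {T : ℝ≥0} {X : Triple solid}

/-- At a point with `L > 0` and without crossings the flux equation would read `0 = 1 + γ L > 0`;
conversely tight paths cross only active points of `(0, 1)`. -/
theorem ae_crossed_ne_zero_iff (h : X.IsCappedEquilibrium γ T) (hγ : 0 < γ) :
    ∀ᵐ x : ℝ, X.Q {p | x ∈ crossed p} ≠ 0 ↔ x ∈ active X.L := by
  have := h.isProbability
  have hnull : volume ({0, 1} : Set ℝ) = 0 := (Set.toFinite _).measure_zero _
  filter_upwards [h.ae_posPart_mul_flux, compl_mem_ae_iff.2 hnull] with x hx hx01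
  simp only [mem_compl_iff, mem_insert_iff, mem_singleton_iff, not_or] at hx01
  constructor
  · intro hne
    by_contra hxa
    refine hne (measure_eq_zero_iff_ae_notMem.2 ?_)
    filter_upwards [h.ae_isTight] with p hp hxp
    have h1 := hp.mem_Icc_of_mem_crossed hxp
    exact hxa (hp.mem_active_of_mem_crossed h.measurable h.locallyIntegrable hxp
      ⟨lt_of_le_of_ne h1.1 (Ne.symm hx01.1), lt_of_le_of_ne h1.2 hx01.2⟩)
  · intro hxa h0
    have hL := pos_of_mem_active h.usc h.ne_zero hxa
    rw [flux, measureReal_def, h0, ENNReal.toReal_zero, mul_zero, mul_zero] at hx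
    have := mul_pos hγ hL
    linarith

theorem occupation_eq (h : X.IsCappedEquilibrium γ T) {t : ℝ≥0} (ht : 0 < t) {A : Set ℝ}
    (hA : MeasurableSet A) : X.occupation t A =
      ∫⁻ x in A ∩ {x | minCost X.L x < t}, X.Q {p | x ∈ crossed p} := by
  have := h.isProbability
  have hB : MeasurableSet (A ∩ {x | minCost X.L x < t}) :=
    hA.inter (measurableSet_lt (continuous_minCost h.locallyIntegrable).measurable measurable_const)
  set B := A ∩ {x | minCost X.L x < t}
  have h1 : X.occupation t A = ∫⁻ p, (∫⁻ x in B, (crossed p).indicator 1 x) ∂X.Q := by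
    refine lintegral_congr_ae ?_
    filter_upwards [h.ae_isTight] with p hp
    rw [hp.volume_occupied h.measurable h.locallyIntegrable ht hA,
      lintegral_indicator_one (measurableSet_crossed p), Measure.restrict_apply
        (measurableSet_crossed p), inter_comm]
  rw [h1, lintegral_lintegral_swap]
  · refine lintegral_congr fun x => ?_
    rw [← lintegral_indicator_one (measurableSet_mem_crossed x)]
    rfl
  · exact (measurable_one.indicator measurableSet_crossed_prod).aemeasurable

theorem occupation_pos_iff (h : X.IsCappedEquilibrium γ T) (hγ : 0 < γ) {t : ℝ≥0} (ht : 0 < t)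
    {A : Set ℝ} (hA : MeasurableSet A) :
    0 < X.occupation t A ↔ 0 < volume ((A ∩ {x | minCost X.L x < t}) ∩ active X.L) := by
  have := h.isProbability
  have hB : MeasurableSet (A ∩ {x | minCost X.L x < t}) :=
    hA.inter (measurableSet_lt (continuous_minCost h.locallyIntegrable).measurable measurable_const)
  rw [h.occupation_eq ht hA, setLIntegral_pos_iff (measurable_measure_crossed X.Q), inter_comm]
  have : volume ((A ∩ {x | minCost X.L x < t}) ∩
      Function.support fun x => X.Q {p | x ∈ crossed p}) =
      volume ((A ∩ {x | minCost X.L x < t}) ∩ active X.L) := by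
    refine measure_congr ?_
    filter_upwards [h.ae_crossed_ne_zero_iff hγ] with x hx
    exact propext ⟨fun h => ⟨h.1, hx.1 h.2⟩, fun h => ⟨h.1, hx.2 h.2⟩⟩
  rw [← this, inter_comm]

theorem arrival_of_mem_solid {x : ℝ} (hx : x ∈ solid) : X.arrival x = 0 := by
  refine le_antisymm ?_ zero_le
  refine (iInf₂_le (0 : ℝ≥0) (Or.inl hx)).trans ?_
  simp

/-- For `t = 0` no tail cost is smaller than `t`, so `ι` is `inf ∅ = ∞` and nothing is counted. -/
theorem occupation_zero (A : Set ℝ) : X.occupation 0 A = 0 := by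
  have : ∀ p : StoppedPath solid × ℝ≥0, {r : ℝ | 0 ≤ r ∧ p.1.ι X.L 0 ≤ ENNReal.ofReal r ∧ r ≤ p.2 ∧
      p.1.pos r ∈ A} = ∅ := fun p => by
    ext r
    simp [StoppedPath.ι]
  simp [occupation, this]

theorem mem_aggregate_iff (h : X.IsCappedEquilibrium γ T) (hγ : 0 < γ) {t : ℝ≥0} {x : ℝ}
    (hx : x ∈ Ioo (0 : ℝ) 1) : x ∈ X.aggregate t ↔ 0 < t ∧ ∀ ε > 0,
      0 < volume ((Metric.ball x ε ∩ {x | minCost X.L x < t}) ∩ active X.L) := by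
  have hx' : x ∉ solid := notMem_solid.2 hx
  constructor
  · rintro (h1 | h1)
    · exact absurd h1 hx'
    · have ht : 0 < t := by
        rw [pos_iff_ne_zero]
        rintro rfl
        have := h1 1 one_pos
        rw [occupation_zero] at this
        exact lt_irrefl _ this
      exact ⟨ht, fun ε hε => (h.occupation_pos_iff hγ ht measurableSet_ball).1 (h1 ε hε)⟩
  · rintro ⟨ht, h1⟩
    exact Or.inr fun ε hε => (h.occupation_pos_iff hγ ht measurableSet_ball).2 (h1 ε hε)

/-- Near an active point the set `{minCost < t}` is a full neighbourhood if `t > minCost x`, by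
continuity, and it is empty if `t < minCost x`. So `x` enters the support exactly around time
`minCost x`. -/
theorem arrival_of_mem_active (h : X.IsCappedEquilibrium γ T) (hγ : 0 < γ) {x : ℝ}
    (hx : x ∈ active X.L) : X.arrival x = ENNReal.ofReal (minCost X.L x) := by
  have hc := continuous_minCost h.locallyIntegrable
  have hnn := minCost_nonneg (L := X.L) (Ioo_subset_Icc_self hx.1)
  refine le_antisymm ?_ ?_
  · refine ENNReal.le_of_forall_pos_le_add fun ε hε _ => ?_
    have ht : 0 < (minCost X.L x).toNNReal + ε := add_pos_of_nonneg_of_pos zero_le hε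
    refine (iInf₂_le ((minCost X.L x).toNNReal + ε)
      ((h.mem_aggregate_iff hγ hx.1).2 ⟨ht, fun η hη => ?_⟩)).trans (le_of_eq ?_)
    · have hlt : minCost X.L x < ((minCost X.L x).toNNReal + ε : ℝ≥0) := by
        rw [NNReal.coe_add, Real.coe_toNNReal _ hnn]
        linarith [NNReal.coe_pos.2 hε]
      set t := (minCost X.L x).toNNReal + ε
      have hU : Metric.ball x η ∩ {x | minCost X.L x < t} ∩ Ioo 0 1 ∈ 𝓝 x :=
        inter_mem (inter_mem (Metric.ball_mem_nhds x hη)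
          ((isOpen_lt hc continuous_const).mem_nhds hlt)) (isOpen_Ioo.mem_nhds hx.1)
      have h1 := (Measure.mem_support_iff_forall x).1 hx.2 _ hU
      rw [Measure.restrict_apply' (measurableSet_lt measurable_const h.measurable)] at h1
      refine h1.trans_le (measure_mono_ae ?_)
      filter_upwards [ae_mem_active h.measurable] with z hz hz'
      exact ⟨hz'.1.1, hz hz'.1.2 hz'.2⟩
    · rw [ENNReal.coe_add]; rfl
  · refine le_iInf₂ fun t ht => ?_
    obtain ⟨ht0, h1⟩ := (h.mem_aggregate_iff hγ hx.1).1 ht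
    have : minCost X.L x ≤ t := by
      by_contra! hlt
      obtain ⟨ε, hε, hsub⟩ := Metric.mem_nhds_iff.1 ((isOpen_lt continuous_const hc).mem_nhds hlt)
      refine (h1 ε hε).ne' ?_
      convert measure_empty (μ := (volume : Measure ℝ))
      refine eq_empty_of_forall_notMem fun z hz => ?_
      have h2 : (t : ℝ) < minCost X.L z := hsub hz.1.1
      exact lt_asymm h2 hz.1.2
    exact ENNReal.ofReal_le_of_le_toReal (by simpa using this)

theorem arrival_of_notMem (h : X.IsCappedEquilibrium γ T) (hγ : 0 < γ) {x : ℝ}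
    (hx : x ∈ Ioo (0 : ℝ) 1) (hxa : x ∉ active X.L) : X.arrival x = ⊤ := by
  refine iInf₂_eq_top.2 fun t ht => ?_
  exfalso
  obtain ⟨ht0, h1⟩ := (h.mem_aggregate_iff hγ hx).1 ht
  refine hxa ⟨hx, (Measure.mem_support_iff_forall x).2 fun U hU => ?_⟩
  obtain ⟨ε, hε, hsub⟩ := Metric.mem_nhds_iff.1 hU
  rw [Measure.restrict_apply' (measurableSet_lt measurable_const h.measurable)]
  refine (h1 ε hε).trans_le (measure_mono fun z hz => ⟨hsub hz.1.1, ?_⟩)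
  exact pos_of_mem_active h.usc h.ne_zero hz.2

theorem swept_eq (h : X.IsCappedEquilibrium γ T) (hγ : 0 < γ) : X.swept = active X.L := by
  ext x
  rw [swept, closure_solid, Set.mem_sdiff, notMem_solid]
  constructor
  · rintro ⟨h1, h2⟩
    by_contra hx
    have h1' : X.arrival x < ⊤ := h1
    rw [h.arrival_of_notMem hγ h2 hx] at h1'
    exact lt_irrefl _ h1'
  · intro hx
    refine ⟨?_, hx.1⟩
    change X.arrival x < ⊤
    rw [h.arrival_of_mem_active hγ hx]
    exact ENNReal.ofReal_lt_top

theorem mem_active_of_arrival_lt (h : X.IsCappedEquilibrium γ T) (hγ : 0 < γ) {x : ℝ}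
    (hx : x ∈ Ioo (0 : ℝ) 1) (hlt : X.arrival x < ⊤) : x ∈ active X.L := by
  by_contra hxa
  rw [h.arrival_of_notMem hγ hx hxa] at hlt
  exact lt_irrefl _ hlt

theorem setOf_arrival_le (h : X.IsCappedEquilibrium γ T) (hγ : 0 < γ) (t : ℝ≥0) :
    {x | X.arrival x ≤ t} = solid ∪ active X.L ∩ {x | minCost X.L x ≤ t} := by
  ext x
  have hiff : ENNReal.ofReal (minCost X.L x) ≤ t ↔ minCost X.L x ≤ t := by
    rw [ENNReal.ofReal, ENNReal.coe_le_coe, Real.toNNReal_le_iff_le_coe]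
  by_cases hs : x ∈ solid
  · simp only [mem_ofPred_eq, arrival_of_mem_solid hs, zero_le, mem_union, hs, true_or]
  · have hx := notMem_solid.1 hs
    by_cases hxa : x ∈ active X.L
    · simp only [mem_ofPred_eq, h.arrival_of_mem_active hγ hxa, hiff, mem_union, hs, mem_inter_iff,
        hxa, true_and, false_or]
    · simp only [mem_ofPred_eq, h.arrival_of_notMem hγ hx hxa, mem_union, hs, mem_inter_iff,
        hxa, false_and, or_self, iff_false, top_le_iff]
      exact ENNReal.coe_ne_top

theorem measurableSet_arrival_le (h : X.IsCappedEquilibrium γ T) (hγ : 0 < γ) (t : ℝ≥0) :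
    MeasurableSet {x | X.arrival x ≤ t} := by
  rw [h.setOf_arrival_le hγ]
  exact measurableSet_solid.union (measurableSet_active.inter
    (measurableSet_le (continuous_minCost h.locallyIntegrable).measurable measurable_const))

theorem measurable_arrival (h : X.IsCappedEquilibrium γ T) (hγ : 0 < γ) :
    Measurable X.arrival := by
  classical
  have : X.arrival = solid.piecewise (fun _ => 0)
      ((active X.L).piecewise (fun x => ENNReal.ofReal (minCost X.L x)) fun _ => ⊤) := by
    funext x
    by_cases hs : x ∈ solid
    · rw [piecewise_eq_of_mem _ _ _ hs, arrival_of_mem_solid hs]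
    · rw [piecewise_eq_of_notMem _ _ _ hs]
      by_cases hxa : x ∈ active X.L
      · rw [piecewise_eq_of_mem _ _ _ hxa, h.arrival_of_mem_active hγ hxa]
      · rw [piecewise_eq_of_notMem _ _ _ hxa, h.arrival_of_notMem hγ (notMem_solid.1 hs) hxa]
  rw [this]
  exact Measurable.piecewise measurableSet_solid measurable_const (Measurable.piecewise
    measurableSet_active (continuous_minCost h.locallyIntegrable).measurable.ennreal_ofReal
    measurable_const)

end Triple.IsCappedEquilibrium

end

section

/-! ### Arrival times of a single front. -/

section FrontTime

/-- The time at which a front with velocity `v - ∫_0^z (u + 1)` at `z`, started at `0`,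
arrives at `x`. -/
def frontTime (u : ℝ → ℝ) (v x : ℝ) : ℝ≥0∞ :=
  ∫⁻ z in Ioc 0 x, (ENNReal.ofReal (v - ∫ r in (0 : ℝ)..z, (u r + 1)))⁻¹

variable {u : ℝ → ℝ} {C : ℝ}

theorem frontTime_mono (u : ℝ → ℝ) (v : ℝ) : Monotone (frontTime u v) := fun _ _ h =>
  lintegral_mono_set (Ioc_subset_Ioc_right h)

theorem locallyIntegrable_add_one (hu : AEMeasurable u volume) (hb : ∀ x, |u x| ≤ C) :
    LocallyIntegrable (fun x => u x + 1) volume := by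
  have h1 : LocallyIntegrable u volume := by
    refine (locallyIntegrable_const C).mono hu.aestronglyMeasurable (ae_of_all _ fun x => ?_)
    exact (hb x).trans (le_abs_self _)
  exact h1.add (locallyIntegrable_const 1)

theorem intervalIntegrable_add_one (hu : AEMeasurable u volume) (hb : ∀ x, |u x| ≤ C) (a b : ℝ) :
    IntervalIntegrable (fun x => u x + 1) volume a b :=
  ((locallyIntegrable_add_one hu hb).integrableOn_isCompact isCompact_uIcc).intervalIntegrable

theorem continuous_integral_add_one (hu : AEMeasurable u volume) (hb : ∀ x, |u x| ≤ C) :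
    Continuous fun z => ∫ r in (0 : ℝ)..z, (u r + 1) :=
  intervalIntegral.continuous_primitive (fun a b => intervalIntegrable_add_one hu hb a b) 0

end FrontTime

/-! ### Comparison of a front carrying an excess with one carrying none. -/

/-- The data of the left front of an equilibrium: `f` is the flux, `g` the excess loss of energy
to the left of a point, and `c` the point up to which the paths move left. -/
structure Front (γ P C c : ℝ) (u L f g : ℝ → ℝ) : Prop where
  γ_pos : 0 < γ
  γ_lt : γ < P
  c_mem : c ∈ Icc (0 : ℝ) 1
  u_meas : AEMeasurable u volume
  u_bdd : ∀ x, |u x| ≤ C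
  usc : UpperSemicontinuous L
  ne_zero : ∀ x, L x ≠ 0
  locInt : LocallyIntegrable L volume
  flux_pos : ∀ᵐ x : ℝ, x ∈ Ioo 0 c → 0 < L x → L x * f x = 1 + γ * L x
  flux_zero : ∀ x ∈ Ioo 0 c, x ∉ active L → f x = 0
  balance : ∀ x ∈ Ico 0 c, f x = P - g x - ∫ z in Ioc 0 x ∩ active L, (u z + 1)
  g_mono : MonotoneOn g (Ico 0 c)
  g_nonneg : ∀ x ∈ Ico 0 c, 0 ≤ g x

namespace Front

variable {γ P C c : ℝ} {u L f g : ℝ → ℝ}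

theorem C_nonneg (h : Front γ P C c u L f g) : 0 ≤ C := (abs_nonneg _).trans (h.u_bdd 0)

/-- Solving `L f = 1 + γ L` for `L`: the slowness `L` is the inverse of the velocity `f - γ`, which
must therefore be positive where the front passes. -/
theorem ae_gap (h : Front γ P C c u L f g) :
    ∀ᵐ x : ℝ, x ∈ Ioo 0 c → 0 < L x → γ < f x ∧ L x = (f x - γ)⁻¹ := by
  filter_upwards [h.flux_pos] with x hx h1 h2
  have h3 : L x * (f x - γ) = 1 := by
    have := hx h1 h2
    linarith
  have h4 : 0 < f x - γ := by
    by_contra! h5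
    have := mul_nonpos_of_nonneg_of_nonpos h2.le h5
    linarith
  exact ⟨by linarith, eq_inv_of_mul_eq_one_left h3⟩

theorem integrableOn (h : Front γ P C c u L f g) {s : Set ℝ} (hs : s ⊆ Icc 0 1) :
    IntegrableOn (fun z => u z + 1) s volume :=
  ((locallyIntegrable_add_one h.u_meas h.u_bdd).integrableOn_isCompact isCompact_Icc).mono_set hs

/-- The swept region to the left of `c` is an interval starting at `0`. -/
theorem segment (h : Front γ P C c u L f g) {x y : ℝ} (hx : x ∈ active L) (hxc : x < c)
    (hy : 0 < y) (hyx : y < x) : y ∈ active L := by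
  by_contra hya
  have hyc : y < c := hyx.trans hxc
  -- The first active point to the right of the hypothetical gap at `y`.
  set b := sInf (active L ∩ Ici y) with hb
  have hne : (active L ∩ Ici y).Nonempty := ⟨x, hx, hyx.le⟩
  have hbdd : BddBelow (active L ∩ Ici y) := ⟨y, fun z hz => hz.2⟩
  have hyb' : y ≤ b := le_csInf hne fun z hz => hz.2
  have hbx : b ≤ x := csInf_le hbdd ⟨hx, hyx.le⟩
  have hba : b ∈ active L := by
    refine ⟨⟨hy.trans_le hyb', hbx.trans_lt hx.1.2⟩, ?_⟩
    have h1 := csInf_mem_closure hne hbdd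
    exact Measure.isClosed_support.closure_subset_iff.2 (fun z hz => hz.1.2) h1
  have hyb : y < b := lt_of_le_of_ne hyb' fun he => hya (he ▸ hba)
  have hgap : ∀ z ∈ Ico y b, z ∉ active L := fun z hz hza =>
    not_lt.2 (csInf_le hbdd ⟨hza, hz.1⟩) hz.2
  have hbc : b < c := hbx.trans_lt hxc
  have hC := h.C_nonneg
  -- The flux vanishes at `y` and no active points lie in `[y, b)`. From there on `-g` can only
  -- decrease the flux, and `|u + 1| ≤ C + 1`, so the flux grows at most linearly beyond `b`.
  have hfle : ∀ z ∈ Ico b c, f z ≤ (C + 1) * (z - b) := by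
    intro z hz
    have hyI : y ∈ Ico 0 c := ⟨hy.le, hyc⟩
    have hzI : z ∈ Ico 0 c := ⟨hy.le.trans (hyb'.trans hz.1), hz.2⟩
    have h1 := h.balance y hyI
    have h2 := h.balance z hzI
    rw [h.flux_zero y ⟨hy, hyc⟩ hya] at h1
    have h3 := h.g_mono hyI hzI (hyb'.trans hz.1)
    have hsub : ∀ s : ℝ, Ioc 0 s ∩ active L ⊆ Icc 0 1 := fun s w hw => Ioo_subset_Icc_self hw.2.1
    have hsplit : Ioc 0 z ∩ active L = (Ioc 0 y ∩ active L) ∪ (Icc b z ∩ active L) := by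
      ext w
      constructor
      · rintro ⟨hw1, hw2⟩
        rcases le_or_gt w y with h5 | h5
        · exact Or.inl ⟨⟨hw1.1, h5⟩, hw2⟩
        · exact Or.inr ⟨⟨not_lt.1 fun h6 => hgap w ⟨h5.le, h6⟩ hw2, hw1.2⟩, hw2⟩
      · rintro (⟨hw1, hw2⟩ | ⟨hw1, hw2⟩)
        · exact ⟨⟨hw1.1, hw1.2.trans (hyb'.trans hz.1)⟩, hw2⟩
        · exact ⟨⟨hw2.1.1, hw1.2⟩, hw2⟩
    have hdisj : Disjoint (Ioc 0 y ∩ active L) (Icc b z ∩ active L) := by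
      rw [disjoint_left]
      rintro w ⟨hw1, -⟩ ⟨hw2, -⟩
      exact not_lt.2 hw1.2 (hyb.trans_le hw2.1)
    rw [hsplit, setIntegral_union hdisj (measurableSet_Icc.inter measurableSet_active)
      (h.integrableOn (hsub y)) (h.integrableOn fun w hw => Ioo_subset_Icc_self hw.2.1)] at h2
    have h4 : ‖∫ w in Icc b z ∩ active L, (u w + 1)‖ ≤ (C + 1) *
        volume.real (Icc b z ∩ active L) := by
      refine norm_setIntegral_le_of_norm_le_const
        ((measure_mono inter_subset_left).trans_lt isCompact_Icc.measure_lt_top) fun w _ => ?_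
      refine (norm_add_le _ _).trans ?_
      rw [norm_one]
      linarith [h.u_bdd w, Real.norm_eq_abs (u w)]
    have h5 : volume.real (Icc b z ∩ active L) ≤ z - b := by
      refine (measureReal_mono inter_subset_left isCompact_Icc.measure_ne_top).trans ?_
      rw [measureReal_def, Real.volume_Icc, ENNReal.toReal_ofReal (by linarith [hz.1])]
    have h6 := (abs_le.1 (h4.trans (mul_le_mul_of_nonneg_left h5 (by linarith)))).1
    linarith
  -- Within distance `γ / (C + 1)` of `b` the flux stays below `γ`, so `L > 0` almost nowhere there,
  -- although `b` lies in the support of `{L > 0}`.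
  set η := min (c - b) (γ / (C + 1))
  have hη : 0 < η := lt_min (by linarith) (div_pos h.γ_pos (by linarith))
  have hU : Ioo y (b + η) ∈ 𝓝 b := isOpen_Ioo.mem_nhds ⟨hyb, by linarith⟩
  have h1 := (Measure.mem_support_iff_forall b).1 hba.2 _ hU
  rw [Measure.restrict_apply' (measurableSet_lt measurable_const h.usc.measurable)] at h1
  refine h1.ne' (measure_eq_zero_iff_ae_notMem.2 ?_)
  have hb0 : ∀ᵐ z : ℝ, z ≠ b := by
    rw [ae_iff]; simp
  filter_upwards [h.ae_gap, ae_mem_active h.usc.measurable, hb0] with z hz1 hz2 hz3 hz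
  have hLz : 0 < L z := hz.2
  rcases lt_or_gt_of_ne hz3 with h2 | h2
  · refine hgap z ⟨hz.1.1.le, h2⟩ (hz2 ⟨hy.trans hz.1.1, ?_⟩ hLz)
    exact h2.trans hba.1.2
  · have h3 : z - b < η := by linarith [hz.1.2]
    have h4 := h3.trans_le (min_le_left _ _)
    have h5 := h3.trans_le (min_le_right _ _)
    rw [lt_div_iff₀ (by linarith)] at h5
    have h6 := (hz1 ⟨hy.trans hz.1.1, by linarith⟩ hLz).1
    have h7 := hfle z ⟨h2.le, by linarith⟩
    linarith

theorem Ioo_subset_of_mem (h : Front γ P C c u L f g) {x : ℝ} (hx : x ∈ active L)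
    (hxc : x < c) : Ioo 0 x ⊆ active L := fun _ hy => h.segment hx hxc hy.1 hy.2

theorem balance_of_subset (h : Front γ P C c u L f g) {x : ℝ} (hx : x ∈ Ico 0 c)
    (hsub : Ioo 0 x ⊆ active L) : f x = P - g x - ∫ z in (0 : ℝ)..x, (u z + 1) := by
  rw [h.balance x hx, intervalIntegral.integral_of_le hx.1]
  congr 1
  refine setIntegral_congr_set ?_
  have hx0 : ∀ᵐ z : ℝ, z ≠ x := by
    rw [ae_iff]; simp
  filter_upwards [hx0] with z hz
  exact propext ⟨fun h => h.1, fun h => ⟨h, hsub ⟨h.1, lt_of_le_of_ne h.2 hz⟩⟩⟩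

theorem ae_speed (h : Front γ P C c u L f g) {x : ℝ} (hxc : x ≤ c) (hsub : Ioo 0 x ⊆ active L) :
    ∀ᵐ z : ℝ, z ∈ Ioo 0 x → γ < f z ∧ L z = (f z - γ)⁻¹ ∧
      f z = P - g z - ∫ z in (0 : ℝ)..z, (u z + 1) := by
  filter_upwards [h.ae_gap] with z hz hz'
  obtain ⟨h1, h2⟩ := hz ⟨hz'.1, hz'.2.trans_le hxc⟩ (pos_of_mem_active h.usc h.ne_zero (hsub hz'))
  exact ⟨h1, h2, h.balance_of_subset ⟨hz'.1.le, hz'.2.trans_le hxc⟩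
    fun w hw => hsub ⟨hw.1, hw.2.trans hz'.2⟩⟩

/-- The velocity `P - γ - g - ∫ (u + 1)` is positive almost everywhere on a swept segment and `g ≥
0`; continuity extends the bound from a dense set to the endpoint. -/
theorem integral_le (h : Front γ P C c u L f g) {a : ℝ} (ha : 0 ≤ a) (hac : a ≤ c)
    (hsub : Ioo 0 a ⊆ active L) : ∫ z in (0 : ℝ)..a, (u z + 1) ≤ P - γ := by
  rcases ha.eq_or_lt with rfl | ha
  · rw [intervalIntegral.integral_same]
    linarith [h.γ_lt]
  have hcont := continuous_integral_add_one h.u_meas h.u_bdd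
  by_contra! hlt
  have hd := Measure.dense_of_ae (h.ae_speed hac hsub)
  have hop : IsOpen {z | P - γ < ∫ r in (0 : ℝ)..z, (u r + 1)} := isOpen_lt continuous_const hcont
  have hne : ({z | P - γ < ∫ r in (0 : ℝ)..z, (u r + 1)} ∩ Ioo 0 a).Nonempty := by
    have : a ∈ closure (Ioo 0 a) := by
      rw [closure_Ioo ha.ne]; exact ⟨ha.le, le_rfl⟩
    exact mem_closure_iff.1 this _ hop hlt
  obtain ⟨z, ⟨hz1, hz2⟩, hz3⟩ := hd.inter_open_nonempty _ (hop.inter isOpen_Ioo) hne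
  obtain ⟨h1, -, h2⟩ := hz3 hz2
  have h3 := h.g_nonneg z ⟨hz2.1.le, hz2.2.trans_le hac⟩
  have h4 : P - γ < ∫ r in (0 : ℝ)..z, (u r + 1) := hz1
  linarith

/-- Dropping the excess `g ≥ 0` from the velocity only makes the front faster. -/
theorem frontTime_le (h : Front γ P C c u L f g) {x : ℝ} (hx : x ∈ active L) (hxc : x < c) :
    frontTime u (P - γ) x ≤ ENNReal.ofReal (costLeft L x) := by
  rw [costLeft, ← lintegral_Ioc_ofReal h.locInt hx.1.1.le, frontTime,
    ← Measure.restrict_congr_set (Ioo_ae_eq_Ioc (μ := volume))]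
  refine setLIntegral_mono_ae h.usc.measurable.ennreal_ofReal.aemeasurable ?_
  filter_upwards [h.ae_speed hxc.le (h.Ioo_subset_of_mem hx hxc)] with z hz hz'
  obtain ⟨h1, h2, h3⟩ := hz hz'
  have h4 := h.g_nonneg z ⟨hz'.1.le, hz'.2.trans hxc⟩
  rw [h2, ENNReal.ofReal_inv_of_pos (by linarith)]
  exact ENNReal.inv_le_inv.2 (ENNReal.ofReal_le_ofReal (by linarith))

/-- The reverse of `frontTime_le`: an excess of at most `δ` slows the front at most as much as
lowering its initial velocity by `δ`. -/
theorem costLeft_le (h : Front γ P C c u L f g) {x δ t : ℝ}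
    (hg : ∀ z ∈ Ico 0 c, costLeft L z ≤ t → g z ≤ δ) (hx : x ∈ Icc 0 c)
    (hsub : Ioo 0 x ⊆ active L) (ht : costLeft L x ≤ t) :
    ENNReal.ofReal (costLeft L x) ≤ frontTime u (P - γ - δ) x := by
  rw [costLeft, ← lintegral_Ioc_ofReal h.locInt hx.1, frontTime,
    ← Measure.restrict_congr_set (Ioo_ae_eq_Ioc (μ := volume))]
  have hm : Measurable fun z =>
      (ENNReal.ofReal (P - γ - δ - ∫ r in (0 : ℝ)..z, (u r + 1)))⁻¹ :=
    ((continuous_const.sub (continuous_integral_add_one h.u_meas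
      h.u_bdd)).measurable.ennreal_ofReal).inv
  refine setLIntegral_mono_ae hm.aemeasurable ?_
  filter_upwards [h.ae_speed hx.2 hsub] with z hz hz'
  obtain ⟨h1, h2, h3⟩ := hz hz'
  have h4 := hg z ⟨hz'.1.le, hz'.2.trans_le hx.2⟩
    ((costLeft_mono h.locInt hz'.2.le).trans ht)
  rw [h2, ENNReal.ofReal_inv_of_pos (by linarith)]
  exact ENNReal.inv_le_inv.2 (ENNReal.ofReal_le_ofReal (by linarith))

/-- An excess below `γ` cannot stop the front. At an unswept `y` the flux is `0`, and the swept part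
of `(0, y]` is an initial segment `(0, a]`, up to its endpoint, with `∫_0^a (u + 1) ≤ P - γ`. The
balance then gives `0 ≥ P - δ - (P - γ) = γ - δ > 0`. -/
theorem subset_of_costLeft_le (h : Front γ P C c u L f g) {x δ t : ℝ} (hδ : δ < γ)
    (hg : ∀ z ∈ Ico 0 c, costLeft L z ≤ t → g z ≤ δ) (hx : x ≤ c)
    (ht : costLeft L x ≤ t) : Ioo 0 x ⊆ active L := by
  intro y hy
  by_contra hya
  have hyc : y < c := hy.2.trans_le hx
  have h1 := h.balance y ⟨hy.1.le, hyc⟩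
  rw [h.flux_zero y ⟨hy.1, hyc⟩ hya] at h1
  have h2 := hg y ⟨hy.1.le, hyc⟩ ((costLeft_mono h.locInt hy.2.le).trans ht)
  set Z := {z | z ∈ Icc 0 y ∧ Ioo 0 z ⊆ active L} with hZ
  have hne : Z.Nonempty := ⟨0, ⟨le_rfl, hy.1.le⟩, by simp⟩
  have hbdd : BddAbove Z := ⟨y, fun z hz => hz.1.2⟩
  have ha0 : 0 ≤ sSup Z := le_csSup hbdd ⟨⟨le_rfl, hy.1.le⟩, by simp⟩
  have hay : sSup Z ≤ y := csSup_le hne fun z hz => hz.1.2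
  have hasub : Ioo 0 (sSup Z) ⊆ active L := by
    intro w hw
    obtain ⟨z, hz, hwz⟩ := exists_lt_of_lt_csSup hne hw.2
    exact hz.2 ⟨hw.1, hwz⟩
  have hset : Ioc 0 y ∩ active L = Ioc 0 (sSup Z) ∩ active L := by
    ext w
    constructor
    · rintro ⟨hw1, hw2⟩
      have hwy : w < y := lt_of_le_of_ne hw1.2 fun he => hya (he ▸ hw2)
      exact ⟨⟨hw1.1, le_csSup hbdd ⟨⟨hw1.1.le, hwy.le⟩,
        h.Ioo_subset_of_mem hw2 (hwy.trans hyc)⟩⟩, hw2⟩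
    · rintro ⟨hw1, hw2⟩
      exact ⟨⟨hw1.1, hw1.2.trans hay⟩, hw2⟩
  have haI : sSup Z ∈ Ico 0 c := ⟨ha0, hay.trans_lt hyc⟩
  have h3 := h.integral_le ha0 haI.2.le hasub
  have h4 := h.balance _ haI
  rw [h.balance_of_subset haI hasub] at h4
  rw [hset] at h1
  linarith

/-- The bound on `g` is available only while the cost is at most `t`, so `costLeft_le` cannot be
applied at `x` directly. This removes the a priori assumption by continuity of the cost. -/
theorem costLeft_lt (h : Front γ P C c u L f g) {x δ t : ℝ} (hδ : δ < γ)
    (hg : ∀ z ∈ Ico 0 c, costLeft L z ≤ t → g z ≤ δ) (hx : x ∈ Icc 0 c)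
    (ht : frontTime u (P - γ - δ) x < ENNReal.ofReal t) : costLeft L x < t := by
  by_contra! hle
  -- If the cost at `x` were at least `t`, it would take the value `s` at some `z ≤ x`, and
  -- `costLeft_le` at `z` would give `s ≤ frontTime z ≤ frontTime x < s`.
  obtain ⟨s, hs1, hs2⟩ := ENNReal.lt_iff_exists_nnreal_btwn.1 ht
  have hst : (s : ℝ) < t := by
    rw [ENNReal.ofReal, ENNReal.coe_lt_coe] at hs2
    rwa [← Real.lt_toNNReal_iff_coe_lt]
  have hsm : (s : ℝ) ∈ Icc (costLeft L 0) (costLeft L x) := by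
    rw [costLeft_zero]
    exact ⟨s.coe_nonneg, hst.le.trans hle⟩
  obtain ⟨z, hz, hzs⟩ := intermediate_value_Icc hx.1
    (continuous_costLeft h.locInt).continuousOn hsm
  have h1 : costLeft L z ≤ t := by linarith
  have h2 := h.subset_of_costLeft_le hδ hg (hz.2.trans hx.2) h1
  have h3 := h.costLeft_le hg ⟨hz.1, hz.2.trans hx.2⟩ h2 h1
  rw [hzs, ENNReal.ofReal_coe_nnreal] at h3
  exact not_lt.2 (h3.trans (frontTime_mono u _ hz.2)) hs1

end Front

end

section

/-! ### Reflection at `1/2`, which exchanges the two interfaces. -/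

section Reflection

/-- The reflection of a function at `1/2`. -/
def reflect (f : ℝ → ℝ) (x : ℝ) : ℝ := f (1 - x)

theorem reflect_reflect (f : ℝ → ℝ) : reflect (reflect f) = f := by
  funext x; simp [reflect]

theorem measurePreserving_reflection : MeasurePreserving (fun x : ℝ => 1 - x) volume volume :=
  Measure.measurePreserving_sub_left volume 1

theorem measure_preimage_reflection (s : Set ℝ) :
    volume ((fun x : ℝ => 1 - x) ⁻¹' s) = volume s :=
  measurePreserving_reflection.measure_preimage_emb (MeasurableEquiv.subLeft 1).measurableEmbedding s

theorem mem_active_reflect {L : ℝ → ℝ} {x : ℝ} : x ∈ active (reflect L) ↔ 1 - x ∈ active L := by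
  have key : ∀ (L : ℝ → ℝ) (x : ℝ), 1 - x ∈ active L → x ∈ active (reflect L) := by
    intro L x hx
    refine ⟨⟨by linarith [hx.1.2], by linarith [hx.1.1]⟩, ?_⟩
    refine (Measure.mem_support_iff_forall x).2 fun U hU => ?_
    obtain ⟨V, hVU, hV, hxV⟩ := mem_nhds_iff.1 hU
    have hV' : (fun x : ℝ => 1 - x) ⁻¹' V ∈ 𝓝 (1 - x) :=
      (hV.preimage (continuous_const.sub continuous_id)).mem_nhds (by simpa using hxV)
    have h1 := (Measure.mem_support_iff_forall (1 - x)).1 hx.2 _ hV'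
    rw [Measure.restrict_apply (hV.measurableSet.preimage
      measurePreserving_reflection.measurable), ← measure_preimage_reflection] at h1
    refine h1.trans_le ?_
    have : (fun x : ℝ => 1 - x) ⁻¹' ((fun x : ℝ => 1 - x) ⁻¹' V ∩ {t | 0 < L t}) =
        V ∩ {t | 0 < reflect L t} := by
      ext z
      simp [reflect]
    rw [this]
    exact (Measure.le_restrict_apply _ _).trans (measure_mono hVU)
  refine ⟨fun h => ?_, key L x⟩
  have := key (reflect L) (1 - x) (by simpa using h)
  rwa [reflect_reflect] at this

theorem costLeft_reflect (L : ℝ → ℝ) (x : ℝ) : costLeft (reflect L) x = costRight L (1 - x) := by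
  have := intervalIntegral.integral_comp_sub_left (a := 0) (b := x)
    (fun t => max (L t) 0) (1 : ℝ)
  rw [sub_zero] at this
  exact this

theorem costRight_reflect (L : ℝ → ℝ) (x : ℝ) : costRight (reflect L) x = costLeft L (1 - x) := by
  have h := costLeft_reflect (reflect L) (1 - x)
  rw [reflect_reflect, sub_sub_cancel] at h
  exact h.symm

theorem integral_reflect (u : ℝ → ℝ) (z : ℝ) :
    ∫ r in (0 : ℝ)..(1 - z), (reflect u r + 1) = ∫ r in z..(1 : ℝ), (u r + 1) := by
  have := intervalIntegral.integral_comp_sub_left (a := 0) (b := 1 - z)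
    (fun t => u t + 1) (1 : ℝ)
  rw [sub_zero, sub_sub_cancel] at this
  exact this

theorem aemeasurable_reflect {u : ℝ → ℝ} (hu : AEMeasurable u volume) :
    AEMeasurable (reflect u) volume :=
  hu.comp_quasiMeasurePreserving measurePreserving_reflection.quasiMeasurePreserving

theorem upperSemicontinuous_reflect {L : ℝ → ℝ} (h : UpperSemicontinuous L) :
    UpperSemicontinuous (reflect L) :=
  upperSemicontinuous_iff_isOpen_preimage.2 fun y =>
    (upperSemicontinuous_iff_isOpen_preimage.1 h y).preimage (continuous_const.sub continuous_id)

theorem locallyIntegrable_reflect {L : ℝ → ℝ} (h : LocallyIntegrable L volume) :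
    LocallyIntegrable (reflect L) volume := by
  rw [locallyIntegrable_iff]
  intro K hK
  have hK' : IsCompact ((fun x : ℝ => 1 - x) ⁻¹' K) := by
    rw [show (fun x : ℝ => 1 - x) ⁻¹' K = (fun x : ℝ => 1 - x) '' K by
      ext z
      simp only [mem_preimage, mem_image]
      exact ⟨fun h => ⟨1 - z, h, by ring⟩, by rintro ⟨w, hw, rfl⟩; simpa using hw⟩]
    exact hK.image (continuous_const.sub continuous_id)
  have h1 := h.integrableOn_isCompact hK'
  have h2 := (measurePreserving_reflection.integrableOn_comp_preimage
    (MeasurableEquiv.subLeft 1).measurableEmbedding (f := L)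
    (s := (fun x : ℝ => 1 - x) ⁻¹' K)).2 h1
  have h3 : (fun x : ℝ => 1 - x) ⁻¹' ((fun x : ℝ => 1 - x) ⁻¹' K) = K := by
    ext z; simp
  rw [h3] at h2
  exact h2

end Reflection

/-! ### Conservation of mass along a single path. -/

section Balance

theorem measureReal_add_add_eq {α : Type*} [MeasurableSpace α] {Q : Measure α}
    [IsFiniteMeasure Q] {A B C D E : Set α} (hA : MeasurableSet A) (hB : MeasurableSet B)
    (hC : MeasurableSet C) (hD : MeasurableSet D) (hE : MeasurableSet E)
    (h : ∀ᵐ p ∂Q, A.indicator (1 : α → ℝ) p + B.indicator 1 p + C.indicator 1 p =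
      D.indicator 1 p + E.indicator 1 p) :
    Q.real A + Q.real B + Q.real C = Q.real D + Q.real E := by
  have hint : ∀ {S : Set α}, MeasurableSet S → Integrable (S.indicator (1 : α → ℝ)) Q :=
    fun hS => (integrable_const (1 : ℝ)).indicator hS
  have := integral_congr_ae h
  rw [integral_add (f := fun a => A.indicator 1 a + B.indicator 1 a)
    ((hint hA).add (hint hB)) (hint hC), integral_add (hint hA) (hint hB),
    integral_add (hint hD) (hint hE)] at this
  simpa only [integral_indicator_one hA, integral_indicator_one hB, integral_indicator_one hC,
    integral_indicator_one hD, integral_indicator_one hE] using this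

variable {L : ℝ → ℝ} {p : StoppedPath solid × ℝ≥0}

-- A pathwise count of mass in `(-∞, x]`: what rests there, starts there, or crosses `x` into it
-- must leave through `0` or stop there. Paths moving right start at or beyond `c > x` and
-- contribute nothing, so crossings of `x` go to the left only. A path with `start = finish` cancels
-- itself.
open Classical in
theorem IsTight.balance_left (h : IsTight L p) (hm : Measurable L)
    (hi : LocallyIntegrable L volume) {c : ℝ} (hc : costLeft L c = costRight L c)
    (hc1 : c ≤ 1) {x : ℝ} (hx : x ∈ Ico 0 c) :
    (if start p ∈ Iic x ∧ p.1.θ = 0 then (1 : ℝ) else 0) +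
        (if start p ∈ Iic x ∩ active L then 1 else 0) + (if x ∈ crossed p then 1 else 0) =
      (if finish p = 0 then 1 else 0) + (if finish p ∈ Iic x ∩ active L then 1 else 0) := by
  have hx0 := hx.1
  have hxc := hx.2
  by_cases hθ : p.1.θ = 0
  · obtain ⟨h1, h2⟩ := h.start_of_θ_eq_zero hθ
    have h3 : start p ∉ active L := fun h => by
      have := h.1.1; have := h.1.2
      rcases h2 with h2 | h2 <;> linarith
    have h4 : x ∉ crossed p := by simp [crossed, h1]
    rcases h2 with h2 | h2
    · have : start p ∈ Iic x := by rw [h2]; exact hx0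
      simp [h1, h4, hθ, h2, hx0]
    · have : start p ∉ Iic x := fun h => by
        have : start p ≤ x := h
        linarith
      simp [h1, h3, h4, this]
      rw [h2]; exact one_ne_zero
  · have hθ' : 0 < p.1.θ := pos_iff_ne_zero.2 hθ
    have hs : start p ∈ Ioo (0 : ℝ) 1 := p.1.pos_zero_mem_Ioo_iff.2 hθ'
    have hf := finish_mem_Icc (p := p) hθ'
    rcases lt_trichotomy (finish p) (start p) with hlt | heq | hlt
    · have h1 := h.start_le hm hi hc hlt
      have h2 : start p ∈ active L := h.mem_active hm hi hlt.ne' left_mem_uIcc hs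
      have h3 : x ∈ crossed p ↔ finish p ≤ x ∧ x < start p := by
        simp [crossed, hlt.le]
      rcases hf.1.eq_or_lt with h0 | h0
      · have h4 : (0 : ℝ) ∉ active L := fun h => lt_irrefl _ h.1.1
        by_cases h5 : start p ≤ x
        · simp [hθ, h2, h3, ← h0, h5, hx0, h4, not_lt.2 h5]
        · simp [hθ, h3, ← h0, h5, hx0, h4, not_le.1 h5]
      · have h4 : finish p ∈ active L :=
          h.mem_active hm hi hlt.ne' right_mem_uIcc ⟨h0, hlt.trans hs.2⟩
        by_cases h5 : start p ≤ x
        · have : finish p ≤ x := by linarith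
          simp [hθ, h2, h3, h5, h0.ne', h4, this]
        · by_cases h6 : finish p ≤ x
          · simp [hθ, h2, h3, h5, h0.ne', h4, h6, not_le.1 h5]
          · simp [hθ, h2, h3, h5, h0.ne', h6]
    · have h4 : x ∉ crossed p := by simp [crossed, heq]
      simp [hθ, h4, heq, hs.1.ne']
    · have h1 := h.le_start hm hi hc hlt
      have h3 : x ∉ crossed p := by
        simp only [crossed, mem_union, mem_Ico, mem_Ioc, not_or, not_and_or, not_le, not_lt]
        exact ⟨Or.inl (by linarith), Or.inl (by linarith)⟩
      have h4 : ¬ start p ≤ x := by linarith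
      have h5 : ¬ finish p ≤ x := by linarith
      have h6 : finish p ≠ 0 := by linarith [hs.1]
      simp [h3, h4, h5, h6]

open Classical in
theorem IsTight.balance_right (h : IsTight L p) (hm : Measurable L)
    (hi : LocallyIntegrable L volume) {c : ℝ} (hc : costLeft L c = costRight L c)
    (hc0 : 0 ≤ c) {x : ℝ} (hx : x ∈ Ioc c 1) :
    (if start p ∈ Ici x ∧ p.1.θ = 0 then (1 : ℝ) else 0) +
        (if start p ∈ Ici x ∩ active L then 1 else 0) + (if x ∈ crossed p then 1 else 0) =
      (if finish p = 1 then 1 else 0) + (if finish p ∈ Ici x ∩ active L then 1 else 0) := by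
  have hx1 := hx.2
  have hxc := hx.1
  by_cases hθ : p.1.θ = 0
  · obtain ⟨h1, h2⟩ := h.start_of_θ_eq_zero hθ
    have h3 : start p ∉ active L := fun h => by
      have := h.1.1; have := h.1.2
      rcases h2 with h2 | h2 <;> linarith
    have h4 : x ∉ crossed p := by simp [crossed, h1]
    rcases h2 with h2 | h2
    · have : start p ∉ Ici x := fun h => by
        have : x ≤ start p := h
        linarith
      simp [h1, h3, h4, this]
      rw [h2]; exact zero_ne_one
    · have : start p ∈ Ici x := by rw [h2]; exact hx1
      simp [h1, h4, hθ, h2, hx1]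
  · have hθ' : 0 < p.1.θ := pos_iff_ne_zero.2 hθ
    have hs : start p ∈ Ioo (0 : ℝ) 1 := p.1.pos_zero_mem_Ioo_iff.2 hθ'
    have hf := finish_mem_Icc (p := p) hθ'
    rcases lt_trichotomy (start p) (finish p) with hlt | heq | hlt
    · have h1 := h.le_start hm hi hc hlt
      have h2 : start p ∈ active L := h.mem_active hm hi hlt.ne left_mem_uIcc hs
      have h3 : x ∈ crossed p ↔ start p < x ∧ x ≤ finish p := by
        simp [crossed, hlt.le]
      rcases hf.2.eq_or_lt with h0 | h0
      · have h4 : (1 : ℝ) ∉ active L := fun h => lt_irrefl _ h.1.2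
        by_cases h5 : x ≤ start p
        · simp [hθ, h2, h3, h0, h5, hx1, h4, not_lt.2 h5]
        · simp [hθ, h3, h0, h5, hx1, h4, not_le.1 h5]
      · have h4 : finish p ∈ active L :=
          h.mem_active hm hi hlt.ne right_mem_uIcc ⟨hs.1.trans hlt, h0⟩
        by_cases h5 : x ≤ start p
        · have : x ≤ finish p := by linarith
          simp [hθ, h2, h3, h5, h0.ne, h4, this]
        · by_cases h6 : x ≤ finish p
          · simp [hθ, h2, h3, h5, h0.ne, h4, h6, not_le.1 h5]
          · simp [hθ, h2, h3, h5, h0.ne, h6]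
    · have h4 : x ∉ crossed p := by simp [crossed, heq]
      simp [hθ, h4, ← heq, hs.2.ne]
    · have h1 := h.start_le hm hi hc hlt
      have h3 : x ∉ crossed p := by
        simp only [crossed, mem_union, mem_Ico, mem_Ioc, not_or, not_and_or, not_le, not_lt]
        exact ⟨Or.inr (by linarith), Or.inr (by linarith)⟩
      have h4 : ¬ x ≤ start p := by linarith
      have h5 : ¬ x ≤ finish p := by linarith
      have h6 : finish p ≠ 1 := by linarith [hs.2]
      simp [h3, h4, h5, h6]

end Balance

end

/-! ### The arrival time of an equilibrium between two front times. -/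

section

/-- The minimum of the arrival times of two fronts started at `0` and at `1`. -/
def twoFrontTime (u : ℝ → ℝ) (v₀ v₁ x : ℝ) : ℝ≥0∞ :=
  min (frontTime u v₀ x) (frontTime (reflect u) v₁ (1 - x))

theorem minCost_reflect (L : ℝ → ℝ) (x : ℝ) : minCost (reflect L) (1 - x) = minCost L x := by
  rw [minCost, minCost, costLeft_reflect, costRight_reflect, sub_sub_cancel, min_comm]

/-- If the left front is first at `x ≤ c`, the one-front estimates apply directly. Otherwise the
right front reaches `x`, hence `c`, before `t`; as both costs agree at `c`, the left front has then
passed all of `(0, c)` by the same time, and with it `x`. -/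
theorem Front.minCost_le_twoFrontTime {γ P P' C c : ℝ} {u L f g f' g' : ℝ → ℝ}
    (F : Front γ P C c u L f g) (F' : Front γ P' C (1 - c) (reflect u) (reflect L) f' g')
    (hc : costLeft L c = costRight L c) {δ t : ℝ} (hδ : δ < γ)
    (hg : ∀ z ∈ Ico 0 c, costLeft L z ≤ t → g z ≤ δ)
    (hg' : ∀ z ∈ Ico 0 (1 - c), costLeft (reflect L) z ≤ t → g' z ≤ δ)
    {x : ℝ} (hx : x ∈ Ioo (0 : ℝ) 1) (hxc : x ≤ c)
    (ht : twoFrontTime u (P - γ - δ) (P' - γ - δ) x < ENNReal.ofReal t) :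
    x ∈ active L ∧
      ENNReal.ofReal (minCost L x) ≤ twoFrontTime u (P - γ - δ) (P' - γ - δ) x := by
  have hmin : ENNReal.ofReal (minCost L x) ≤ ENNReal.ofReal (costLeft L x) :=
    ENNReal.ofReal_le_ofReal (min_le_left _ _)
  rcases min_choice (frontTime u (P - γ - δ) x)
    (frontTime (reflect u) (P' - γ - δ) (1 - x)) with h1 | h1
  · rw [twoFrontTime, h1] at ht ⊢
    have h2 := (F.costLeft_lt hδ hg ⟨hx.1.le, hxc⟩ ht).le
    have h3 := F.subset_of_costLeft_le hδ hg hxc h2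
    exact ⟨mem_active_of_subset hx.1 ⟨hx.1.le, le_rfl⟩ hx F.usc F.ne_zero h3,
      hmin.trans (F.costLeft_le hg ⟨hx.1.le, hxc⟩ h3 h2)⟩
  · rw [twoFrontTime, h1] at ht ⊢
    have h0 : frontTime (reflect u) (P' - γ - δ) (1 - c) ≤
        frontTime (reflect u) (P' - γ - δ) (1 - x) := frontTime_mono _ _ (by linarith)
    have hm : 1 - c ∈ Icc (0 : ℝ) (1 - c) := ⟨F'.c_mem.1, le_rfl⟩
    have h2 := F'.costLeft_lt hδ hg' hm (h0.trans_lt ht)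
    have h3 := F'.subset_of_costLeft_le hδ hg' le_rfl h2.le
    have h4 := F'.costLeft_le hg' hm h3 h2.le
    rw [costLeft_reflect, sub_sub_cancel, ← hc] at h2 h4
    have h5 := F.subset_of_costLeft_le hδ hg le_rfl h2.le
    exact ⟨mem_active_of_subset (hx.1.trans_le hxc) ⟨hx.1.le, hxc⟩ hx F.usc F.ne_zero h5,
      hmin.trans ((ENNReal.ofReal_le_ofReal (costLeft_mono F.locInt hxc)).trans (h4.trans h0))⟩

theorem exists_costLeft_eq_costRight {L : ℝ → ℝ} (hi : LocallyIntegrable L volume) :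
    ∃ c ∈ Icc (0 : ℝ) 1, costLeft L c = costRight L c := by
  have h0 : costLeft L 0 - costRight L 0 ≤ 0 := by
    rw [costLeft_zero, zero_sub, neg_nonpos]
    exact integral_posPart_nonneg zero_le_one
  have h1 : 0 ≤ costLeft L 1 - costRight L 1 := by
    rw [costRight_one, sub_zero]
    exact integral_posPart_nonneg zero_le_one
  obtain ⟨c, hc, hc'⟩ := intermediate_value_Icc (zero_le_one (α := ℝ))
    ((continuous_costLeft hi).sub (continuous_costRight hi)).continuousOn ⟨h0, h1⟩
  exact ⟨c, hc, sub_eq_zero.1 hc'⟩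

namespace Triple

/-- The mass of the exit measure at a point. -/
def exitMass (X : Triple solid) (i : ℝ) : ℝ := (X.exitMeasure {i}).toReal

namespace IsCappedEquilibrium

variable {γ C : ℝ} {T : ℝ≥0} {X : Triple solid} {u : ℝ → ℝ}

/-- Stopping at `β = θ` is the same as finishing in the solid, and tight paths do so only at `0` or
`1`. -/
theorem exitMeasure_apply (h : X.IsCappedEquilibrium γ T) {B : Set ℝ} (hB : MeasurableSet B) :
    X.exitMeasure B = ENNReal.ofReal X.κ * X.Q {p | finish p ∈ B ∩ {0, 1}} := by
  have hm : Measurable fun p : StoppedPath solid × ℝ≥0 => p.1.pos p.1.θ :=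
    StoppedPath.measurable_pos_comp (StoppedPath.measurable_θ.comp
      measurable_fst).coe_nnreal_real measurable_fst
  rw [exitMeasure, Measure.smul_apply, Measure.map_apply hm hB, Measure.restrict_apply (hm hB),
    smul_eq_mul]
  congr 1
  refine measure_congr ?_
  filter_upwards [h.ae_isTight] with p hp
  refine propext ⟨fun hx => ?_, fun hx => ?_⟩
  · have h1 : p.2 = p.1.θ := hx.2
    have h2 : finish p = p.1.pos p.1.θ := by rw [finish, h1]
    change finish p ∈ _
    rw [h2]
    exact ⟨hx.1, hp.exit h1⟩
  · have hx1 : finish p ∈ B ∩ {0, 1} := hx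
    have h1 : p.2 = p.1.θ := hp.finish_mem_solid_iff.1 (by
      rcases hx1.2 with h | h
      · rw [h]; exact Or.inl (mem_Iic.2 le_rfl)
      · rw [h]; exact Or.inr (mem_Ici.2 le_rfl))
    refine ⟨?_, h1⟩
    change p.1.pos p.1.θ ∈ B
    rw [← h1]
    exact hx1.1

theorem exitMass_eq (h : X.IsCappedEquilibrium γ T) {i : ℝ} (hi : i = 0 ∨ i = 1) :
    X.exitMass i = X.κ * X.Q.real {p | finish p = i} := by
  rw [exitMass, h.exitMeasure_apply (measurableSet_singleton i), ENNReal.toReal_mul,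
    ENNReal.toReal_ofReal h.κ_pos.le, measureReal_def]
  have : ({i} : Set ℝ) ∩ {0, 1} = {i} := inter_eq_left.2 (by simpa using hi)
  rw [this]
  rfl

theorem excess_eq (h : X.IsCappedEquilibrium γ T) (hγ : 0 < γ) (B : Set ℝ) :
    X.excess u B = X.κ * X.Q.real {p | start p ∈ B ∧ p.1.θ = 0} +
      (X.κ * X.Q.real {p | start p ∈ B ∩ active X.L} -
        X.κ * X.Q.real {p | finish p ∈ B ∩ active X.L} - ∫ x in B ∩ active X.L, (u x + 1)) := by
  rw [excess, h.swept_eq hγ]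
  simp only [add_comm (1 : ℝ)]
  rfl

theorem excess_inter (h : X.IsCappedEquilibrium γ T) (hγ : 0 < γ) (B : Set ℝ) :
    X.excess u (B ∩ (solid ∪ active X.L)) = X.excess u B := by
  have h1 : B ∩ (solid ∪ active X.L) ∩ active X.L = B ∩ active X.L := by
    ext x
    simp only [mem_inter_iff, mem_union]
    tauto
  have h2 : {p : StoppedPath solid × ℝ≥0 | start p ∈ B ∩ (solid ∪ active X.L) ∧ p.1.θ = 0} =
      {p | start p ∈ B ∧ p.1.θ = 0} := by
    ext p
    simp only [mem_ofPred_eq, mem_inter_iff]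
    constructor
    · rintro ⟨⟨h1, -⟩, h2⟩
      exact ⟨h1, h2⟩
    · rintro ⟨h1, h2⟩
      exact ⟨⟨h1, Or.inl (p.1.θ_eq_zero_iff_mem_solid.1 h2)⟩, h2⟩
  rw [h.excess_eq hγ, h.excess_eq hγ, h1, h2]

theorem integrableOn_active (hu : AEMeasurable u volume) (hb : ∀ x, |u x| ≤ C) (L : ℝ → ℝ)
    (B : Set ℝ) : IntegrableOn (fun x => u x + 1) (B ∩ active L) volume :=
  ((locallyIntegrable_add_one hu hb).integrableOn_isCompact isCompact_Icc).mono_set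
    (inter_subset_right.trans (active_subset.trans Ioo_subset_Icc_self))

/-- The excess is a real-valued set function, so additivity is checked term by term; admissibility
supplies the sign of the difference. -/
theorem excess_mono (h : X.IsCappedEquilibrium γ T) (hγ : 0 < γ) (hu : AEMeasurable u volume)
    (hb : ∀ x, |u x| ≤ C) (hadm : X.IsAdmissible u) {B B' : Set ℝ} (hB : MeasurableSet B)
    (hB' : MeasurableSet B') (hsub : B ⊆ B') : X.excess u B ≤ X.excess u B' := by
  have := h.isProbability
  have hD := hB'.diff hB
  have key : X.excess u B' = X.excess u B + X.excess u (B' \ B) := by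
    have hun : B' = B ∪ B' \ B := (union_sdiff_cancel hsub).symm
    have hdj : Disjoint B (B' \ B) := disjoint_sdiff_right
    have hmA : ∀ {S : Set ℝ}, MeasurableSet S →
        MeasurableSet {p : StoppedPath solid × ℝ≥0 | start p ∈ S ∧ p.1.θ = 0} := fun hS =>
      (measurable_start hS).inter ((StoppedPath.measurable_θ.comp measurable_fst)
        (measurableSet_singleton 0))
    have e1 : X.Q.real {p | start p ∈ B' ∧ p.1.θ = 0} = X.Q.real {p | start p ∈ B ∧ p.1.θ = 0} +
        X.Q.real {p | start p ∈ B' \ B ∧ p.1.θ = 0} := by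
      rw [← measureReal_union _ (hmA hD)]
      · congr 1
        ext p
        simp only [mem_ofPred_eq, mem_union, Set.mem_sdiff]
        have := @hsub (start p)
        tauto
      · rw [disjoint_left]
        exact fun p hp hp' => hp'.1.2 hp.1
    have e2 : ∀ {F : StoppedPath solid × ℝ≥0 → ℝ}, Measurable F →
        X.Q.real {p | F p ∈ B' ∩ active X.L} = X.Q.real {p | F p ∈ B ∩ active X.L} +
        X.Q.real {p | F p ∈ (B' \ B) ∩ active X.L} := by
      intro F hF
      have hm : MeasurableSet {p | F p ∈ (B' \ B) ∩ active X.L} :=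
        hF (hD.inter measurableSet_active)
      rw [← measureReal_union _ hm]
      · congr 1
        ext p
        simp only [mem_ofPred_eq, mem_union, Set.mem_sdiff, mem_inter_iff]
        have := @hsub (F p)
        tauto
      · rw [disjoint_left]
        exact fun p hp hp' => hp'.1.2 hp.1
    have e3 : ∫ x in B' ∩ active X.L, (u x + 1) = (∫ x in B ∩ active X.L, (u x + 1)) +
        ∫ x in (B' \ B) ∩ active X.L, (u x + 1) := by
      rw [← setIntegral_union (hdj.mono inter_subset_left inter_subset_left)
        (hD.inter measurableSet_active) (integrableOn_active hu hb _ _)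
        (integrableOn_active hu hb _ _), ← union_inter_distrib_right, ← hun]
    rw [h.excess_eq hγ, h.excess_eq hγ, h.excess_eq hγ, e1, e2 measurable_start,
      e2 measurable_finish, e3]
    ring
  linarith [hadm.2 _ hD]

/-- The pathwise balance integrated against `κ ℚ`. -/
theorem excess_Iic (h : X.IsCappedEquilibrium γ T) (hγ : 0 < γ) {c : ℝ}
    (hc : costLeft X.L c = costRight X.L c) (hc1 : c ≤ 1) {x : ℝ} (hx : x ∈ Ico 0 c) :
    X.excess u (Iic x) = X.exitMass 0 - X.flux x - ∫ z in Iic x ∩ active X.L, (u z + 1) := by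
  classical
  have := h.isProbability
  have hθ : MeasurableSet {p : StoppedPath solid × ℝ≥0 | p.1.θ = 0} :=
    (StoppedPath.measurable_θ.comp measurable_fst) (measurableSet_singleton 0)
  have key := measureReal_add_add_eq (Q := X.Q)
    (A := {p | start p ∈ Iic x ∧ p.1.θ = 0}) (B := {p | start p ∈ Iic x ∩ active X.L})
    (C := {p | x ∈ crossed p}) (D := {p | finish p = 0}) (E := {p | finish p ∈ Iic x ∩ active X.L})
    ((measurable_start measurableSet_Iic).inter hθ)
    (measurable_start (measurableSet_Iic.inter measurableSet_active)) (measurableSet_mem_crossed x)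
    (measurable_finish (measurableSet_singleton 0))
    (measurable_finish (measurableSet_Iic.inter measurableSet_active)) (by
      filter_upwards [h.ae_isTight] with p hp
      have := hp.balance_left h.measurable h.locallyIntegrable hc hc1 hx
      simpa only [indicator_apply, mem_ofPred_eq, Pi.one_apply] using this)
  rw [h.excess_eq hγ, h.exitMass_eq (Or.inl rfl), flux]
  linear_combination X.κ * key

theorem excess_Ici (h : X.IsCappedEquilibrium γ T) (hγ : 0 < γ) {c : ℝ}
    (hc : costLeft X.L c = costRight X.L c) (hc0 : 0 ≤ c) {x : ℝ} (hx : x ∈ Ioc c 1) :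
    X.excess u (Ici x) = X.exitMass 1 - X.flux x - ∫ z in Ici x ∩ active X.L, (u z + 1) := by
  classical
  have := h.isProbability
  have hθ : MeasurableSet {p : StoppedPath solid × ℝ≥0 | p.1.θ = 0} :=
    (StoppedPath.measurable_θ.comp measurable_fst) (measurableSet_singleton 0)
  have key := measureReal_add_add_eq (Q := X.Q)
    (A := {p | start p ∈ Ici x ∧ p.1.θ = 0}) (B := {p | start p ∈ Ici x ∩ active X.L})
    (C := {p | x ∈ crossed p}) (D := {p | finish p = 1}) (E := {p | finish p ∈ Ici x ∩ active X.L})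
    ((measurable_start measurableSet_Ici).inter hθ)
    (measurable_start (measurableSet_Ici.inter measurableSet_active)) (measurableSet_mem_crossed x)
    (measurable_finish (measurableSet_singleton 1))
    (measurable_finish (measurableSet_Ici.inter measurableSet_active)) (by
      filter_upwards [h.ae_isTight] with p hp
      have := hp.balance_right h.measurable h.locallyIntegrable hc hc0 hx
      simpa only [indicator_apply, mem_ofPred_eq, Pi.one_apply] using this)
  rw [h.excess_eq hγ, h.exitMass_eq (Or.inr rfl), flux]
  linear_combination X.κ * key

/-- Once all of `(0, 1)` is swept, every path starts at rest or in the swept set and finishes in the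
swept set, at `0` or at `1`; the total excess thus depends on the exit masses only. -/
theorem excess_univ (h : X.IsCappedEquilibrium γ T) (hγ : 0 < γ) (ha : active X.L = Ioo 0 1) :
    X.excess u univ = X.exitMass 0 + X.exitMass 1 - ∫ z in Ioo 0 1, (u z + 1) := by
  classical
  have := h.isProbability
  have hθ : MeasurableSet {p : StoppedPath solid × ℝ≥0 | p.1.θ = 0} :=
    (StoppedPath.measurable_θ.comp measurable_fst) (measurableSet_singleton 0)
  have key := measureReal_add_add_eq (Q := X.Q)
    (A := {p | start p ∈ univ ∧ p.1.θ = 0}) (B := {p | start p ∈ univ ∩ active X.L})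
    (C := ∅) (D := {p | finish p = 0} ∪ {p | finish p = 1})
    (E := {p | finish p ∈ univ ∩ active X.L})
    ((measurable_start MeasurableSet.univ).inter hθ)
    (measurable_start (MeasurableSet.univ.inter measurableSet_active)) MeasurableSet.empty
    ((measurable_finish (measurableSet_singleton 0)).union
      (measurable_finish (measurableSet_singleton 1)))
    (measurable_finish (MeasurableSet.univ.inter measurableSet_active)) (by
      filter_upwards [h.ae_isTight] with p hp
      simp only [indicator_apply, mem_ofPred_eq, Pi.one_apply, mem_union, ha, mem_univ, true_and,
        univ_inter, mem_empty_iff_false, if_false, add_zero]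
      by_cases h0 : p.1.θ = 0
      · obtain ⟨h1, h2⟩ := hp.start_of_θ_eq_zero h0
        rcases h2 with h2 | h2 <;> simp [h0, h1, h2]
      · have h0' := pos_iff_ne_zero.2 h0
        have h1 : start p ∈ Ioo (0 : ℝ) 1 := p.1.pos_zero_mem_Ioo_iff.2 h0'
        have h2 := IsTight.finish_mem_Icc (p := p) h0'
        rcases h2.1.eq_or_lt with h3 | h3
        · simp [h0, h1, ← h3]
        · rcases h2.2.eq_or_lt with h4 | h4
          · simp [h0, h1, h4]
          · simp [h0, h1, h3, h4, h3.ne', h4.ne])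
  have h1 : MeasurableSet {p : StoppedPath solid × ℝ≥0 | finish p = 1} :=
    measurable_finish (measurableSet_singleton 1)
  rw [measureReal_union (by
    rw [disjoint_left]
    intro p hp hp'
    have h1 : finish p = 0 := hp
    have h2 : finish p = 1 := hp'
    exact zero_ne_one (h1.symm.trans h2)) h1, measureReal_empty] at key
  rw [h.excess_eq hγ, h.exitMass_eq (Or.inl rfl), h.exitMass_eq (Or.inr rfl), ← ha, univ_inter]
  rw [univ_inter] at key
  linear_combination X.κ * key

theorem leftFront (h : X.IsCappedEquilibrium γ T) (hγ : 0 < γ) (hu : AEMeasurable u volume)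
    (hb : ∀ x, |u x| ≤ C) (hadm : X.IsAdmissible u) {c : ℝ} (hc01 : c ∈ Icc (0 : ℝ) 1)
    (hc : costLeft X.L c = costRight X.L c) (hP : γ < X.exitMass 0) :
    Front γ (X.exitMass 0) C c u X.L X.flux fun x => X.excess u (Iic x) where
  γ_pos := hγ
  γ_lt := hP
  c_mem := hc01
  u_meas := hu
  u_bdd := hb
  usc := h.usc
  ne_zero := h.ne_zero
  locInt := h.locallyIntegrable
  flux_pos := by
    filter_upwards [h.ae_posPart_mul_flux] with x hx _ hL
    rwa [max_eq_left hL.le] at hx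
  flux_zero x hx hxa := h.flux_eq_zero ⟨hx.1, hx.2.trans_le hc01.2⟩ hxa
  balance x hx := by
    have : Ioc 0 x ∩ active X.L = Iic x ∩ active X.L := by
      ext z
      exact ⟨fun hz => ⟨hz.1.2, hz.2⟩, fun hz => ⟨⟨hz.2.1.1, hz.1⟩, hz.2⟩⟩
    rw [this, h.excess_Iic hγ hc hc01.2 hx]
    ring
  g_mono x _ y _ hxy := h.excess_mono hγ hu hb hadm measurableSet_Iic measurableSet_Iic
    (Iic_subset_Iic.2 hxy)
  g_nonneg x _ := hadm.2 _ measurableSet_Iic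

theorem rightFront (h : X.IsCappedEquilibrium γ T) (hγ : 0 < γ) (hu : AEMeasurable u volume)
    (hb : ∀ x, |u x| ≤ C) (hadm : X.IsAdmissible u) {c : ℝ} (hc01 : c ∈ Icc (0 : ℝ) 1)
    (hc : costLeft X.L c = costRight X.L c) (hP : γ < X.exitMass 1) :
    Front γ (X.exitMass 1) C (1 - c) (reflect u) (reflect X.L) (reflect X.flux)
      fun x => X.excess u (Ici (1 - x)) where
  γ_pos := hγ
  γ_lt := hP
  c_mem := ⟨by linarith [hc01.2], by linarith [hc01.1]⟩
  u_meas := aemeasurable_reflect hu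
  u_bdd x := hb _
  usc := upperSemicontinuous_reflect h.usc
  ne_zero x := h.ne_zero _
  locInt := locallyIntegrable_reflect h.locallyIntegrable
  flux_pos := by
    filter_upwards [measurePreserving_reflection.quasiMeasurePreserving.ae
      h.ae_posPart_mul_flux] with x hx _ hL
    rwa [max_eq_left (by exact hL.le)] at hx
  flux_zero x hx hxa := by
    refine h.flux_eq_zero ⟨by linarith [hx.2, hc01.1], by linarith [hx.1]⟩ fun h => ?_
    exact hxa (mem_active_reflect.2 h)
  balance x hx := by
    have h1 : (fun z : ℝ => 1 - z) ⁻¹' (Ici (1 - x) ∩ active X.L) =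
        Ioc 0 x ∩ active (reflect X.L) := by
      ext z
      constructor
      · rintro ⟨h1, h2⟩
        have h1' : 1 - x ≤ 1 - z := h1
        have h3 := mem_active_reflect.2 h2
        exact ⟨⟨h3.1.1, by linarith⟩, h3⟩
      · rintro ⟨h1, h2⟩
        refine ⟨?_, mem_active_reflect.1 h2⟩
        change 1 - x ≤ 1 - z
        linarith [h1.2]
    have h2 := measurePreserving_reflection.setIntegral_preimage_emb
      (MeasurableEquiv.subLeft 1).measurableEmbedding (fun z => u z + 1)
      (Ici (1 - x) ∩ active X.L)
    rw [h1] at h2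
    have h3 := h.excess_Ici (u := u) hγ hc hc01.1 (x := 1 - x)
      ⟨by linarith [hx.2], by linarith [hx.1]⟩
    rw [h3, ← h2]
    simp only [reflect]
    ring
  g_mono x _ y _ hxy := h.excess_mono hγ hu hb hadm measurableSet_Ici measurableSet_Ici
    (Ici_subset_Ici.2 (by linarith))
  g_nonneg x _ := hadm.2 _ measurableSet_Ici

theorem excess_le_cumulativeExcess (h : X.IsCappedEquilibrium γ T) (hγ : 0 < γ)
    (hu : AEMeasurable u volume) (hb : ∀ x, |u x| ≤ C) (hadm : X.IsAdmissible u) {B : Set ℝ}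
    (hB : MeasurableSet B) {t : ℝ≥0} (hBt : ∀ x ∈ B ∩ active X.L, minCost X.L x ≤ t) :
    X.excess u B ≤ X.cumulativeExcess u t := by
  rw [← h.excess_inter hγ]
  refine h.excess_mono hγ hu hb hadm (hB.inter (measurableSet_solid.union measurableSet_active))
    (h.measurableSet_arrival_le hγ t) ?_
  rw [h.setOf_arrival_le hγ]
  rintro x ⟨hx, hx' | hx'⟩
  · exact Or.inl hx'
  · exact Or.inr ⟨hx', hBt x ⟨hx, hx'⟩⟩

/-- The arrival time is at least that of fronts without excess loss of energy. -/
theorem twoFrontTime_le_arrival (h : X.IsCappedEquilibrium γ T) (hγ : 0 < γ)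
    (hu : AEMeasurable u volume) (hb : ∀ x, |u x| ≤ C) (hadm : X.IsAdmissible u)
    (h0 : γ < X.exitMass 0) (h1 : γ < X.exitMass 1) :
    ∀ᵐ x : ℝ, x ∈ Ioo (0 : ℝ) 1 →
      twoFrontTime u (X.exitMass 0 - γ) (X.exitMass 1 - γ) x ≤ X.arrival x := by
  have hi := h.locallyIntegrable
  obtain ⟨c, hc01, hc⟩ := exists_costLeft_eq_costRight hi
  -- The one-front estimates hold strictly on either side of `c`.
  have hxc : ∀ᵐ x : ℝ, x ≠ c := by
    rw [ae_iff]; simp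
  filter_upwards [hxc] with x hx hx01
  by_cases hxa : x ∈ active X.L
  · rw [h.arrival_of_mem_active hγ hxa, minCost]
    rcases lt_or_gt_of_ne hx with hlt | hlt
    · have h2 := (h.leftFront hγ hu hb hadm hc01 hc h0).frontTime_le hxa hlt
      have h3 := costLeft_mono hi hlt.le
      have h4 := costRight_anti hi hlt.le
      rw [min_eq_left (by linarith)]
      exact (min_le_left _ _).trans h2
    · have h2 := (h.rightFront hγ hu hb hadm hc01 hc h1).frontTime_le (x := 1 - x)
        (mem_active_reflect.2 (by rwa [sub_sub_cancel])) (by linarith)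
      rw [costLeft_reflect, sub_sub_cancel] at h2
      have h3 := costLeft_mono hi hlt.le
      have h4 := costRight_anti hi hlt.le
      rw [min_eq_right (by linarith)]
      exact (min_le_right _ _).trans h2
  · rw [h.arrival_of_notMem hγ hx01 hxa]
    exact le_top

/-- If the excess loss of energy is small, then the arrival time is almost optimal. -/
theorem arrival_le_twoFrontTime (h : X.IsCappedEquilibrium γ T) (hγ : 0 < γ)
    (hu : AEMeasurable u volume) (hb : ∀ x, |u x| ≤ C) (hadm : X.IsAdmissible u)
    (h0 : γ < X.exitMass 0) (h1 : γ < X.exitMass 1) {δ : ℝ} (hδ : δ < γ) {t : ℝ≥0}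
    (ht : X.cumulativeExcess u t ≤ δ) {x : ℝ} (hx : x ∈ Ioo (0 : ℝ) 1)
    (hlt : twoFrontTime u (X.exitMass 0 - γ - δ) (X.exitMass 1 - γ - δ) x < t) :
    X.arrival x ≤ twoFrontTime u (X.exitMass 0 - γ - δ) (X.exitMass 1 - γ - δ) x := by
  have hi := h.locallyIntegrable
  obtain ⟨c, hc01, hc⟩ := exists_costLeft_eq_costRight hi
  have F := h.leftFront hγ hu hb hadm hc01 hc h0
  have F' := h.rightFront hγ hu hb hadm hc01 hc h1
  rw [← ENNReal.ofReal_coe_nnreal] at hlt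
  -- Swept points to the left of `z` arrive no later than `costLeft z ≤ t`, so their excess is part
  -- of `𝐄_t ≤ δ`.
  have hg : ∀ z ∈ Ico 0 c, costLeft X.L z ≤ t → X.excess u (Iic z) ≤ δ := fun z _ hz' =>
    (h.excess_le_cumulativeExcess hγ hu hb hadm measurableSet_Iic fun w hw =>
      (min_le_left _ _).trans ((costLeft_mono hi hw.1).trans hz')).trans ht
  have hg' : ∀ z ∈ Ico 0 (1 - c), costLeft (reflect X.L) z ≤ t →
      X.excess u (Ici (1 - z)) ≤ δ := fun z _ hz' =>
    (h.excess_le_cumulativeExcess hγ hu hb hadm measurableSet_Ici fun w hw =>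
      (min_le_right _ _).trans ((costRight_anti hi hw.1).trans
        (by rwa [costLeft_reflect] at hz'))).trans ht
  rcases le_total x c with hxc | hxc
  · obtain ⟨h2, h3⟩ := F.minCost_le_twoFrontTime F' hc hδ hg hg' hx hxc hlt
    rwa [h.arrival_of_mem_active hγ h2]
  -- For `x ≥ c` the two fronts change roles under reflection.
  · have hsw : twoFrontTime (reflect u) (X.exitMass 1 - γ - δ) (X.exitMass 0 - γ - δ) (1 - x) =
        twoFrontTime u (X.exitMass 0 - γ - δ) (X.exitMass 1 - γ - δ) x := by
      rw [twoFrontTime, twoFrontTime, reflect_reflect, sub_sub_cancel, min_comm]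
    obtain ⟨h2, h3⟩ := F'.minCost_le_twoFrontTime (P' := X.exitMass 0) (f' := X.flux)
      (g' := fun x => X.excess u (Iic x))
      (by rw [reflect_reflect, reflect_reflect, sub_sub_cancel]; exact F)
      (by rw [costLeft_reflect, costRight_reflect, sub_sub_cancel, hc]) hδ hg'
      (by rw [reflect_reflect, sub_sub_cancel]; exact hg) (x := 1 - x)
      ⟨by linarith [hx.2], by linarith [hx.1]⟩ (by linarith) (by rwa [hsw])
    rw [hsw, minCost_reflect] at h3
    rw [mem_active_reflect, sub_sub_cancel] at h2
    rwa [h.arrival_of_mem_active hγ h2]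

/-- The total excess loss of energy once everything has been swept at optimal speed. -/
theorem cumulativeExcess_eq (h : X.IsCappedEquilibrium γ T) (hγ : 0 < γ)
    (hu : AEMeasurable u volume) (hb : ∀ x, |u x| ≤ C) (hadm : X.IsAdmissible u)
    (h0 : γ < X.exitMass 0) (h1 : γ < X.exitMass 1) {τ : ℝ≥0}
    (hτ : ∀ s < τ, X.cumulativeExcess u s ≤ 0) {c : ℝ}
    (hW : ∀ x ∈ Ioo (0 : ℝ) 1, x ≠ c →
      twoFrontTime u (X.exitMass 0 - γ) (X.exitMass 1 - γ) x < τ) {t : ℝ≥0} (ht : τ ≤ t) :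
    X.cumulativeExcess u t = X.exitMass 0 + X.exitMass 1 - ∫ z in Ioo 0 1, (u z + 1) := by
  have hi := h.locallyIntegrable
  -- The excess is at most `0` before `τ`, so the sandwich applies with `δ = 0`: every point but `c`
  -- is reached before `τ`.
  have key : ∀ x ∈ Ioo (0 : ℝ) 1, x ≠ c → x ∈ active X.L ∧ minCost X.L x ≤ τ := by
    intro x hx hxc
    obtain ⟨s, hs1, hs2⟩ := ENNReal.lt_iff_exists_nnreal_btwn.1 (hW x hx hxc)
    have h2 := h.arrival_le_twoFrontTime hγ hu hb hadm h0 h1 (δ := 0) hγ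
      (hτ s (ENNReal.coe_lt_coe.1 hs2)) hx (by simpa only [sub_zero] using hs1)
    simp only [sub_zero] at h2
    have h3 : X.arrival x < τ := h2.trans_lt (hs1.trans hs2)
    have h4 := h.mem_active_of_arrival_lt hγ hx (h3.trans ENNReal.coe_lt_top)
    rw [h.arrival_of_mem_active hγ h4] at h3
    refine ⟨h4, ?_⟩
    rw [ENNReal.ofReal, ENNReal.coe_lt_coe] at h3
    exact Real.toNNReal_le_iff_le_coe.1 h3.le
  have hae : ∀ᵐ x : ℝ, x ≠ c := by
    rw [ae_iff]; simp
  have ha : active X.L = Ioo 0 1 := by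
    refine Subset.antisymm active_subset fun x hx => ?_
    refine mem_active_of_ae_pos (zero_lt_one (α := ℝ)) (Ioo_subset_Icc_self hx) hx ?_
    filter_upwards [hae] with z hz hz'
    exact pos_of_mem_active h.usc h.ne_zero (key z hz' hz).1
  -- The exceptional point `c` is handled by density and continuity of `minCost`.
  have hle : ∀ x ∈ Ioo (0 : ℝ) 1, minCost X.L x ≤ τ := by
    intro x hx
    by_contra! hlt
    have hd := Measure.dense_of_ae hae
    have hop : IsOpen ({z | (τ : ℝ) < minCost X.L z} ∩ Ioo 0 1) :=
      (isOpen_lt continuous_const (continuous_minCost hi)).inter isOpen_Ioo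
    obtain ⟨z, ⟨hz1, hz2⟩, hz3⟩ := hd.inter_open_nonempty _ hop ⟨x, hlt, hx⟩
    exact not_lt.2 (key z hz2 hz3).2 hz1
  rw [← h.excess_univ hγ ha, cumulativeExcess]
  congr 1
  rw [h.setOf_arrival_le hγ, ha]
  refine eq_univ_of_forall fun x => ?_
  by_cases hx : x ∈ solid
  · exact Or.inl hx
  · have hx' := notMem_solid.1 hx
    exact Or.inr ⟨hx', (hle x hx').trans (NNReal.coe_le_coe.2 ht)⟩

end IsCappedEquilibrium

end Triple

end

section

/-! ### Regularity of front times and the collision of two fronts. -/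

section FrontTime

variable {u : ℝ → ℝ} {C v : ℝ}

theorem abs_speed_sub_le (hb : ∀ x, |u x| ≤ C) (hu : AEMeasurable u volume) (z z₀ : ℝ) :
    |(v - ∫ r in (0 : ℝ)..z, (u r + 1)) - (v - ∫ r in (0 : ℝ)..z₀, (u r + 1))| ≤
      (C + 1) * |z - z₀| := by
  have h1 := intervalIntegral.integral_interval_sub_left (intervalIntegrable_add_one hu hb 0 z₀)
    (intervalIntegrable_add_one hu hb 0 z)
  have h2 : ‖∫ r in z..z₀, (u r + 1)‖ ≤ (C + 1) * |z₀ - z| :=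
    intervalIntegral.norm_integral_le_of_norm_le_const fun r _ =>
      (norm_add_le _ _).trans (by rw [norm_one]; exact add_le_add_left (hb r) 1)
  rw [← h1, Real.norm_eq_abs, abs_sub_comm z₀ z] at h2
  convert h2 using 2
  ring

/-- A front reaching `x` in finite time has positive velocity up to `x`. -/
theorem speed_pos_of_frontTime_lt_top (hu : AEMeasurable u volume) (hb : ∀ x, |u x| ≤ C) {x : ℝ}
    (hx : 0 < x) (h : frontTime u v x < ⊤) {z : ℝ} (hz : z ∈ Icc 0 x) :
    0 < v - ∫ r in (0 : ℝ)..z, (u r + 1) := by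
  have hC : 0 ≤ C := (abs_nonneg _).trans (hb 0)
  by_contra! hle
  -- A Lipschitz velocity which is not positive at `z` grows at most linearly away from `z`, and the
  -- inverse of a linear function is not integrable.
  have h1 : ∀ w, v - ∫ r in (0 : ℝ)..w, (u r + 1) ≤ (C + 1) * |w - z| := fun w => by
    have := (abs_le.1 (abs_speed_sub_le (v := v) hb hu w z)).2
    linarith
  have h2 : ∫⁻ w in Ioc 0 x, ‖((C + 1) * (w - z))⁻¹‖ₑ ≤ frontTime u v x := by
    refine lintegral_mono fun w => ?_
    rw [← ofReal_norm, norm_inv]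
    refine (le_trans ?_ (ENNReal.inv_le_inv.2 (ENNReal.ofReal_le_ofReal (h1 w))))
    rw [norm_mul, Real.norm_of_nonneg (by linarith : 0 ≤ C + 1), Real.norm_eq_abs]
    rcases eq_or_lt_of_le (abs_nonneg (w - z)) with h0 | h0
    · rw [← h0]; simp
    · rw [ENNReal.ofReal_inv_of_pos (by positivity)]
  have h3 : IntegrableOn (fun w => ((C + 1) * (w - z))⁻¹) (Ioc 0 x) volume :=
    ⟨(measurable_const.mul (measurable_id.sub_const z)).inv.aestronglyMeasurable, h2.trans_lt h⟩
  have h4 : IntervalIntegrable (fun w => (w - z)⁻¹) volume 0 x := by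
    rw [intervalIntegrable_iff_integrableOn_Ioc_of_le hx.le]
    refine (h3.const_mul (C + 1)).congr (ae_of_all _ fun w => ?_)
    change (C + 1) * ((C + 1) * (w - z))⁻¹ = (w - z)⁻¹
    rw [mul_inv, ← mul_assoc, mul_inv_cancel₀ (by linarith), one_mul]
  rcases intervalIntegrable_sub_inv_iff.1 h4 with h5 | h5
  · exact hx.ne h5
  · exact h5 (by rwa [uIcc_of_le hx.le])

theorem continuous_speed (hu : AEMeasurable u volume) (hb : ∀ x, |u x| ≤ C) (v : ℝ) :
    Continuous fun z => v - ∫ r in (0 : ℝ)..z, (u r + 1) :=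
  continuous_const.sub (continuous_integral_add_one hu hb)

theorem exists_le_speed (hu : AEMeasurable u volume) (hb : ∀ x, |u x| ≤ C) {x : ℝ}
    (h : ∀ z ∈ Icc 0 x, 0 < v - ∫ r in (0 : ℝ)..z, (u r + 1)) :
    ∃ m > 0, ∀ z ∈ Icc 0 x, m ≤ v - ∫ r in (0 : ℝ)..z, (u r + 1) := by
  rcases lt_or_ge x 0 with hx | hx
  · exact ⟨1, one_pos, fun z hz => absurd (hz.1.trans hz.2) (not_le.2 hx)⟩
  · obtain ⟨z, hz, hmin⟩ := isCompact_Icc.exists_isMinOn ⟨0, le_rfl, hx⟩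
      (continuous_speed hu hb v).continuousOn
    exact ⟨_, h z hz, fun w hw => hmin hw⟩

/-- Truncating the velocity below at `m` makes the slowness continuous on the whole line without
changing it where the velocity is at least `m`. -/
theorem continuous_inv_max_speed (hu : AEMeasurable u volume) (hb : ∀ x, |u x| ≤ C) (v : ℝ) {m : ℝ}
    (hm : 0 < m) : Continuous fun z => (max (v - ∫ r in (0 : ℝ)..z, (u r + 1)) m)⁻¹ :=
  ((continuous_speed hu hb v).max continuous_const).inv₀ fun _ => (lt_max_of_lt_right hm).ne'

theorem frontTime_eq_ofReal (hu : AEMeasurable u volume) (hb : ∀ x, |u x| ≤ C) {x m : ℝ}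
    (hm : 0 < m) (h : ∀ z ∈ Icc 0 x, m ≤ v - ∫ r in (0 : ℝ)..z, (u r + 1)) {y : ℝ} (hy : y ≤ x) :
    frontTime u v y =
      ENNReal.ofReal (∫ z in (0 : ℝ)..y, (max (v - ∫ r in (0 : ℝ)..z, (u r + 1)) m)⁻¹) := by
  have hnn : ∀ z, 0 ≤ (max (v - ∫ r in (0 : ℝ)..z, (u r + 1)) m)⁻¹ := fun z =>
    inv_nonneg.2 (hm.le.trans (le_max_right _ _))
  rcases le_or_gt y 0 with h0 | h0
  · rw [frontTime, Ioc_eq_empty_of_le h0, Measure.restrict_empty, lintegral_zero_measure,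
      intervalIntegral.integral_symm, ENNReal.ofReal_of_nonpos]
    rw [neg_nonpos]
    exact intervalIntegral.integral_nonneg h0 fun z _ => hnn z
  · rw [intervalIntegral.integral_of_le h0.le, ofReal_integral_eq_lintegral_ofReal
      ((continuous_inv_max_speed hu hb v hm).integrableOn_Icc.mono_set Ioc_subset_Icc_self)
      (ae_of_all _ hnn)]
    refine setLIntegral_congr_fun measurableSet_Ioc fun z hz => ?_
    have h1 := h z ⟨hz.1.le, hz.2.trans hy⟩
    change _ = ENNReal.ofReal ((max (v - ∫ r in (0 : ℝ)..z, (u r + 1)) m)⁻¹)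
    rw [max_eq_left h1, ENNReal.ofReal_inv_of_pos (hm.trans_le h1)]

theorem frontTime_pos (u : ℝ → ℝ) (v : ℝ) (hu : AEMeasurable u volume) (hb : ∀ x, |u x| ≤ C)
    {x y : ℝ} (hxy : x < y) :
    0 < ∫⁻ z in Ioc x y, (ENNReal.ofReal (v - ∫ r in (0 : ℝ)..z, (u r + 1)))⁻¹ := by
  have hm : Measurable fun z => (ENNReal.ofReal (v - ∫ r in (0 : ℝ)..z, (u r + 1)))⁻¹ :=
    (continuous_speed hu hb v).measurable.ennreal_ofReal.inv
  rw [setLIntegral_pos_iff hm]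
  have : Function.support (fun z => (ENNReal.ofReal (v - ∫ r in (0 : ℝ)..z, (u r + 1)))⁻¹) =
      univ := by
    ext z; simp
  rw [this, univ_inter, Real.volume_Ioc]
  simpa using hxy

theorem frontTime_lt_frontTime (hu : AEMeasurable u volume) (hb : ∀ x, |u x| ≤ C) {x y : ℝ}
    (hx : 0 ≤ x) (hxy : x < y) (h : frontTime u v x ≠ ⊤) : frontTime u v x < frontTime u v y := by
  have h1 : frontTime u v y = frontTime u v x +
      ∫⁻ z in Ioc x y, (ENNReal.ofReal (v - ∫ r in (0 : ℝ)..z, (u r + 1)))⁻¹ := by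
    rw [frontTime, frontTime, ← lintegral_union measurableSet_Ioc
      (Ioc_disjoint_Ioc_of_le le_rfl), Ioc_union_Ioc_eq_Ioc hx hxy.le]
  rw [h1]
  exact ENNReal.lt_add_right h (frontTime_pos u v hu hb hxy).ne'

theorem frontTime_zero : frontTime u v 0 = 0 := by simp [frontTime]

/-- Where the time is finite, the velocity is positive slightly beyond `x`, and the front time is
locally the primitive of a continuous function. In the case `x ≤ 0` this uses `v > 0`. -/
theorem continuous_frontTime (hu : AEMeasurable u volume) (hb : ∀ x, |u x| ≤ C) (hv : 0 < v) :
    Continuous (frontTime u v) := by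
  refine continuous_iff_continuousAt.2 fun x => ?_
  by_cases hfin : frontTime u v x < ⊤
  · have hpos : ∀ z ∈ Icc 0 (max x 0), 0 < v - ∫ r in (0 : ℝ)..z, (u r + 1) := by
      rcases le_or_gt x 0 with h0 | h0
      · rw [max_eq_right h0]
        intro z hz
        have : z = 0 := le_antisymm hz.2 hz.1
        simpa [this] using hv
      · rw [max_eq_left h0.le]
        exact fun z hz => speed_pos_of_frontTime_lt_top hu hb h0 hfin hz
    have hy : ∃ y > max x 0, ∀ z ∈ Icc 0 y, 0 < v - ∫ r in (0 : ℝ)..z, (u r + 1) := by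
      have hop : IsOpen {z | 0 < v - ∫ r in (0 : ℝ)..z, (u r + 1)} :=
        isOpen_lt continuous_const (continuous_speed hu hb v)
      obtain ⟨ε, hε, hsub⟩ := Metric.isOpen_iff.1 hop _
        (hpos _ ⟨le_max_right _ _, le_rfl⟩)
      refine ⟨max x 0 + ε / 2, by linarith, fun z hz => ?_⟩
      rcases le_or_gt z (max x 0) with h1 | h1
      · exact hpos z ⟨hz.1, h1⟩
      · refine hsub ?_
        rw [Metric.mem_ball, Real.dist_eq, abs_of_pos (by linarith)]
        linarith [hz.2]
    obtain ⟨y, hxy, hy⟩ := hy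
    obtain ⟨m, hm, hmy⟩ := exists_le_speed hu hb hy
    have hc : Continuous fun y => ENNReal.ofReal
        (∫ z in (0 : ℝ)..y, (max (v - ∫ r in (0 : ℝ)..z, (u r + 1)) m)⁻¹) :=
      ENNReal.continuous_ofReal.comp (intervalIntegral.continuous_primitive
        (fun a b => (continuous_inv_max_speed hu hb v hm).intervalIntegrable a b) 0)
    refine hc.continuousAt.congr ?_
    filter_upwards [Iio_mem_nhds ((le_max_left x 0).trans_lt hxy)] with w hw
    exact (frontTime_eq_ofReal hu hb hm hmy (le_of_lt hw)).symm
  -- Where the time is infinite, continuity from below of the measure with density the slowness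
  -- shows that the times at `x - 1/(n+1)` tend to `∞`; monotonicity does the rest.
  · have htop : frontTime u v x = ⊤ := not_lt_top_iff.1 hfin
    rw [ContinuousAt, htop, ENNReal.tendsto_nhds_top_iff_nnreal]
    intro M
    set μ := (volume : Measure ℝ).withDensity
      fun z => (ENNReal.ofReal (v - ∫ r in (0 : ℝ)..z, (u r + 1)))⁻¹
    have hμ : ∀ y, frontTime u v y = μ (Ioc 0 y) := fun y =>
      (withDensity_apply _ measurableSet_Ioc).symm
    have hun : μ (⋃ n : ℕ, Ioc 0 (x - 1 / (n + 1))) = ⊤ := by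
      rw [← htop, hμ, ← measure_congr ((withDensity_absolutelyContinuous volume _).ae_eq
        (Ioo_ae_eq_Ioc (μ := volume) (a := (0 : ℝ)) (b := x)))]
      congr 1
      ext w
      simp only [mem_iUnion, mem_Ioc, mem_Ioo]
      constructor
      · rintro ⟨n, h1, h2⟩
        have : (0 : ℝ) < 1 / (n + 1) := Nat.one_div_pos_of_nat
        exact ⟨h1, by linarith⟩
      · rintro ⟨h1, h2⟩
        obtain ⟨n, hn⟩ := exists_nat_one_div_lt (sub_pos.2 h2)
        exact ⟨n, h1, by linarith⟩
    have hmono : Monotone fun n : ℕ => Ioc (0 : ℝ) (x - 1 / (n + 1)) := fun n k hnk =>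
      Ioc_subset_Ioc_right (sub_le_sub_left (Nat.one_div_le_one_div hnk) _)
    have hlim := tendsto_measure_iUnion_atTop (μ := μ) hmono
    rw [hun, ENNReal.tendsto_nhds_top_iff_nnreal] at hlim
    obtain ⟨n, hn⟩ := (hlim M).exists
    have hn0 : (0 : ℝ) < 1 / (n + 1) := Nat.one_div_pos_of_nat
    filter_upwards [Ioi_mem_nhds (show x - 1 / (n + 1 : ℝ) < x by linarith)] with w hw
    rw [hμ]
    exact hn.trans_le (measure_mono (Ioc_subset_Ioc_right (le_of_lt hw)))

/-- The points which the fronts reach at the time of their collision, or at time `τ` if they do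
not collide before. -/
theorem exists_front_positions (hu : AEMeasurable u volume) (hb : ∀ x, |u x| ≤ C) {v₀ v₁ : ℝ}
    (h0 : 0 < v₀) (h1 : 0 < v₁) {τ : ℝ≥0} (hτ : 0 < τ) :
    ∃ a b : ℝ, ∃ t : ℝ≥0, 0 < a ∧ 0 < b ∧ a + b ≤ 1 ∧ 0 < t ∧ t ≤ τ ∧ frontTime u v₀ a = t ∧
      frontTime (reflect u) v₁ b = t ∧ (t = τ ∨ a + b = 1) := by
  have hb' : ∀ x, |reflect u x| ≤ C := fun x => hb _
  have hc0 := continuous_frontTime hu hb h0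
  have hc1 := continuous_frontTime (aemeasurable_reflect hu) hb' h1
  have hpos0 : ∀ x, 0 < x → 0 < frontTime u v₀ x := fun x hx => frontTime_pos u v₀ hu hb hx
  have hpos1 : ∀ x, 0 < x → 0 < frontTime (reflect u) v₁ x := fun x hx =>
    frontTime_pos _ v₁ (aemeasurable_reflect hu) hb' hx
  -- Truncation at `τ` makes both times real-valued, so that the intermediate value theorem applies
  -- to their difference.
  have hmin : ∀ {f : ℝ → ℝ≥0∞}, Continuous f →
      Continuous fun x => (min (f x) (τ : ℝ≥0∞)).toReal := fun hf => by
    refine ENNReal.continuousOn_toReal.comp_continuous (hf.min continuous_const) fun x => ?_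
    exact (min_le_right _ _).trans_lt ENNReal.coe_lt_top |>.ne
  have hτ' : (0 : ℝ≥0∞) < τ := ENNReal.coe_pos.2 hτ
  have hF0 := hmin hc0
  have hF1 := hmin (f := fun x => frontTime (reflect u) v₁ (1 - x))
    (hc1.comp (continuous_const.sub continuous_id))
  obtain ⟨x, hx, hxe⟩ := intermediate_value_Icc (zero_le_one (α := ℝ))
    (hF0.sub hF1).continuousOn (show (0 : ℝ) ∈ Icc _ _ by
      constructor
      · simp only [Pi.sub_apply, frontTime_zero, zero_min, ENNReal.toReal_zero, zero_sub,
          neg_nonpos]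
        exact ENNReal.toReal_nonneg
      · simp only [Pi.sub_apply, sub_self, frontTime_zero, zero_min, ENNReal.toReal_zero,
          sub_zero]
        exact ENNReal.toReal_nonneg)
  have hne : ∀ y : ℝ≥0∞, min y (τ : ℝ≥0∞) ≠ ⊤ := fun y =>
    ((min_le_right _ _).trans_lt ENNReal.coe_lt_top).ne
  have heq : min (frontTime u v₀ x) τ = min (frontTime (reflect u) v₁ (1 - x)) τ := by
    rw [← ENNReal.toReal_eq_toReal_iff' (hne _) (hne _)]
    exact sub_eq_zero.1 hxe
  have hx0 : 0 < x := by
    refine lt_of_le_of_ne hx.1 ?_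
    rintro rfl
    rw [frontTime_zero, zero_min, sub_zero] at heq
    exact (lt_min (hpos1 1 one_pos) hτ').ne heq
  have hx1 : x < 1 := by
    refine lt_of_le_of_ne hx.2 ?_
    rintro rfl
    rw [sub_self, frontTime_zero, zero_min] at heq
    exact (lt_min (hpos0 1 one_pos) hτ').ne' heq
  -- Either the fronts meet at `x` before `τ`, or neither has passed `x` at time `τ`; in the latter
  -- case their positions at time `τ` lie on the two sides of `x`.
  rcases lt_or_ge (frontTime u v₀ x) τ with hlt | hge
  · rw [min_eq_left hlt.le] at heq
    have heq' : frontTime (reflect u) v₁ (1 - x) = frontTime u v₀ x := by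
      rcases min_choice (frontTime (reflect u) v₁ (1 - x)) (τ : ℝ≥0∞) with h | h
      · rw [heq, h]
      · rw [h] at heq
        exact absurd heq hlt.ne
    obtain ⟨t, ht⟩ := ENNReal.lt_iff_exists_coe.1 hlt
    replace ht := ht.1.symm
    refine ⟨x, 1 - x, t, hx0, by linarith, by linarith, ?_, ?_, ht.symm, heq'.trans ht.symm,
      Or.inr (by ring)⟩
    · rw [← ENNReal.coe_pos, ht]; exact hpos0 x hx0
    · rw [← ENNReal.coe_le_coe, ht]; exact hlt.le
  · rw [min_eq_right hge] at heq
    have hge' : τ ≤ frontTime (reflect u) v₁ (1 - x) := heq ▸ min_le_left _ _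
    obtain ⟨a, ha, hae⟩ := intermediate_value_Icc hx0.le hc0.continuousOn
      (show (τ : ℝ≥0∞) ∈ Icc (frontTime u v₀ 0) (frontTime u v₀ x) by
        rw [frontTime_zero]; exact ⟨zero_le, hge⟩)
    obtain ⟨b, hb, hbe⟩ := intermediate_value_Icc (sub_pos.2 hx1).le hc1.continuousOn
      (show (τ : ℝ≥0∞) ∈ Icc (frontTime (reflect u) v₁ 0) (frontTime (reflect u) v₁ (1 - x)) by
        rw [frontTime_zero]; exact ⟨zero_le, hge'⟩)
    refine ⟨a, b, τ, lt_of_le_of_ne ha.1 ?_, lt_of_le_of_ne hb.1 ?_, by linarith [ha.2, hb.2],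
      hτ, le_rfl, hae, hbe, Or.inl rfl⟩
    · rintro rfl
      rw [frontTime_zero] at hae
      exact hτ'.ne hae
    · rintro rfl
      rw [frontTime_zero] at hbe
      exact hτ'.ne hbe

end FrontTime

end

section

/-! ### Quantile functions of primitives. -/

section Quantile

/-- The quantile function of `G` on `[0, a]`. -/
def quantile (G : ℝ → ℝ) (a h : ℝ) : ℝ := sInf ({x | x ∈ Icc 0 a ∧ h ≤ G x} ∪ {a})

variable {G : ℝ → ℝ} {a : ℝ}

theorem quantile_bddBelow (ha : 0 ≤ a) (h : ℝ) :
    BddBelow ({x | x ∈ Icc 0 a ∧ h ≤ G x} ∪ {a}) := by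
  refine ⟨0, ?_⟩
  rintro x (hx | rfl)
  · exact hx.1.1
  · exact ha

theorem quantile_mem (ha : 0 ≤ a) (h : ℝ) : quantile G a h ∈ Icc 0 a := by
  refine ⟨le_csInf ⟨a, Or.inr rfl⟩ ?_, csInf_le (quantile_bddBelow ha h) (Or.inr rfl)⟩
  rintro x (hx | rfl)
  · exact hx.1.1
  · exact ha

/-- Continuity of `G` makes the infimum attained. The point `x = a` is excluded because levels above
`G a` are also sent to `a`, where they form an atom. -/
theorem quantile_le_iff (hG : Continuous G) (hm : Monotone G) (ha : 0 ≤ a) {h x : ℝ}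
    (hx : x ∈ Ico 0 a) : quantile G a h ≤ x ↔ h ≤ G x := by
  constructor
  · intro hq
    have hcl : IsClosed ({x | x ∈ Icc 0 a ∧ h ≤ G x} ∪ {a}) :=
      (isClosed_Icc.inter (isClosed_le continuous_const hG)).union isClosed_singleton
    have hmem := hcl.csInf_mem ⟨a, Or.inr rfl⟩ (quantile_bddBelow ha h)
    rcases hmem with hmem | hmem
    · exact hmem.2.trans (hm hq)
    · exact absurd (le_of_eq_of_le (mem_singleton_iff.1 hmem).symm hq) (not_le.2 hx.2)
  · exact fun hq => csInf_le (quantile_bddBelow ha h) (Or.inl ⟨⟨hx.1, hx.2.le⟩, hq⟩)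

theorem monotone_quantile (ha : 0 ≤ a) : Monotone (quantile G a) := fun h h' hh => by
  refine csInf_le_csInf (quantile_bddBelow ha h) ⟨a, Or.inr rfl⟩ ?_
  rintro x (hx | hx)
  · exact Or.inl ⟨hx.1, hh.trans hx.2⟩
  · exact Or.inr hx

theorem measurable_quantile (ha : 0 ≤ a) : Measurable (quantile G a) :=
  (monotone_quantile ha).measurable

/-- The law of the quantile function of a primitive. -/
theorem map_quantile {ρ : ℝ → ℝ} (hρ : LocallyIntegrable ρ volume) (hnn : ∀ x, 0 ≤ ρ x)
    {G₀ N : ℝ} (hG₀ : 0 ≤ G₀) (ha : 0 < a) (hN : G₀ + ∫ r in (0 : ℝ)..a, ρ r ≤ N) :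
    (volume.restrict (Ioc 0 N)).map (quantile (fun x => G₀ + ∫ r in (0 : ℝ)..x, ρ r) a) =
      ENNReal.ofReal G₀ • Measure.dirac 0 +
        (volume.withDensity fun x => ENNReal.ofReal (ρ x)).restrict (Ioc 0 a) +
        ENNReal.ofReal (N - (G₀ + ∫ r in (0 : ℝ)..a, ρ r)) • Measure.dirac a := by
  have hii : ∀ x y, IntervalIntegrable ρ volume x y := fun x y =>
    (hρ.integrableOn_isCompact isCompact_uIcc).intervalIntegrable
  set G : ℝ → ℝ := fun x => G₀ + ∫ r in (0 : ℝ)..x, ρ r with hG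
  have hGc : Continuous G := continuous_const.add
    (intervalIntegral.continuous_primitive hii 0)
  have hGm : Monotone G := fun x y hxy => by
    have h1 := intervalIntegral.integral_interval_sub_left (hii 0 y) (hii 0 x)
    have h2 := intervalIntegral.integral_nonneg (μ := volume) hxy fun r _ => hnn r
    simp only [hG]
    linarith
  have hG0 : G 0 = G₀ := by simp [hG]
  have hqm : Measurable (quantile G a) := measurable_quantile ha.le
  have hdens : ∀ x, 0 ≤ x → (volume.withDensity fun x => ENNReal.ofReal (ρ x)) (Ioc 0 x) =
      ENNReal.ofReal (∫ r in (0 : ℝ)..x, ρ r) := fun x hx => by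
    rw [withDensity_apply _ measurableSet_Ioc, intervalIntegral.integral_of_le hx,
      ofReal_integral_eq_lintegral_ofReal
        ((intervalIntegrable_iff_integrableOn_Ioc_of_le hx).1 (hii 0 x)) (ae_of_all _ hnn)]
  have hint : ∀ x, 0 ≤ x → 0 ≤ ∫ r in (0 : ℝ)..x, ρ r := fun x hx =>
    intervalIntegral.integral_nonneg hx fun r _ => hnn r
  have hfin : IsFiniteMeasure ((volume.restrict (Ioc 0 N)).map (quantile G a)) :=
    Measure.isFiniteMeasure_map _ _
  -- Finite measures are compared on half-lines; the atoms at `0` and `a` account for the three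
  -- cases.
  refine Measure.ext_of_Iic _ _ fun x => ?_
  rw [Measure.map_apply hqm measurableSet_Iic, Measure.restrict_apply (hqm measurableSet_Iic)]
  simp only [Measure.coe_add, Measure.coe_smul, Pi.add_apply, Pi.smul_apply, smul_eq_mul,
    Measure.dirac_apply' _ (measurableSet_Iic (a := x)), Measure.restrict_apply
      (measurableSet_Iic (a := x))]
  rcases lt_or_ge x 0 with hx0 | hx0
  · have h1 : quantile G a ⁻¹' Iic x = ∅ := eq_empty_of_forall_notMem fun h hh =>
      absurd ((quantile_mem ha.le h).1.trans hh) (not_le.2 hx0)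
    have h2 : Iic x ∩ Ioc 0 a = ∅ := eq_empty_of_forall_notMem fun z hz =>
      absurd (hz.2.1.trans_le hz.1) (not_lt.2 hx0.le)
    have h3 : (0 : ℝ) ∉ Iic x := not_le.2 hx0
    have h4 : a ∉ Iic x := not_le.2 (hx0.trans ha)
    rw [h1, h2, indicator_of_notMem h3, indicator_of_notMem h4]
    simp
  · have h3 : (0 : ℝ) ∈ Iic x := hx0
    rcases lt_or_ge x a with hxa | hxa
    · have h1 : quantile G a ⁻¹' Iic x ∩ Ioc 0 N = Ioc 0 (G x) := by
        ext h
        simp only [mem_inter_iff, mem_preimage, mem_Iic, mem_Ioc,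
          quantile_le_iff hGc hGm ha.le ⟨hx0, hxa⟩]
        have : G x ≤ N := (hGm hxa.le).trans hN
        constructor
        · rintro ⟨h1, h2, h3⟩; exact ⟨h2, h1⟩
        · rintro ⟨h1, h2⟩; exact ⟨h2, h1, h2.trans this⟩
      have h2 : Iic x ∩ Ioc 0 a = Ioc 0 x := by
        ext z
        simp only [mem_inter_iff, mem_Iic, mem_Ioc]
        constructor
        · rintro ⟨h1, h2, h3⟩; exact ⟨h2, h1⟩
        · rintro ⟨h1, h2⟩; exact ⟨h2, h1, h2.trans hxa.le⟩
      have h4 : a ∉ Iic x := not_le.2 hxa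
      rw [h1, h2, indicator_of_mem h3, indicator_of_notMem h4, hdens x hx0, Real.volume_Ioc,
        sub_zero, Pi.one_apply, mul_one, mul_zero, add_zero, hG, ENNReal.ofReal_add hG₀ (hint x hx0)]
    · have h1 : quantile G a ⁻¹' Iic x ∩ Ioc 0 N = Ioc 0 N :=
        inter_eq_right.2 fun h _ => (quantile_mem ha.le h).2.trans hxa
      have h2 : Iic x ∩ Ioc 0 a = Ioc 0 a := inter_eq_right.2 fun z hz => hz.2.trans hxa
      have h4 : a ∈ Iic x := hxa
      rw [h1, h2, indicator_of_mem h3, indicator_of_mem h4, hdens a ha.le, Real.volume_Ioc,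
        sub_zero, Pi.one_apply, Pi.one_apply, mul_one, mul_one, ← ENNReal.ofReal_add hG₀ (hint a ha.le),
        ← ENNReal.ofReal_add (add_nonneg hG₀ (hint a ha.le)) (sub_nonneg.2 hN)]
      congr 1
      ring

end Quantile

/-! ### Coupling of sources and sinks with prescribed flux. -/

section Coupling

variable {u : ℝ → ℝ} {C : ℝ}

/-- Sources with density `(u + 1)⁺` and a point source at `a` can be coupled with sinks with
density `(u + 1)⁻` and a point sink of mass `P` at `0` to their left. -/
theorem exists_coupling (hu : AEMeasurable u volume) (hb : ∀ x, |u x| ≤ C) {a P : ℝ} (ha : 0 < a)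
    (hP : 0 < P) (hpos : ∀ x ∈ Icc 0 a, 0 ≤ P - ∫ r in (0 : ℝ)..x, (u r + 1)) :
    ∃ N > 0, ∃ s k : ℝ → ℝ, Measurable s ∧ Measurable k ∧
      (∀ h ∈ Ioc 0 N, 0 ≤ k h ∧ k h ≤ s h ∧ s h ≤ a ∧ 0 < s h) ∧
      (∀ x ∈ Ioo 0 a, (volume.restrict (Ioc 0 N)).real {h | k h ≤ x ∧ x < s h} =
        P - ∫ r in (0 : ℝ)..x, (u r + 1)) ∧
      (∀ A : Set ℝ, MeasurableSet A → 0 ∉ A →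
        (volume.restrict (Ioc 0 N)).real (s ⁻¹' A) - (volume.restrict (Ioc 0 N)).real (k ⁻¹' A) =
          (∫ r in A ∩ Ioc 0 a, (u r + 1)) +
            A.indicator (fun _ => P - ∫ r in (0 : ℝ)..a, (u r + 1)) a) ∧
      volume.restrict (Ioc 0 N) {h | k h = 0} = ENNReal.ofReal P := by
  have hloc := locallyIntegrable_add_one hu hb
  set ρ : ℝ → ℝ := fun x => max (u x + 1) 0 with hρdef
  set σ : ℝ → ℝ := fun x => max (-(u x + 1)) 0 with hσdef
  have hρ : LocallyIntegrable ρ volume := locallyIntegrable_posPart hloc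
  have hσ : LocallyIntegrable σ volume := locallyIntegrable_posPart hloc.neg
  have hρn : ∀ x, 0 ≤ ρ x := fun x => le_max_right _ _
  have hσn : ∀ x, 0 ≤ σ x := fun x => le_max_right _ _
  have hsplit : ∀ x, u x + 1 = ρ x - σ x := fun x => by
    simp only [hρdef, hσdef]
    rcases le_total (u x + 1) 0 with h | h
    · rw [max_eq_right h, max_eq_left (by linarith)]; ring
    · rw [max_eq_left h, max_eq_right (by linarith)]; ring
  have hiρ : ∀ x y, IntervalIntegrable ρ volume x y := fun x y =>
    (hρ.integrableOn_isCompact isCompact_uIcc).intervalIntegrable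
  have hiσ : ∀ x y, IntervalIntegrable σ volume x y := fun x y =>
    (hσ.integrableOn_isCompact isCompact_uIcc).intervalIntegrable
  -- `H` and `K` are the cumulative masses of sources and sinks. Their difference `K - H` is the
  -- required flux, and `H ≤ K` says that sinks are always ahead on the left.
  set H : ℝ → ℝ := fun x => 0 + ∫ r in (0 : ℝ)..x, ρ r with hH
  set K : ℝ → ℝ := fun x => P + ∫ r in (0 : ℝ)..x, σ r with hK
  have hHc : Continuous H := continuous_const.add (intervalIntegral.continuous_primitive hiρ 0)
  have hKc : Continuous K := continuous_const.add (intervalIntegral.continuous_primitive hiσ 0)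
  have hmono : ∀ {f : ℝ → ℝ}, (∀ x y, IntervalIntegrable f volume x y) → (∀ x, 0 ≤ f x) →
      Monotone fun x => ∫ r in (0 : ℝ)..x, f r := fun hi hn x y hxy => by
    have h1 := intervalIntegral.integral_interval_sub_left (hi 0 y) (hi 0 x)
    have h2 := intervalIntegral.integral_nonneg (μ := volume) hxy fun r _ => hn r
    simp only
    linarith
  have hHm : Monotone H := fun x y hxy => by
    have := hmono hiρ hρn hxy
    simp only at this
    simp only [hH]; linarith
  have hKm : Monotone K := fun x y hxy => by
    have := hmono hiσ hσn hxy
    simp only at this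
    simp only [hK]; linarith
  have hdiff : ∀ x, K x - H x = P - ∫ r in (0 : ℝ)..x, (u r + 1) := fun x => by
    simp only [hsplit, hK, hH]
    rw [intervalIntegral.integral_sub (hiρ 0 x) (hiσ 0 x)]
    ring
  have hH0 : H 0 = 0 := by simp [hH]
  have hK0 : K 0 = P := by simp [hK]
  have hHnn : ∀ x, 0 ≤ x → 0 ≤ H x := fun x hx => hH0 ▸ hHm hx
  have hKa : P ≤ K a := hK0 ▸ hKm ha.le
  have hHK : ∀ x ∈ Icc 0 a, H x ≤ K x := fun x hx => by
    have := hpos x hx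
    rw [← hdiff] at this
    linarith
  have hHa : H a ≤ K a := hHK a ⟨ha.le, le_rfl⟩
  have hsm : Measurable (quantile H a) := measurable_quantile ha.le
  have hkm : Measurable (quantile K a) := measurable_quantile ha.le
  -- Levels up to the total sink mass `K a` parametrize the pairs; those above the source mass `H a`
  -- start at `a`, which is the point source.
  refine ⟨K a, hP.trans_le hKa, quantile H a, quantile K a, hsm, hkm, ?_, ?_, ?_, ?_⟩
  · intro h hh
    refine ⟨(quantile_mem ha.le h).1, ?_, (quantile_mem ha.le h).2, ?_⟩
    · rcases (quantile_mem (G := H) ha.le h).2.eq_or_lt with he | hlt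
      · rw [he]; exact (quantile_mem ha.le h).2
      · have hmem : quantile H a h ∈ Ico 0 a := ⟨(quantile_mem ha.le h).1, hlt⟩
        rw [quantile_le_iff hKc hKm ha.le hmem]
        exact ((quantile_le_iff hHc hHm ha.le hmem).1 le_rfl).trans (hHK _ ⟨hmem.1, hlt.le⟩)
    · by_contra! hle
      rw [quantile_le_iff hHc hHm ha.le ⟨le_rfl, ha⟩, hH0] at hle
      exact not_lt.2 hle hh.1
  · intro x hx
    have hx' : x ∈ Ico 0 a := ⟨hx.1.le, hx.2⟩
    have hms : MeasurableSet {h | quantile K a h ≤ x ∧ x < quantile H a h} :=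
      (hkm measurableSet_Iic).inter (hsm measurableSet_Ioi)
    -- The pairs crossing `x` are those at levels in `(H x, K x]`.
    have h1 : {h | quantile K a h ≤ x ∧ x < quantile H a h} ∩ Ioc 0 (K a) = Ioc (H x) (K x) := by
      ext h
      have e1 := quantile_le_iff (h := h) hKc hKm ha.le hx'
      have e2 := quantile_le_iff (h := h) hHc hHm ha.le hx'
      simp only [mem_inter_iff, mem_ofPred_eq, mem_Ioc, e1, ← not_le, e2]
      simp only [not_le]
      have e3 := hKm hx.2.le
      have e4 := hHnn x hx.1.le
      constructor
      · rintro ⟨⟨h1, h2⟩, -, -⟩; exact ⟨h2, h1⟩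
      · rintro ⟨h1, h2⟩; exact ⟨⟨h2, h1⟩, by linarith, by linarith⟩
    rw [measureReal_def, Measure.restrict_apply hms, h1, Real.volume_Ioc, hdiff,
      ENNReal.toReal_ofReal (hpos x ⟨hx.1.le, hx.2.le⟩)]
  · intro A hA h0A
    have hDρ : ((volume.withDensity fun x => ENNReal.ofReal (ρ x)).restrict (Ioc 0 a)) A =
        ENNReal.ofReal (∫ r in A ∩ Ioc 0 a, ρ r) := by
      rw [Measure.restrict_apply hA, withDensity_apply _ (hA.inter measurableSet_Ioc),
        ofReal_integral_eq_lintegral_ofReal ((hρ.integrableOn_isCompact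
          isCompact_Icc).mono_set (inter_subset_right.trans Ioc_subset_Icc_self)) (ae_of_all _ hρn)]
    have hDσ : ((volume.withDensity fun x => ENNReal.ofReal (σ x)).restrict (Ioc 0 a)) A =
        ENNReal.ofReal (∫ r in A ∩ Ioc 0 a, σ r) := by
      rw [Measure.restrict_apply hA, withDensity_apply _ (hA.inter measurableSet_Ioc),
        ofReal_integral_eq_lintegral_ofReal ((hσ.integrableOn_isCompact
          isCompact_Icc).mono_set (inter_subset_right.trans Ioc_subset_Icc_self)) (ae_of_all _ hσn)]
    have e1 := congrArg (fun μ => μ A) (map_quantile hρ hρn le_rfl ha hHa)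
    have e2 := congrArg (fun μ => μ A) (map_quantile hσ hσn hP.le ha le_rfl)
    simp only [Measure.coe_add, Measure.coe_smul, Pi.add_apply, Pi.smul_apply, smul_eq_mul,
      Measure.dirac_apply' _ hA, indicator_of_notMem h0A, mul_zero, zero_add, sub_self,
      ENNReal.ofReal_zero, zero_mul, add_zero, hDσ, hDρ] at e1 e2
    rw [Measure.map_apply (by simpa only [zero_add, hH] using hsm) hA] at e1
    rw [Measure.map_apply hkm hA] at e2
    have e1' : (volume.restrict (Ioc 0 (K a))).real (quantile H a ⁻¹' A) =
        (∫ r in A ∩ Ioc 0 a, ρ r) + A.indicator (fun _ => K a - H a) a := by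
      have hi : 0 ≤ ∫ r in A ∩ Ioc 0 a, ρ r := integral_nonneg hρn
      rw [measureReal_def]
      have : quantile H a = quantile (fun x => ∫ r in (0 : ℝ)..x, ρ r) a := by
        simp only [hH, zero_add]
      rw [this, e1, ENNReal.toReal_add ENNReal.ofReal_ne_top (by
        by_cases h : a ∈ A <;> simp [h]), ENNReal.toReal_ofReal hi]
      congr 1
      have hd : 0 ≤ K a - ∫ r in (0 : ℝ)..a, ρ r := by
        have : H a = ∫ r in (0 : ℝ)..a, ρ r := by simp [hH]
        linarith
      by_cases h : a ∈ A
      · simp [h, hH, ENNReal.toReal_ofReal hd]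
      · simp [h]
    have e2' : (volume.restrict (Ioc 0 (K a))).real (quantile K a ⁻¹' A) =
        ∫ r in A ∩ Ioc 0 a, σ r := by
      rw [measureReal_def, e2, ENNReal.toReal_ofReal (integral_nonneg hσn)]
    rw [e1', e2', hdiff]
    simp only [hsplit]
    rw [integral_sub ((hρ.integrableOn_isCompact
          isCompact_Icc).mono_set (inter_subset_right.trans Ioc_subset_Icc_self))
      ((hσ.integrableOn_isCompact
          isCompact_Icc).mono_set (inter_subset_right.trans Ioc_subset_Icc_self))]
    ring
  · have h1 : {h | quantile K a h = 0} = quantile K a ⁻¹' Iic 0 := by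
      ext h
      exact ⟨fun hh => le_of_eq hh, fun hh => le_antisymm hh (quantile_mem ha.le h).1⟩
    have h2 : quantile K a ⁻¹' Iic 0 ∩ Ioc 0 (K a) = Ioc 0 P := by
      ext h
      simp only [mem_inter_iff, mem_preimage, mem_Iic, mem_Ioc,
        quantile_le_iff hKc hKm ha.le ⟨le_rfl, ha⟩, hK0]
      constructor
      · rintro ⟨h1, h2, -⟩; exact ⟨h2, h1⟩
      · rintro ⟨h1, h2⟩; exact ⟨h2, h1, h2.trans hKa⟩
    rw [h1, Measure.restrict_apply (hkm measurableSet_Iic), h2, Real.volume_Ioc, sub_zero]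

end Coupling

end

/-! ### A cost function with two positive pieces. -/

section

/-- The function which is `g` on `[0, a]`, `h` on `[b, 1]`, the larger of the two where these
intervals meet, and `-γ⁻¹` elsewhere. -/
def twoPiece (γ : ℝ) (g h : ℝ → ℝ) (a b x : ℝ) : ℝ :=
  max ((Icc 0 a).piecewise g (fun _ => -γ⁻¹) x) ((Icc b 1).piecewise h (fun _ => -γ⁻¹) x)

/-- Raising a constant on a closed set can only produce upward jumps at the set. -/
theorem upperSemicontinuous_piecewise {s : Set ℝ} [∀ x, Decidable (x ∈ s)] (hs : IsClosed s) {g : ℝ → ℝ}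
    (hg : Continuous g) {c : ℝ} (hc : ∀ x, c ≤ g x) :
    UpperSemicontinuous (s.piecewise g fun _ => c) := by
  have hle : ∀ x, s.piecewise g (fun _ => c) x ≤ g x := fun x => by
    by_cases hx : x ∈ s
    · rw [piecewise_eq_of_mem _ _ _ hx]
    · rw [piecewise_eq_of_notMem _ _ _ hx]
      exact hc x
  intro x y hy
  by_cases hx : x ∈ s
  · rw [piecewise_eq_of_mem _ _ _ hx] at hy
    filter_upwards [hg.continuousAt.eventually_lt_const hy] with z hz using (hle z).trans_lt hz
  · rw [piecewise_eq_of_notMem _ _ _ hx] at hy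
    filter_upwards [hs.isOpen_compl.mem_nhds hx] with z hz
    rwa [piecewise_eq_of_notMem _ _ _ hz]

section TwoPiece

variable {γ : ℝ} {g h : ℝ → ℝ} {a b : ℝ}

theorem upperSemicontinuous_twoPiece (hγ : 0 < γ) (hg : Continuous g) (hh : Continuous h)
    (hg0 : ∀ x, 0 < g x) (hh0 : ∀ x, 0 < h x) : UpperSemicontinuous (twoPiece γ g h a b) := by
  have hc : -γ⁻¹ < 0 := neg_neg_of_pos (inv_pos.2 hγ)
  exact (upperSemicontinuous_piecewise isClosed_Icc hg fun x => (hc.trans (hg0 x)).le).sup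
    (upperSemicontinuous_piecewise isClosed_Icc hh fun x => (hc.trans (hh0 x)).le)

theorem twoPiece_of_mem_left (hγ : 0 < γ) (hg0 : ∀ x, 0 < g x) {x : ℝ} (h1 : x ∈ Icc 0 a)
    (h2 : x < b) : twoPiece γ g h a b x = g x := by
  have hc : -γ⁻¹ < 0 := neg_neg_of_pos (inv_pos.2 hγ)
  rw [twoPiece, piecewise_eq_of_mem _ _ _ h1,
    piecewise_eq_of_notMem _ _ _ fun h => not_le.2 h2 h.1, max_eq_left (hc.trans (hg0 x)).le]

theorem twoPiece_of_mem_right (hγ : 0 < γ) (hh0 : ∀ x, 0 < h x) {x : ℝ} (h1 : x ∈ Icc b 1)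
    (h2 : a < x) : twoPiece γ g h a b x = h x := by
  have hc : -γ⁻¹ < 0 := neg_neg_of_pos (inv_pos.2 hγ)
  rw [twoPiece, piecewise_eq_of_mem _ _ _ h1,
    piecewise_eq_of_notMem _ _ _ fun h => not_le.2 h2 h.2, max_eq_right (hc.trans (hh0 x)).le]

theorem twoPiece_of_notMem {x : ℝ} (h1 : x ∉ Icc 0 a) (h2 : x ∉ Icc b 1) :
    twoPiece γ g h a b x = -γ⁻¹ := by
  rw [twoPiece, piecewise_eq_of_notMem _ _ _ h1, piecewise_eq_of_notMem _ _ _ h2, max_self]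

theorem twoPiece_pos_of_mem_left (hg0 : ∀ x, 0 < g x) {x : ℝ} (h1 : x ∈ Icc 0 a) :
    0 < twoPiece γ g h a b x := by
  rw [twoPiece, piecewise_eq_of_mem _ _ _ h1]
  exact lt_max_of_lt_left (hg0 x)

theorem twoPiece_pos_of_mem_right (hh0 : ∀ x, 0 < h x) {x : ℝ} (h1 : x ∈ Icc b 1) :
    0 < twoPiece γ g h a b x := by
  rw [twoPiece, piecewise_eq_of_mem _ _ _ h1]
  exact lt_max_of_lt_right (hh0 x)

theorem twoPiece_ne_zero (hγ : 0 < γ) (hg0 : ∀ x, 0 < g x) (hh0 : ∀ x, 0 < h x) (x : ℝ) :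
    twoPiece γ g h a b x ≠ 0 := by
  by_cases h1 : x ∈ Icc 0 a
  · exact (twoPiece_pos_of_mem_left hg0 h1).ne'
  by_cases h2 : x ∈ Icc b 1
  · exact (twoPiece_pos_of_mem_right hh0 h2).ne'
  rw [twoPiece_of_notMem h1 h2]
  exact (neg_neg_of_pos (inv_pos.2 hγ)).ne

theorem measurable_twoPiece (hg : Continuous g) (hh : Continuous h) :
    Measurable (twoPiece γ g h a b) :=
  (hg.measurable.piecewise measurableSet_Icc measurable_const).max
    (hh.measurable.piecewise measurableSet_Icc measurable_const)

theorem locallyIntegrable_twoPiece (hg : Continuous g) (hh : Continuous h) :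
    LocallyIntegrable (twoPiece γ g h a b) volume := by
  have hF : Continuous fun x => |g x| + |h x| + |γ⁻¹| := by fun_prop
  refine hF.locallyIntegrable.mono (measurable_twoPiece hg hh).aestronglyMeasurable
    (ae_of_all _ fun x => ?_)
  have h1 := abs_nonneg (g x)
  have h2 := abs_nonneg (h x)
  have h3 := abs_nonneg γ⁻¹
  rw [Real.norm_eq_abs, Real.norm_eq_abs, abs_of_nonneg (a := |g x| + |h x| + |γ⁻¹|) (by linarith),
    twoPiece]
  refine abs_max_le_max_abs_abs.trans (max_le ?_ ?_)
  · by_cases hx : x ∈ Icc 0 a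
    · rw [piecewise_eq_of_mem _ _ _ hx]; linarith
    · rw [piecewise_eq_of_notMem _ _ _ hx, abs_neg]; linarith
  · by_cases hx : x ∈ Icc b 1
    · rw [piecewise_eq_of_mem _ _ _ hx]; linarith
    · rw [piecewise_eq_of_notMem _ _ _ hx, abs_neg]; linarith

theorem costLeft_twoPiece (hγ : 0 < γ) (hg0 : ∀ x, 0 < g x) (hab : a ≤ b) {x : ℝ}
    (hx : x ∈ Icc 0 a) : costLeft (twoPiece γ g h a b) x = ∫ t in (0 : ℝ)..x, g t := by
  rw [costLeft]
  refine intervalIntegral.integral_congr_ae ?_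
  -- If `a = b`, the pieces share one point, where the maximum may exceed `g`.
  filter_upwards [compl_mem_ae_iff.2 (measure_singleton b)] with t ht ht'
  rw [uIoc_of_le hx.1] at ht'
  have htb : t < b := lt_of_le_of_ne ((ht'.2.trans hx.2).trans hab) ht
  rw [twoPiece_of_mem_left hγ hg0 ⟨ht'.1.le, ht'.2.trans hx.2⟩ htb, max_eq_left (hg0 t).le]

theorem costRight_twoPiece (hγ : 0 < γ) (hh0 : ∀ x, 0 < h x) (hab : a ≤ b) {x : ℝ}
    (hx : x ∈ Icc b 1) : costRight (twoPiece γ g h a b) x = ∫ t in x..1, h t := by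
  rw [costRight]
  refine intervalIntegral.integral_congr_ae ?_
  filter_upwards [compl_mem_ae_iff.2 (measure_singleton a)] with t ht ht'
  rw [uIoc_of_le hx.2] at ht'
  rw [twoPiece_of_mem_right hγ hh0 ⟨(hx.1.trans_lt ht'.1).le, ht'.2⟩
    ((hab.trans hx.1).trans_lt ht'.1), max_eq_left (hh0 t).le]

/-- Both pieces have the same total cost, so on `[0, a]` one has `costLeft x ≤ costLeft a =
costRight b ≤ costRight x`. -/
theorem minCost_twoPiece_left (hγ : 0 < γ) (hg : Continuous g) (hh : Continuous h)
    (hg0 : ∀ x, 0 < g x) (hh0 : ∀ x, 0 < h x) (ha : 0 ≤ a) (hab : a ≤ b) (hb : b ≤ 1)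
    (heq : ∫ t in (0 : ℝ)..a, g t = ∫ t in b..1, h t) {x : ℝ} (hx : x ∈ Icc 0 a) :
    minCost (twoPiece γ g h a b) x = ∫ t in (0 : ℝ)..x, g t := by
  have hi := locallyIntegrable_twoPiece (γ := γ) (a := a) (b := b) hg hh
  have h1 := costLeft_mono hi hx.2
  have h2 := costRight_anti hi (hx.2.trans hab)
  rw [costLeft_twoPiece hγ hg0 hab ⟨ha, le_rfl⟩, heq,
    ← costRight_twoPiece (g := g) hγ hh0 hab ⟨le_rfl, hb⟩] at h1
  rw [minCost, min_eq_left (h1.trans h2), costLeft_twoPiece hγ hg0 hab hx]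

theorem minCost_twoPiece_right (hγ : 0 < γ) (hg : Continuous g) (hh : Continuous h)
    (hg0 : ∀ x, 0 < g x) (hh0 : ∀ x, 0 < h x) (ha : 0 ≤ a) (hab : a ≤ b) (hb : b ≤ 1)
    (heq : ∫ t in (0 : ℝ)..a, g t = ∫ t in b..1, h t) {x : ℝ} (hx : x ∈ Icc b 1) :
    minCost (twoPiece γ g h a b) x = ∫ t in x..1, h t := by
  have hi := locallyIntegrable_twoPiece (γ := γ) (a := a) (b := b) hg hh
  have h1 := costRight_anti hi hx.1
  have h2 := costLeft_mono hi (hab.trans hx.1)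
  rw [costRight_twoPiece hγ hh0 hab ⟨le_rfl, hb⟩, ← heq,
    ← costLeft_twoPiece (h := h) hγ hg0 hab ⟨ha, le_rfl⟩] at h1
  rw [minCost, min_eq_right (h1.trans h2), costRight_twoPiece hγ hh0 hab hx]

end TwoPiece

end

/-! ### Laws of straight pairs driven by couplings. -/

section

/-- The pair starting at `s` and stopped at `k`, where the path runs from `s` to `0`. -/
def leftPair (s k : ℝ) : StoppedPath solid × ℝ≥0 := (StoppedPath.toLeft s, (s - k).toNNReal)

/-- The pair starting at `s` and stopped at `k`, where the path runs from `s` to `1`. -/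
def rightPair (s k : ℝ) : StoppedPath solid × ℝ≥0 := (StoppedPath.toRight s, (k - s).toNNReal)

theorem start_leftPair (s k : ℝ) : start (leftPair s k) = s := StoppedPath.toLeft_pos_zero s

theorem start_rightPair (s k : ℝ) : start (rightPair s k) = s := StoppedPath.toRight_pos_zero s

theorem finish_leftPair {s k : ℝ} (hs : s ∈ Ioo (0 : ℝ) 1) (hk : k ∈ Icc 0 s) :
    finish (leftPair s k) = k := by
  have h1 : (0 : ℝ) ≤ s - k := sub_nonneg.2 hk.2
  rw [finish, leftPair, Real.coe_toNNReal _ h1, StoppedPath.toLeft_pos hs h1, sub_sub_cancel,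
    max_eq_left hk.1]

theorem finish_rightPair {s k : ℝ} (hs : s ∈ Ioo (0 : ℝ) 1) (hk : k ∈ Icc s 1) :
    finish (rightPair s k) = k := by
  have h1 : (0 : ℝ) ≤ k - s := sub_nonneg.2 hk.1
  rw [finish, rightPair, Real.coe_toNNReal _ h1, StoppedPath.toRight_pos hs h1, add_sub_cancel,
    min_eq_left hk.2]

theorem isTight_leftPair {L : ℝ → ℝ} (hi : LocallyIntegrable L volume) {s k : ℝ}
    (hs : s ∈ Ioo (0 : ℝ) 1) (hk : k ∈ Icc 0 s) (hc : minCost L s = costLeft L s)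
    (hL : ∀ x ∈ Icc k s, 0 < L x) : IsTight L (leftPair s k) where
  cost_eq := by
    change (StoppedPath.toLeft s).cost L = ENNReal.ofReal (minCost L (start (leftPair s k)))
    rw [start_leftPair, hc, StoppedPath.cost_toLeft hi hs]
  le_θ := by
    change (s - k).toNNReal ≤ (StoppedPath.toLeft s).θ
    rw [StoppedPath.toLeft_θ hs]
    exact Real.toNNReal_le_toNNReal (sub_le_self _ hk.1)
  exit := fun _ => Or.inl <| by
    change (StoppedPath.toLeft s).pos (StoppedPath.toLeft s).θ = 0
    rw [StoppedPath.toLeft_θ hs, Real.coe_toNNReal _ hs.1.le, StoppedPath.toLeft_pos hs hs.1.le,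
      sub_self, max_self]
  pos_ae := ae_of_all _ fun t ht => by
    change t ∈ Ioc 0 ((s - k).toNNReal : ℝ) at ht
    change 0 < L ((StoppedPath.toLeft s).pos t)
    rw [Real.coe_toNNReal _ (sub_nonneg.2 hk.2)] at ht
    have h1 : 0 ≤ s - t := by linarith [ht.2, hk.1]
    rw [StoppedPath.toLeft_pos hs ht.1.le, max_eq_left h1]
    exact hL _ ⟨by linarith [ht.2], by linarith [ht.1]⟩

theorem isTight_rightPair {L : ℝ → ℝ} (hi : LocallyIntegrable L volume) {s k : ℝ}
    (hs : s ∈ Ioo (0 : ℝ) 1) (hk : k ∈ Icc s 1) (hc : minCost L s = costRight L s)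
    (hL : ∀ x ∈ Icc s k, 0 < L x) : IsTight L (rightPair s k) where
  cost_eq := by
    change (StoppedPath.toRight s).cost L = ENNReal.ofReal (minCost L (start (rightPair s k)))
    rw [start_rightPair, hc, StoppedPath.cost_toRight hi hs]
  le_θ := by
    change (k - s).toNNReal ≤ (StoppedPath.toRight s).θ
    rw [StoppedPath.toRight_θ hs]
    exact Real.toNNReal_le_toNNReal (sub_le_sub_right hk.2 _)
  exit := fun _ => Or.inr <| by
    have h1 : (0 : ℝ) ≤ 1 - s := sub_nonneg.2 hs.2.le
    change (StoppedPath.toRight s).pos (StoppedPath.toRight s).θ = 1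
    rw [StoppedPath.toRight_θ hs, Real.coe_toNNReal _ h1, StoppedPath.toRight_pos hs h1,
      add_sub_cancel, min_self]
  pos_ae := ae_of_all _ fun t ht => by
    change t ∈ Ioc 0 ((k - s).toNNReal : ℝ) at ht
    change 0 < L ((StoppedPath.toRight s).pos t)
    rw [Real.coe_toNNReal _ (sub_nonneg.2 hk.1)] at ht
    have h1 : s + t ≤ 1 := by linarith [ht.2, hk.2]
    rw [StoppedPath.toRight_pos hs ht.1.le, min_eq_left h1]
    exact hL _ ⟨by linarith [ht.1], by linarith [ht.2]⟩

theorem measurable_leftPair {s k : ℝ → ℝ} (hs : Measurable s) (hk : Measurable k) :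
    Measurable fun h => leftPair (s h) (k h) :=
  (StoppedPath.measurable_toLeft.comp hs).prodMk (hs.sub hk).real_toNNReal

theorem measurable_rightPair {s k : ℝ → ℝ} (hs : Measurable s) (hk : Measurable k) :
    Measurable fun h => rightPair (s h) (k h) :=
  (StoppedPath.measurable_toRight.comp hs).prodMk (hk.sub hs).real_toNNReal

/-- Starting points `s` and stopping points `k`, on the parameter interval `(0, N]`, such that the
mass moving from the right to the left of `x` is `P - ∫_0^x (u + 1)`. -/
structure Coupling (u : ℝ → ℝ) (a P N : ℝ) (s k : ℝ → ℝ) : Prop where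
  pos : 0 < N
  measurable_s : Measurable s
  measurable_k : Measurable k
  mem : ∀ h ∈ Ioc 0 N, 0 ≤ k h ∧ k h ≤ s h ∧ s h ≤ a ∧ 0 < s h
  crossing : ∀ x ∈ Ioo 0 a, (volume.restrict (Ioc 0 N)).real {h | k h ≤ x ∧ x < s h} =
    P - ∫ r in (0 : ℝ)..x, (u r + 1)
  balance : ∀ A : Set ℝ, MeasurableSet A → 0 ∉ A →
    (volume.restrict (Ioc 0 N)).real (s ⁻¹' A) - (volume.restrict (Ioc 0 N)).real (k ⁻¹' A) =
      (∫ r in A ∩ Ioc 0 a, (u r + 1)) + A.indicator (fun _ => P - ∫ r in (0 : ℝ)..a, (u r + 1)) a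
  atom : volume.restrict (Ioc 0 N) {h | k h = 0} = ENNReal.ofReal P

/-- The law of pairs moving to `0` according to `(s, k)`, and to `1` according to the reflection
of `(s', k')`. -/
def pairLaw (N M : ℝ) (s k s' k' : ℝ → ℝ) : Measure (StoppedPath solid × ℝ≥0) :=
  (ENNReal.ofReal (N + M))⁻¹ •
    ((volume.restrict (Ioc 0 N)).map (fun h => leftPair (s h) (k h)) +
      (volume.restrict (Ioc 0 M)).map (fun h => rightPair (1 - s' h) (1 - k' h)))

section PairLaw

variable {N M : ℝ} {s k s' k' : ℝ → ℝ}

theorem ofReal_mul_pairLaw (hN : 0 < N) (hM : 0 < M) (hs : Measurable s) (hk : Measurable k)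
    (hs' : Measurable s') (hk' : Measurable k') {S : Set (StoppedPath solid × ℝ≥0)}
    (hS : MeasurableSet S) :
    ENNReal.ofReal (N + M) * pairLaw N M s k s' k' S =
      volume.restrict (Ioc 0 N) {h | leftPair (s h) (k h) ∈ S} +
        volume.restrict (Ioc 0 M) {h | rightPair (1 - s' h) (1 - k' h) ∈ S} := by
  have hr : Measurable fun h => rightPair (1 - s' h) (1 - k' h) :=
    measurable_rightPair (measurable_const.sub hs') (measurable_const.sub hk')
  rw [pairLaw, Measure.smul_apply, Measure.add_apply,
    Measure.map_apply (measurable_leftPair hs hk) hS, Measure.map_apply hr hS, smul_eq_mul, ← mul_assoc, ENNReal.mul_inv_cancel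
      (ENNReal.ofReal_pos.2 (add_pos hN hM)).ne' ENNReal.ofReal_ne_top, one_mul]
  rfl

theorem mul_real_pairLaw (hN : 0 < N) (hM : 0 < M) (hs : Measurable s) (hk : Measurable k)
    (hs' : Measurable s') (hk' : Measurable k') {S : Set (StoppedPath solid × ℝ≥0)}
    (hS : MeasurableSet S) :
    (N + M) * (pairLaw N M s k s' k').real S =
      (volume.restrict (Ioc 0 N)).real {h | leftPair (s h) (k h) ∈ S} +
        (volume.restrict (Ioc 0 M)).real {h | rightPair (1 - s' h) (1 - k' h) ∈ S} := by
  rw [Measure.real, Measure.real, Measure.real, ← ENNReal.toReal_add (measure_ne_top _ _)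
    (measure_ne_top _ _), ← ofReal_mul_pairLaw hN hM hs hk hs' hk' hS, ENNReal.toReal_mul,
    ENNReal.toReal_ofReal (add_pos hN hM).le]

theorem isProbabilityMeasure_pairLaw (hN : 0 < N) (hM : 0 < M) (hs : Measurable s)
    (hk : Measurable k) (hs' : Measurable s') (hk' : Measurable k') :
    IsProbabilityMeasure (pairLaw N M s k s' k') := by
  constructor
  have h := ofReal_mul_pairLaw hN hM hs hk hs' hk' MeasurableSet.univ
  simp only [mem_univ, ofPred_true, Measure.restrict_apply MeasurableSet.univ, univ_inter,
    Real.volume_Ioc, sub_zero, ← ENNReal.ofReal_add hN.le hM.le] at h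
  have h0 := (ENNReal.ofReal_pos.2 (add_pos hN hM)).ne'
  calc pairLaw N M s k s' k' univ
      = (ENNReal.ofReal (N + M))⁻¹ * (ENNReal.ofReal (N + M) * pairLaw N M s k s' k' univ) := by
        rw [← mul_assoc, ENNReal.inv_mul_cancel h0 ENNReal.ofReal_ne_top, one_mul]
    _ = 1 := by rw [h, ENNReal.inv_mul_cancel h0 ENNReal.ofReal_ne_top]

theorem ae_pairLaw (hs : Measurable s) (hk : Measurable k) (hs' : Measurable s')
    (hk' : Measurable k') {p : StoppedPath solid × ℝ≥0 → Prop} (hp : MeasurableSet {q | p q})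
    (hl : ∀ h ∈ Ioc 0 N, p (leftPair (s h) (k h)))
    (hr : ∀ h ∈ Ioc 0 M, p (rightPair (1 - s' h) (1 - k' h))) :
    ∀ᵐ q ∂pairLaw N M s k s' k', p q := by
  have hm : Measurable fun h => rightPair (1 - s' h) (1 - k' h) :=
    measurable_rightPair (measurable_const.sub hs') (measurable_const.sub hk')
  refine Measure.ae_smul_measure (ae_add_measure_iff.2 ⟨?_, ?_⟩) _
  · rw [ae_map_iff (measurable_leftPair hs hk).aemeasurable hp]
    exact (ae_restrict_iff' measurableSet_Ioc).2 (ae_of_all _ hl)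
  · rw [ae_map_iff hm.aemeasurable hp]
    exact (ae_restrict_iff' measurableSet_Ioc).2 (ae_of_all _ hr)

end PairLaw

/-- Needed to check tightness under an image measure pair by pair. The almost everywhere condition
in time is the vanishing of the time spent in `{L ≤ 0}`, which is measurable in the path. -/
theorem measurableSet_isTight {L : ℝ → ℝ} (hm : Measurable L) (hi : LocallyIntegrable L volume) :
    MeasurableSet {p : StoppedPath solid × ℝ≥0 | IsTight L p} := by
  have hpθ : Measurable fun p : StoppedPath solid × ℝ≥0 => p.1.pos p.1.θ :=
    StoppedPath.measurable_pos_comp (StoppedPath.measurable_θ.comp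
      measurable_fst).coe_nnreal_real measurable_fst
  have hθ : Measurable fun p : StoppedPath solid × ℝ≥0 => p.1.θ :=
    StoppedPath.measurable_θ.comp measurable_fst
  have hf : Measurable (indicator {x | L x ≤ 0} (fun _ => (1 : ℝ≥0∞))) :=
    measurable_const.indicator (measurableSet_le hm measurable_const)
  have h1 : MeasurableSet {p : StoppedPath solid × ℝ≥0 |
      p.1.cost L = ENNReal.ofReal (minCost L (start p))} :=
    measurableSet_eq_fun ((StoppedPath.measurable_cost hm).comp measurable_fst)
      ((continuous_minCost hi).measurable.comp measurable_start).ennreal_ofReal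
  have h2 : MeasurableSet {p : StoppedPath solid × ℝ≥0 | p.2 ≤ p.1.θ} :=
    measurableSet_le measurable_snd hθ
  have h3 : MeasurableSet {p : StoppedPath solid × ℝ≥0 |
      p.2 = p.1.θ → p.1.pos p.1.θ = 0 ∨ p.1.pos p.1.θ = 1} := by
    have h4 : MeasurableSet {p : StoppedPath solid × ℝ≥0 | p.2 = p.1.θ} :=
      measurableSet_eq_fun measurable_snd hθ
    have h5 : MeasurableSet {p : StoppedPath solid × ℝ≥0 | p.1.pos p.1.θ = 0} :=
      hpθ (measurableSet_singleton 0)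
    have h6 : MeasurableSet {p : StoppedPath solid × ℝ≥0 | p.1.pos p.1.θ = 1} :=
      hpθ (measurableSet_singleton 1)
    exact h4.imp (h5.union h6)
  have h4 : MeasurableSet {p : StoppedPath solid × ℝ≥0 |
      ∫⁻ t in Ioc (0 : ℝ) p.2, indicator {x | L x ≤ 0} (fun _ => (1 : ℝ≥0∞)) (p.1.pos t) = 0} :=
    measurableSet_eq_fun (StoppedPath.measurable_lintegral_Ioc measurable_fst measurable_const
      measurable_snd.coe_nnreal_real hf) measurable_const
  convert ((h1.inter h2).inter h3).inter h4 using 1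
  ext p
  have key : (∫⁻ t in Ioc (0 : ℝ) p.2, indicator {x | L x ≤ 0} (fun _ => (1 : ℝ≥0∞)) (p.1.pos t) = 0)
      ↔ ∀ᵐ t : ℝ, t ∈ Ioc (0 : ℝ) p.2 → 0 < L (p.1.pos t) := by
    have hfp : Measurable fun t => indicator {x | L x ≤ 0} (fun _ => (1 : ℝ≥0∞)) (p.1.pos t) :=
      hf.comp p.1.lipschitz_pos.continuous.measurable
    rw [lintegral_eq_zero_iff hfp, Filter.EventuallyEq,
      ae_restrict_iff' measurableSet_Ioc]
    refine Filter.eventually_congr (ae_of_all _ fun t => ?_)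
    simp [indicator_apply]
  exact ⟨fun h => ⟨⟨⟨h.cost_eq, h.le_θ⟩, h.exit⟩, key.2 h.pos_ae⟩,
    fun h => ⟨h.1.1.1, h.1.1.2, h.1.2, key.1 h.2⟩⟩

end

/-! ### The equilibrium of two interfaces with prescribed fluxes. -/

section

theorem restrict_Ioc_congr {N : ℝ} {A B : Set ℝ} (h : ∀ x ∈ Ioc 0 N, x ∈ A ↔ x ∈ B) :
    volume.restrict (Ioc 0 N) A = volume.restrict (Ioc 0 N) B := by
  rw [Measure.restrict_apply' measurableSet_Ioc, Measure.restrict_apply' measurableSet_Ioc]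
  congr 1
  ext x
  simp only [mem_inter_iff]
  exact ⟨fun hx => ⟨(h x hx.2).1 hx.1, hx.2⟩, fun hx => ⟨(h x hx.2).2 hx.1, hx.2⟩⟩

/-- The data of two interfaces which move from `0` to `a` and from `1` to `1 - b` during the same
time `t`, with slownesses `g` and `h`. -/
structure Plan (u : ℝ → ℝ) (γ P₀ P₁ a b N M : ℝ) (s k s' k' g h : ℝ → ℝ) (t : ℝ≥0) : Prop where
  γ_pos : 0 < γ
  a_pos : 0 < a
  b_pos : 0 < b
  add_le : a + b ≤ 1
  left : Coupling u a P₀ N s k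
  right : Coupling (reflect u) b P₁ M s' k'
  continuous_g : Continuous g
  continuous_h : Continuous h
  g_pos : ∀ x, 0 < g x
  h_pos : ∀ x, 0 < h x
  g_mul : ∀ x ∈ Icc 0 a, g x * (P₀ - γ - ∫ r in (0 : ℝ)..x, (u r + 1)) = 1
  h_mul : ∀ x ∈ Icc 0 b, h (1 - x) * (P₁ - γ - ∫ r in (0 : ℝ)..x, (reflect u r + 1)) = 1
  cost_g : ∫ x in (0 : ℝ)..a, g x = t
  cost_h : ∫ x in (1 - b)..1, h x = t

namespace Plan

variable {u : ℝ → ℝ} {γ P₀ P₁ a b N M : ℝ} {s k s' k' g h : ℝ → ℝ} {t : ℝ≥0}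

/-- The triple `(κ, ℚ, L)` of a plan. -/
def triple (_ : Plan u γ P₀ P₁ a b N M s k s' k' g h t) : Triple solid :=
  ⟨N + M, pairLaw N M s k s' k', twoPiece γ g h a (1 - b)⟩

variable (H : Plan u γ P₀ P₁ a b N M s k s' k' g h t)

include H

theorem mem_left {z : ℝ} (hz : z ∈ Ioc 0 N) :
    s z ∈ Ioo (0 : ℝ) 1 ∧ k z ∈ Icc 0 (s z) ∧ s z ≤ a := by
  obtain ⟨h1, h2, h3, h4⟩ := H.left.mem z hz
  have := H.add_le
  have := H.b_pos
  exact ⟨⟨h4, by linarith⟩, ⟨h1, h2⟩, h3⟩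

theorem mem_right {z : ℝ} (hz : z ∈ Ioc 0 M) :
    1 - s' z ∈ Ioo (0 : ℝ) 1 ∧ 1 - k' z ∈ Icc (1 - s' z) 1 ∧ 1 - b ≤ 1 - s' z := by
  obtain ⟨h1, h2, h3, h4⟩ := H.right.mem z hz
  have := H.add_le
  have := H.a_pos
  exact ⟨⟨by linarith, by linarith⟩, ⟨by linarith, by linarith⟩, by linarith⟩

theorem measurable_L : Measurable H.triple.L := measurable_twoPiece H.continuous_g H.continuous_h

theorem locallyIntegrable_L : LocallyIntegrable H.triple.L volume :=
  locallyIntegrable_twoPiece H.continuous_g H.continuous_h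

theorem le_one_sub : a ≤ 1 - b := by linarith [H.add_le]

theorem minCost_left {x : ℝ} (hx : x ∈ Icc 0 a) :
    minCost H.triple.L x = ∫ z in (0 : ℝ)..x, g z :=
  minCost_twoPiece_left H.γ_pos H.continuous_g H.continuous_h H.g_pos H.h_pos H.a_pos.le
    H.le_one_sub (by linarith [H.b_pos]) (H.cost_g.trans H.cost_h.symm) hx

theorem minCost_right {x : ℝ} (hx : x ∈ Icc (1 - b) 1) :
    minCost H.triple.L x = ∫ z in x..1, h z :=
  minCost_twoPiece_right H.γ_pos H.continuous_g H.continuous_h H.g_pos H.h_pos H.a_pos.le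
    H.le_one_sub (by linarith [H.b_pos]) (H.cost_g.trans H.cost_h.symm) hx

theorem minCost_left_le {x : ℝ} (hx : x ∈ Icc 0 a) : minCost H.triple.L x ≤ t := by
  have h1 := intervalIntegral.integral_add_adjacent_intervals
    (H.continuous_g.intervalIntegrable (μ := volume) 0 x) (H.continuous_g.intervalIntegrable x a)
  have h2 : 0 ≤ ∫ z in x..a, g z := intervalIntegral.integral_nonneg hx.2 fun z _ => (H.g_pos z).le
  rw [H.minCost_left hx, ← H.cost_g]
  linarith

theorem minCost_right_le {x : ℝ} (hx : x ∈ Icc (1 - b) 1) : minCost H.triple.L x ≤ t := by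
  have h1 := intervalIntegral.integral_add_adjacent_intervals
    (H.continuous_h.intervalIntegrable (μ := volume) (1 - b) x)
    (H.continuous_h.intervalIntegrable x 1)
  have h2 : 0 ≤ ∫ z in (1 - b)..x, h z :=
    intervalIntegral.integral_nonneg hx.1 fun z _ => (H.h_pos z).le
  rw [H.minCost_right hx, ← H.cost_h]
  linarith

theorem isTight_left {z : ℝ} (hz : z ∈ Ioc 0 N) :
    IsTight H.triple.L (leftPair (s z) (k z)) := by
  obtain ⟨h1, h2, h3⟩ := H.mem_left hz
  have h4 : s z ∈ Icc 0 a := ⟨h1.1.le, h3⟩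
  refine isTight_leftPair H.locallyIntegrable_L h1 h2 ?_ fun x hx =>
    twoPiece_pos_of_mem_left H.g_pos ⟨h2.1.trans hx.1, hx.2.trans h3⟩
  rw [H.minCost_left h4]
  exact (costLeft_twoPiece H.γ_pos H.g_pos H.le_one_sub h4).symm

theorem isTight_right {z : ℝ} (hz : z ∈ Ioc 0 M) :
    IsTight H.triple.L (rightPair (1 - s' z) (1 - k' z)) := by
  obtain ⟨h1, h2, h3⟩ := H.mem_right hz
  have h4 : 1 - s' z ∈ Icc (1 - b) 1 := ⟨h3, h1.2.le⟩
  refine isTight_rightPair H.locallyIntegrable_L h1 h2 ?_ fun x hx =>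
    twoPiece_pos_of_mem_right H.h_pos ⟨h3.trans hx.1, hx.2.trans h2.2⟩
  rw [H.minCost_right h4]
  exact (costRight_twoPiece H.γ_pos H.h_pos H.le_one_sub h4).symm

theorem ae_of_forall {p : StoppedPath solid × ℝ≥0 → Prop} (hp : MeasurableSet {q | p q})
    (hl : ∀ z ∈ Ioc 0 N, p (leftPair (s z) (k z)))
    (hr : ∀ z ∈ Ioc 0 M, p (rightPair (1 - s' z) (1 - k' z))) : ∀ᵐ q ∂H.triple.Q, p q :=
  ae_pairLaw H.left.measurable_s H.left.measurable_k H.right.measurable_s H.right.measurable_k hp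
    hl hr

theorem ae_isTight : ∀ᵐ p ∂H.triple.Q, IsTight H.triple.L p :=
  H.ae_of_forall (measurableSet_isTight H.measurable_L H.locallyIntegrable_L)
    (fun _ hz => H.isTight_left hz) fun _ hz => H.isTight_right hz

theorem ae_minCost_start_le : ∀ᵐ p ∂H.triple.Q, minCost H.triple.L (start p) ≤ t := by
  refine H.ae_of_forall ?_ (fun z hz => ?_) fun z hz => ?_
  · exact measurableSet_le ((continuous_minCost H.locallyIntegrable_L).measurable.comp
      measurable_start) measurable_const
  · obtain ⟨h1, h2, h3⟩ := H.mem_left hz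
    rw [start_leftPair]
    exact H.minCost_left_le ⟨h1.1.le, h3⟩
  · obtain ⟨h1, h2, h3⟩ := H.mem_right hz
    rw [start_rightPair]
    exact H.minCost_right_le ⟨h3, h1.2.le⟩

theorem mul_real {S : Set (StoppedPath solid × ℝ≥0)} (hS : MeasurableSet S) :
    H.triple.κ * H.triple.Q.real S =
      (volume.restrict (Ioc 0 N)).real {z | leftPair (s z) (k z) ∈ S} +
        (volume.restrict (Ioc 0 M)).real {z | rightPair (1 - s' z) (1 - k' z) ∈ S} :=
  mul_real_pairLaw H.left.pos H.right.pos H.left.measurable_s H.left.measurable_k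
    H.right.measurable_s H.right.measurable_k hS

theorem flux_eq (x : ℝ) : H.triple.κ * H.triple.Q.real {p | x ∈ crossed p} =
    (volume.restrict (Ioc 0 N)).real {z | k z ≤ x ∧ x < s z} +
      (volume.restrict (Ioc 0 M)).real {z | k' z ≤ 1 - x ∧ 1 - x < s' z} := by
  rw [H.mul_real (measurableSet_mem_crossed x)]
  congr 1
  · refine congrArg ENNReal.toReal (restrict_Ioc_congr fun z hz => ?_)
    obtain ⟨h1, h2, h3⟩ := H.mem_left hz
    simp only [mem_ofPred_eq, crossed, start_leftPair, finish_leftPair h1 h2, mem_union, mem_Ico,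
      mem_Ioc]
    refine ⟨fun hx => hx.resolve_right fun hx => ?_, Or.inl⟩
    exact absurd (hx.1.trans_le hx.2) (not_lt.2 h2.2)
  · refine congrArg ENNReal.toReal (restrict_Ioc_congr fun z hz => ?_)
    obtain ⟨h1, h2, h3⟩ := H.mem_right hz
    simp only [mem_ofPred_eq, crossed, start_rightPair, finish_rightPair h1 h2, mem_union, mem_Ico,
      mem_Ioc]
    refine ⟨fun hx => ?_, fun hx => Or.inr ⟨by linarith [hx.2], by linarith [hx.1]⟩⟩
    rcases hx with hx | hx
    · exact absurd (hx.1.trans_lt hx.2) (not_lt.2 h2.1)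
    · exact ⟨by linarith [hx.2], by linarith [hx.1]⟩

/-- Pairs moving right start at or beyond `1 - b ≥ a`, so only the left coupling crosses `x < a`. -/
theorem flux_left {x : ℝ} (hx : x ∈ Ioo 0 a) :
    H.triple.κ * H.triple.Q.real {p | x ∈ crossed p} = P₀ - ∫ r in (0 : ℝ)..x, (u r + 1) := by
  have h1 : (volume.restrict (Ioc 0 M)).real {z | k' z ≤ 1 - x ∧ 1 - x < s' z} = 0 := by
    rw [measureReal_eq_zero_iff (measure_ne_top _ _), ← measure_empty (μ := volume.restrict (Ioc 0 M))]
    refine restrict_Ioc_congr fun z hz => ⟨fun hz' => ?_, fun hz' => absurd hz' (notMem_empty z)⟩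
    have h2 := (H.right.mem z hz).2.2.1
    have h3 : 1 - x < s' z := hz'.2
    linarith [H.add_le, hx.2]
  rw [H.flux_eq, h1, add_zero, H.left.crossing x hx]

theorem flux_right {x : ℝ} (hx : x ∈ Ioo 0 b) :
    H.triple.κ * H.triple.Q.real {p | 1 - x ∈ crossed p} =
      P₁ - ∫ r in (0 : ℝ)..x, (reflect u r + 1) := by
  have h1 : (volume.restrict (Ioc 0 N)).real {z | k z ≤ 1 - x ∧ 1 - x < s z} = 0 := by
    rw [measureReal_eq_zero_iff (measure_ne_top _ _), ← measure_empty (μ := volume.restrict (Ioc 0 N))]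
    refine restrict_Ioc_congr fun z hz => ⟨fun hz' => ?_, fun hz' => absurd hz' (notMem_empty z)⟩
    have h2 := (H.left.mem z hz).2.2.1
    have h3 : 1 - x < s z := hz'.2
    linarith [H.add_le, hx.2]
  rw [H.flux_eq, h1, zero_add, sub_sub_cancel, H.right.crossing x hx]

/-- On the pieces, slowness times velocity equals one, which is `L · flux = 1 + γ L`. Elsewhere the
value `-γ⁻¹` makes both sides vanish, whatever the flux. -/
theorem ae_posPart_mul_flux :
    ∀ᵐ x, max (H.triple.L x) 0 * (H.triple.κ * H.triple.Q.real {p | x ∈ crossed p}) =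
      1 + γ * H.triple.L x := by
  have hγ := H.γ_pos
  have hn : volume ({0, a, 1 - b, 1} : Set ℝ) = 0 := (toFinite _).measure_zero _
  filter_upwards [compl_mem_ae_iff.2 hn] with x hx
  simp only [mem_compl_iff, mem_insert_iff, mem_singleton_iff, not_or] at hx
  obtain ⟨hx0, hxa, hxb, hx1⟩ := hx
  by_cases h1 : x ∈ Icc 0 a
  · have h2 : x ∈ Ioo 0 a := ⟨lt_of_le_of_ne h1.1 (Ne.symm hx0), lt_of_le_of_ne h1.2 hxa⟩
    have h3 : H.triple.L x = g x :=
      twoPiece_of_mem_left hγ H.g_pos h1 (h2.2.trans_le H.le_one_sub)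
    rw [H.flux_left h2, h3, max_eq_left (H.g_pos x).le]
    linarith [H.g_mul x h1]
  by_cases h2 : x ∈ Icc (1 - b) 1
  · have h3 : 1 - x ∈ Ioo 0 b := ⟨sub_pos.2 (lt_of_le_of_ne h2.2 hx1),
      by linarith [lt_of_le_of_ne h2.1 (Ne.symm hxb)]⟩
    have h4 : H.triple.L x = h x := twoPiece_of_mem_right hγ H.h_pos h2
      (H.le_one_sub.trans_lt (lt_of_le_of_ne h2.1 (Ne.symm hxb)))
    have h5 := H.flux_right h3
    have h6 := H.h_mul (1 - x) ⟨h3.1.le, h3.2.le⟩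
    rw [sub_sub_cancel] at h5 h6
    rw [h5, h4, max_eq_left (H.h_pos x).le]
    linarith
  · have h3 : H.triple.L x = -γ⁻¹ := twoPiece_of_notMem h1 h2
    rw [h3, max_eq_right (neg_neg_of_pos (inv_pos.2 hγ)).le, zero_mul, mul_neg,
      mul_inv_cancel₀ hγ.ne']
    ring

theorem isProbabilityMeasure : IsProbabilityMeasure H.triple.Q :=
  isProbabilityMeasure_pairLaw H.left.pos H.right.pos H.left.measurable_s H.left.measurable_k
    H.right.measurable_s H.right.measurable_k

/-- All conditions follow from tightness, the pointwise flux equation, and the fact that the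
starting points have minimal cost at most `t`. -/
theorem isCappedEquilibrium : H.triple.IsCappedEquilibrium γ t where
  κ_pos := add_pos H.left.pos H.right.pos
  isProbability := H.isProbabilityMeasure
  usc := upperSemicontinuous_twoPiece H.γ_pos H.continuous_g H.continuous_h H.g_pos H.h_pos
  ne_zero := twoPiece_ne_zero H.γ_pos H.g_pos H.h_pos
  optimal := fun P _ hP => optimal_of_ae_cost_eq H.measurable_L H.locallyIntegrable_L
    (H.ae_isTight.mono fun _ hp => hp.cost_eq) hP
  capped := by
    filter_upwards [H.ae_isTight, H.ae_minCost_start_le] with p hp hle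
    refine ⟨?_, hp.le_θ⟩
    rw [hp.cost_eq]
    exact ENNReal.ofReal_le_of_le_toReal (hle.trans_eq (ENNReal.coe_toReal t).symm)
  exit := by
    filter_upwards [H.ae_isTight] with p hp hβ
    rw [essBoundary_solid]
    exact hp.exit hβ
  locallyIntegrable := H.locallyIntegrable_L
  fixedPoint := fun φ hφ hφc => by
    have := H.isProbabilityMeasure
    have hg : Measurable fun x => φ x * max (H.triple.L x) 0 :=
      hφ.continuous.measurable.mul (H.measurable_L.max measurable_const)
    have hgi : Integrable (fun x => φ x * max (H.triple.L x) 0) volume := by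
      simpa only [smul_eq_mul] using (locallyIntegrable_posPart H.locallyIntegrable_L
        ).integrable_smul_left_of_hasCompactSupport hφ.continuous hφc
    rw [integral_occupation H.measurable_L H.locallyIntegrable_L H.ae_isTight hg hgi,
      ← integral_const_mul]
    refine integral_congr_ae ?_
    filter_upwards [H.ae_posPart_mul_flux] with x hx
    rw [← hx]
    ring
  negPart := fun φ hφ hφc => by
    rw [← lintegral_zero (μ := H.triple.Q)]
    refine lintegral_congr_ae ?_
    filter_upwards [H.ae_isTight] with p hp
    rw [← lintegral_zero (μ := volume.restrict (Ioc (0 : ℝ) p.2))]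
    refine lintegral_congr_ae ?_
    filter_upwards [(ae_restrict_iff' measurableSet_Ioc).2 hp.pos_ae] with z hz
    rw [max_eq_right (neg_nonpos.2 hz.le), mul_zero, ENNReal.ofReal_zero]

end Plan

end

/-! ### Exit measure, admissibility and excess of the construction. -/

section

namespace Plan

variable {u : ℝ → ℝ} {γ P₀ P₁ a b N M C : ℝ} {s k s' k' g h : ℝ → ℝ} {t : ℝ≥0}

variable (H : Plan u γ P₀ P₁ a b N M s k s' k' g h t)

include H

theorem exitMeasure_eq : H.triple.exitMeasure =
    ENNReal.ofReal P₀ • Measure.dirac 0 + ENNReal.ofReal P₁ • Measure.dirac 1 := by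
  ext B hB
  have hS : MeasurableSet {p : StoppedPath solid × ℝ≥0 | finish p ∈ B ∩ {0, 1}} :=
    measurable_finish (hB.inter (toFinite _).measurableSet)
  have h1 : volume.restrict (Ioc 0 N) {z | leftPair (s z) (k z) ∈
      {p : StoppedPath solid × ℝ≥0 | finish p ∈ B ∩ {0, 1}}} =
      ENNReal.ofReal P₀ * Measure.dirac 0 B := by
    by_cases h0 : (0 : ℝ) ∈ B
    · rw [Measure.dirac_apply_of_mem h0, mul_one, ← H.left.atom]
      refine restrict_Ioc_congr fun z hz => ?_
      obtain ⟨h1, h2, h3⟩ := H.mem_left hz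
      have h4 : k z ≠ 1 := (h2.2.trans_lt h1.2).ne
      simp only [mem_ofPred_eq, finish_leftPair h1 h2, mem_inter_iff, mem_insert_iff,
        mem_singleton_iff, h4, or_false]
      exact ⟨fun h => h.2, fun h => ⟨h ▸ h0, h⟩⟩
    · rw [Measure.dirac_apply' _ hB, indicator_of_notMem h0, mul_zero,
        ← measure_empty (μ := volume.restrict (Ioc 0 N))]
      refine restrict_Ioc_congr fun z hz => ?_
      obtain ⟨h1, h2, h3⟩ := H.mem_left hz
      have h4 : k z ≠ 1 := (h2.2.trans_lt h1.2).ne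
      simp only [mem_ofPred_eq, finish_leftPair h1 h2, mem_inter_iff, mem_insert_iff,
        mem_singleton_iff, h4, or_false, mem_empty_iff_false, iff_false]
      exact fun h => h0 (h.2 ▸ h.1)
  have h2 : volume.restrict (Ioc 0 M) {z | rightPair (1 - s' z) (1 - k' z) ∈
      {p : StoppedPath solid × ℝ≥0 | finish p ∈ B ∩ {0, 1}}} =
      ENNReal.ofReal P₁ * Measure.dirac 1 B := by
    by_cases h0 : (1 : ℝ) ∈ B
    · rw [Measure.dirac_apply_of_mem h0, mul_one, ← H.right.atom]
      refine restrict_Ioc_congr fun z hz => ?_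
      obtain ⟨h1, h2, h3⟩ := H.mem_right hz
      have h4 : 1 - k' z ≠ 0 := (h1.1.trans_le h2.1).ne'
      simp only [mem_ofPred_eq, finish_rightPair h1 h2, mem_inter_iff, mem_insert_iff,
        mem_singleton_iff, h4, false_or, sub_eq_self]
      exact ⟨fun h => h.2, fun h => ⟨by rwa [h, sub_zero], h⟩⟩
    · rw [Measure.dirac_apply' _ hB, indicator_of_notMem h0, mul_zero,
        ← measure_empty (μ := volume.restrict (Ioc 0 M))]
      refine restrict_Ioc_congr fun z hz => ?_
      obtain ⟨h1, h2, h3⟩ := H.mem_right hz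
      have h4 : 1 - k' z ≠ 0 := (h1.1.trans_le h2.1).ne'
      simp only [mem_ofPred_eq, finish_rightPair h1 h2, mem_inter_iff, mem_insert_iff,
        mem_singleton_iff, h4, false_or, mem_empty_iff_false, iff_false]
      exact fun h => h0 (h.2 ▸ h.1)
  rw [H.isCappedEquilibrium.exitMeasure_apply hB]
  refine (ofReal_mul_pairLaw H.left.pos H.right.pos H.left.measurable_s H.left.measurable_k
    H.right.measurable_s H.right.measurable_k hS).trans ?_
  rw [h1, h2]
  rfl

theorem active_subset_union : active H.triple.L ⊆ Ioc 0 a ∪ Ico (1 - b) 1 := by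
  intro x hx
  have h1 := pos_of_mem_active H.isCappedEquilibrium.usc H.isCappedEquilibrium.ne_zero hx
  have h2 := active_subset hx
  by_contra hn
  simp only [mem_union, not_or] at hn
  have h3 : H.triple.L x = -γ⁻¹ := twoPiece_of_notMem (fun h => hn.1 ⟨h2.1, h.2⟩)
    (fun h => hn.2 ⟨h.1, h2.2⟩)
  have := inv_pos.2 H.γ_pos
  linarith

theorem left_rest_nonneg : 0 ≤ P₀ - ∫ r in (0 : ℝ)..a, (u r + 1) := by
  have h1 := H.g_mul a ⟨H.a_pos.le, le_rfl⟩
  have h2 : 0 < P₀ - γ - ∫ r in (0 : ℝ)..a, (u r + 1) :=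
    pos_of_mul_pos_right (one_pos.trans_eq h1.symm) (H.g_pos a).le
  linarith [H.γ_pos]

theorem right_rest_nonneg : 0 ≤ P₁ - ∫ r in (0 : ℝ)..b, (reflect u r + 1) := by
  have h1 := H.h_mul b ⟨H.b_pos.le, le_rfl⟩
  have h2 : 0 < P₁ - γ - ∫ r in (0 : ℝ)..b, (reflect u r + 1) :=
    pos_of_mul_pos_right (one_pos.trans_eq h1.symm) (H.h_pos _).le
  linarith [H.γ_pos]

/-- Sources minus sinks cancel `(1 + u) dx` exactly in each piece. What remains are the point
sources at the final front positions `a` and `1 - b`. -/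
theorem excess_eq_indicator (hu : AEMeasurable u volume) (hb : ∀ x, |u x| ≤ C) {B : Set ℝ}
    (hB : MeasurableSet B) : H.triple.excess u B =
      (B ∩ active H.triple.L).indicator (fun _ => P₀ - ∫ r in (0 : ℝ)..a, (u r + 1)) a +
      (B ∩ active H.triple.L).indicator (fun _ => P₁ - ∫ r in (0 : ℝ)..b, (reflect u r + 1))
        (1 - b) := by
  set A := B ∩ active H.triple.L with hA
  have hAm : MeasurableSet A := hB.inter measurableSet_active
  have hsub : A ⊆ Ioo 0 1 := inter_subset_right.trans active_subset
  set A' : Set ℝ := (fun x => 1 - x) ⁻¹' A with hA'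
  have hrefl : Measurable fun x : ℝ => 1 - x := measurable_const.sub measurable_id
  have hA'm : MeasurableSet A' := hrefl hAm
  have h0A : (0 : ℝ) ∉ A := fun h => lt_irrefl _ (hsub h).1
  have h0A' : (0 : ℝ) ∉ A' := fun h => by
    have : (1 : ℝ) - 0 < 1 := (hsub h).2
    linarith
  have hθ : H.triple.Q.real {p | start p ∈ B ∧ p.1.θ = 0} = 0 := by
    rw [measureReal_eq_zero_iff (by have := H.isProbabilityMeasure; exact measure_ne_top _ _)]
    have h1 : ∀ᵐ p ∂H.triple.Q, p.1.θ ≠ 0 := by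
      refine H.ae_of_forall ?_ (fun z hz => ?_) fun z hz => ?_
      · have hm : Measurable fun p : StoppedPath solid × ℝ≥0 => p.1.θ :=
          StoppedPath.measurable_θ.comp measurable_fst
        exact (hm (measurableSet_singleton 0)).compl
      · have h2 := (H.mem_left hz).1
        refine ne_of_gt ?_
        rw [← StoppedPath.pos_zero_mem_Ioo_iff]
        change start (leftPair (s z) (k z)) ∈ _
        rwa [start_leftPair]
      · have h2 := (H.mem_right hz).1
        refine ne_of_gt ?_
        rw [← StoppedPath.pos_zero_mem_Ioo_iff]
        change start (rightPair (1 - s' z) (1 - k' z)) ∈ _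
        rwa [start_rightPair]
    refine measure_mono_null (fun p hp => ?_) (ae_iff.1 h1)
    exact not_not.2 hp.2
  have hstart : H.triple.κ * H.triple.Q.real {p | start p ∈ A} =
      (volume.restrict (Ioc 0 N)).real (s ⁻¹' A) + (volume.restrict (Ioc 0 M)).real (s' ⁻¹' A') := by
    have hm : MeasurableSet {p : StoppedPath solid × ℝ≥0 | start p ∈ A} := measurable_start hAm
    rw [H.mul_real hm]
    simp only [mem_ofPred_eq, start_leftPair, start_rightPair]
    rfl
  have hfinish : H.triple.κ * H.triple.Q.real {p | finish p ∈ A} =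
      (volume.restrict (Ioc 0 N)).real (k ⁻¹' A) + (volume.restrict (Ioc 0 M)).real (k' ⁻¹' A') := by
    have hm : MeasurableSet {p : StoppedPath solid × ℝ≥0 | finish p ∈ A} := measurable_finish hAm
    rw [H.mul_real hm]
    congr 1
    · refine congrArg ENNReal.toReal (restrict_Ioc_congr fun z hz => ?_)
      obtain ⟨h1, h2, -⟩ := H.mem_left hz
      simp only [mem_ofPred_eq, finish_leftPair h1 h2, mem_preimage]
    · refine congrArg ENNReal.toReal (restrict_Ioc_congr fun z hz => ?_)
      obtain ⟨h1, h2, -⟩ := H.mem_right hz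
      simp only [mem_ofPred_eq, finish_rightPair h1 h2, hA', mem_preimage]
  have hloc := locallyIntegrable_add_one hu hb
  have hint : IntegrableOn (fun x => u x + 1) (Icc 0 1) := hloc.integrableOn_isCompact isCompact_Icc
  have hsplit : ∫ x in A, (u x + 1) =
      (∫ x in A ∩ Ioc 0 a, (u x + 1)) + ∫ x in A' ∩ Ioc 0 b, (reflect u x + 1) := by
    have h1 : ∫ x in A' ∩ Ioc 0 b, (reflect u x + 1) = ∫ x in A ∩ Ico (1 - b) 1, (u x + 1) := by
      have h2 : A' ∩ Ioc 0 b = (fun x => 1 - x) ⁻¹' (A ∩ Ico (1 - b) 1) := by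
        ext x
        simp only [hA', mem_inter_iff, mem_preimage, mem_Ioc, mem_Ico]
        refine and_congr_right fun _ => ⟨fun h => ⟨by linarith [h.2], by linarith [h.1]⟩,
          fun h => ⟨by linarith [h.2], by linarith [h.1]⟩⟩
      rw [h2]
      exact measurePreserving_reflection.setIntegral_preimage_emb
        (Homeomorph.subLeft (1 : ℝ)).measurableEmbedding (fun x => u x + 1) _
    have h2 : A = A ∩ Ioc 0 a ∪ A ∩ Ico (1 - b) 1 := by
      rw [← inter_union_distrib_left]
      exact (inter_eq_left.2 (inter_subset_right.trans H.active_subset_union)).symm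
    rw [h1]
    nth_rewrite 1 [h2]
    refine setIntegral_union₀ ?_ (hAm.inter measurableSet_Ico).nullMeasurableSet
      (hint.mono_set fun x hx => Ioo_subset_Icc_self (hsub hx.1))
      (hint.mono_set fun x hx => Ioo_subset_Icc_self (hsub hx.1))
    -- The two pieces overlap at most in the collision point.
    refine measure_mono_null (t := {a}) (fun x hx => ?_) (measure_singleton a)
    exact le_antisymm hx.1.2.2 (H.le_one_sub.trans hx.2.2.1)
  have hbal := H.left.balance A hAm h0A
  have hbal' := H.right.balance A' hA'm h0A'
  have hind : A'.indicator (fun _ => P₁ - ∫ r in (0 : ℝ)..b, (reflect u r + 1)) b =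
      A.indicator (fun _ => P₁ - ∫ r in (0 : ℝ)..b, (reflect u r + 1)) (1 - b) := rfl
  rw [H.isCappedEquilibrium.excess_eq H.γ_pos, hθ, hstart, hfinish, hsplit, ← hind]
  linarith

theorem isAdmissible (hu : AEMeasurable u volume) (hb : ∀ x, |u x| ≤ C) :
    H.triple.IsAdmissible u := by
  constructor
  · rw [H.isCappedEquilibrium.swept_eq H.γ_pos]
    have h1 : IntegrableOn (fun x => u x + 1) (Icc 0 1) :=
      (locallyIntegrable_add_one hu hb).integrableOn_isCompact isCompact_Icc
    simpa only [add_comm] using h1.mono_set (active_subset.trans Ioo_subset_Icc_self)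
  · intro B hB
    rw [H.excess_eq_indicator hu hb hB]
    exact add_nonneg (indicator_nonneg (fun _ _ => H.left_rest_nonneg) _)
      (indicator_nonneg (fun _ _ => H.right_rest_nonneg) _)

/-- Both atoms of the excess sit at points whose minimal cost is exactly `t`, so they are not
counted before time `t`. -/
theorem cumulativeExcess_eq_zero (hu : AEMeasurable u volume) (hb : ∀ x, |u x| ≤ C) {r : ℝ≥0}
    (hr : r < t) : H.triple.cumulativeExcess u r = 0 := by
  have hE := H.isCappedEquilibrium
  have key : ∀ x ∈ Ioo (0 : ℝ) 1, minCost H.triple.L x = t →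
      x ∉ {x | H.triple.arrival x ≤ r} ∩ active H.triple.L := by
    rintro x hx hc ⟨h1, h2⟩
    rw [hE.setOf_arrival_le H.γ_pos] at h1
    rcases h1 with h1 | h1
    · exact notMem_solid.2 hx h1
    · have h3 : minCost H.triple.L x ≤ r := h1.2
      rw [hc] at h3
      exact not_lt.2 (NNReal.coe_le_coe.1 h3) hr
  rw [Triple.cumulativeExcess, H.excess_eq_indicator hu hb (hE.measurableSet_arrival_le H.γ_pos r),
    indicator_of_notMem, indicator_of_notMem, add_zero]
  · refine key _ ⟨by linarith [H.le_one_sub, H.a_pos], by linarith [H.b_pos]⟩ ?_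
    rw [H.minCost_right ⟨le_rfl, by linarith [H.b_pos]⟩, H.cost_h]
  · refine key _ ⟨H.a_pos, by linarith [H.add_le, H.b_pos]⟩ ?_
    rw [H.minCost_left ⟨H.a_pos.le, le_rfl⟩, H.cost_g]

end Plan

end

/-! ### Existence of equilibria without excess before the collision. -/

section

variable {u : ℝ → ℝ} {γ C : ℝ}

/-- A front whose arrival time at `a` is `t`: its slowness, as a globally continuous function. -/
theorem exists_slowness (hu : AEMeasurable u volume) (hb : ∀ x, |u x| ≤ C) {v a : ℝ} {t : ℝ≥0}
    (ha : 0 < a) (h : frontTime u v a = t) :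
    ∃ g : ℝ → ℝ, Continuous g ∧ (∀ x, 0 < g x) ∧
      (∀ x ∈ Icc 0 a, g x * (v - ∫ r in (0 : ℝ)..x, (u r + 1)) = 1) ∧
      ∫ x in (0 : ℝ)..a, g x = t := by
  have hlt : frontTime u v a < ⊤ := h ▸ ENNReal.coe_lt_top
  have hpos : ∀ z ∈ Icc 0 a, 0 < v - ∫ r in (0 : ℝ)..z, (u r + 1) := fun z hz =>
    speed_pos_of_frontTime_lt_top hu hb ha hlt hz
  obtain ⟨m, hm, hle⟩ := exists_le_speed hu hb hpos
  refine ⟨_, continuous_inv_max_speed hu hb v hm, fun x => inv_pos.2 (lt_max_of_lt_right hm),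
    fun x hx => ?_, ?_⟩
  · rw [max_eq_left (hle x hx), inv_mul_cancel₀ (hpos x hx).ne']
  · have h1 := frontTime_eq_ofReal hu hb hm hle le_rfl
    rw [h] at h1
    have h2 : 0 ≤ ∫ z in (0 : ℝ)..a, (max (v - ∫ r in (0 : ℝ)..z, (u r + 1)) m)⁻¹ :=
      intervalIntegral.integral_nonneg ha.le fun z _ => (inv_pos.2 (lt_max_of_lt_right hm)).le
    have h3 := congrArg ENNReal.toReal h1
    rw [ENNReal.toReal_ofReal h2, ENNReal.coe_toReal] at h3
    exact h3.symm

/-- Fronts run until they collide or until `τ`; their positions, slownesses and couplings form a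
plan. In the case of a collision, `c` is the meeting point and all other points are reached strictly
earlier, as front times are strictly increasing. -/
theorem exists_triple (hγ : 0 < γ) (hu : AEMeasurable u volume) (hb : ∀ x, |u x| ≤ C) {P₀ P₁ : ℝ}
    (h0 : γ < P₀) (h1 : γ < P₁) {τ : ℝ≥0} (hτ : 0 < τ) :
    ∃ X : Triple solid, X.IsEquilibrium γ ∧ X.IsAdmissible u ∧
      X.exitMeasure = ENNReal.ofReal P₀ • Measure.dirac 0 + ENNReal.ofReal P₁ • Measure.dirac 1 ∧
      ∃ t : ℝ≥0, 0 < t ∧ t ≤ τ ∧ (∀ r < t, X.cumulativeExcess u r = 0) ∧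
        (t = τ ∨ ∃ c, ∀ x ∈ Ioo (0 : ℝ) 1, (x ≠ c → twoFrontTime u (P₀ - γ) (P₁ - γ) x < t) ∧
          twoFrontTime u (P₀ - γ) (P₁ - γ) x ≤ t) := by
  have hu' := aemeasurable_reflect hu
  have hb' : ∀ x, |reflect u x| ≤ C := fun x => hb _
  obtain ⟨a, b, t, ha, hb0, hab, ht, htτ, hfa, hfb, hor⟩ :=
    exists_front_positions hu hb (sub_pos.2 h0) (sub_pos.2 h1) hτ
  obtain ⟨g, hgc, hg0, hgm, hgi⟩ := exists_slowness hu hb ha hfa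
  obtain ⟨h, hhc, hh0, hhm, hhi⟩ := exists_slowness hu' hb' hb0 hfb
  obtain ⟨N, hN, s, k, hs, hk, hc1, hc2, hc3, hc4⟩ := exists_coupling (P := P₀) hu hb ha
    (hγ.trans h0) fun x hx => by
      have := pos_of_mul_pos_right (one_pos.trans_eq (hgm x hx).symm) (hg0 x).le
      linarith
  obtain ⟨M, hM, s', k', hs', hk', hd1, hd2, hd3, hd4⟩ := exists_coupling (P := P₁) hu' hb' hb0
    (hγ.trans h1) fun x hx => by
      have := pos_of_mul_pos_right (one_pos.trans_eq (hhm x hx).symm) (hh0 x).le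
      linarith
  have H : Plan u γ P₀ P₁ a b N M s k s' k' g (fun x => h (1 - x)) t :=
    { γ_pos := hγ
      a_pos := ha
      b_pos := hb0
      add_le := hab
      left := ⟨hN, hs, hk, hc1, hc2, hc3, hc4⟩
      right := ⟨hM, hs', hk', hd1, hd2, hd3, hd4⟩
      continuous_g := hgc
      continuous_h := hhc.comp (continuous_const.sub continuous_id)
      g_pos := hg0
      h_pos := fun x => hh0 _
      g_mul := hgm
      h_mul := fun x hx => by
        rw [sub_sub_cancel]
        exact hhm x hx
      cost_g := hgi
      cost_h := by
        rw [intervalIntegral.integral_comp_sub_left (fun x => h x), sub_self, sub_sub_cancel, hhi] }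
  refine ⟨H.triple, ⟨t, ht, H.isCappedEquilibrium⟩, H.isAdmissible hu hb, H.exitMeasure_eq, t, ht,
    htτ, fun r hr => H.cumulativeExcess_eq_zero hu hb hr, hor.imp_right fun hab1 => ⟨a, ?_⟩⟩
  have key : ∀ x ∈ Ioo (0 : ℝ) 1, x ≠ a → twoFrontTime u (P₀ - γ) (P₁ - γ) x < t := by
    intro x hx hxa
    rcases lt_or_gt_of_ne hxa with hlt | hlt
    · refine (min_le_left _ _).trans_lt ?_
      rw [← hfa]
      refine frontTime_lt_frontTime hu hb hx.1.le hlt (ne_top_of_le_ne_top ?_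
        (frontTime_mono u _ hlt.le))
      rw [hfa]
      exact ENNReal.coe_ne_top
    · refine (min_le_right _ _).trans_lt ?_
      have h2 : 1 - x < b := by linarith
      rw [← hfb]
      refine frontTime_lt_frontTime hu' hb' (by linarith [hx.2]) h2 (ne_top_of_le_ne_top ?_
        (frontTime_mono _ _ h2.le))
      rw [hfb]
      exact ENNReal.coe_ne_top
  refine fun x hx => ⟨key x hx, ?_⟩
  by_cases hxa : x = a
  · rw [hxa, twoFrontTime, hfa]
    exact min_le_left _ _
  · exact (key x hx hxa).le

end

/-! ### Dependence on the velocities and the explicit formula. -/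

section

variable {u : ℝ → ℝ} {v C : ℝ}

/-- The front time depends continuously on the initial speed. -/
theorem continuous_frontTime_speed (hu : AEMeasurable u volume) (hb : ∀ x, |u x| ≤ C) (x : ℝ) :
    Continuous fun v => frontTime u v x := by
  rcases le_or_gt x 0 with hx | hx
  · simp only [frontTime, Ioc_eq_empty_of_le hx, Measure.restrict_empty, lintegral_zero_measure]
    exact continuous_const
  refine continuous_iff_seqContinuous.2 fun f v hf => ?_
  have hm : ∀ v, Measurable fun z => (ENNReal.ofReal (v - ∫ r in (0 : ℝ)..z, (u r + 1)))⁻¹ :=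
    fun v => (continuous_speed hu hb v).measurable.ennreal_ofReal.inv
  have hlim : ∀ z, Tendsto (fun n => (ENNReal.ofReal (f n - ∫ r in (0 : ℝ)..z, (u r + 1)))⁻¹) atTop
      (𝓝 (ENNReal.ofReal (v - ∫ r in (0 : ℝ)..z, (u r + 1)))⁻¹) := fun z =>
    tendsto_inv_iff.2 (ENNReal.tendsto_ofReal (hf.sub_const _))
  -- If the limit is finite, the velocity has a positive minimum `m`, and `(m / 2)⁻¹` eventually
  -- dominates; if it is infinite, Fatou's lemma suffices.
  by_cases hfin : frontTime u v x < ⊤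
  · obtain ⟨m, hm0, hle⟩ := exists_le_speed hu hb
      fun z hz => speed_pos_of_frontTime_lt_top hu hb hx hfin hz
    have hev : ∀ᶠ n in atTop, v - m / 2 < f n :=
      hf.eventually (lt_mem_nhds (by linarith))
    refine tendsto_lintegral_filter_of_dominated_convergence (fun _ => (ENNReal.ofReal (m / 2))⁻¹)
      (Eventually.of_forall fun n => hm _) ?_ ?_ (ae_of_all _ hlim)
    · filter_upwards [hev] with n hn
      refine (ae_restrict_iff' measurableSet_Ioc).2 (ae_of_all _ fun z hz => ?_)
      refine ENNReal.inv_le_inv.2 (ENNReal.ofReal_le_ofReal ?_)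
      linarith [hle z ⟨hz.1.le, hz.2⟩]
    · rw [setLIntegral_const, Real.volume_Ioc]
      exact ENNReal.mul_ne_top (ENNReal.inv_ne_top.2 (ENNReal.ofReal_pos.2 (by linarith)).ne')
        ENNReal.ofReal_ne_top
  · have htop : frontTime u v x = ⊤ := not_lt_top_iff.1 hfin
    refine tendsto_of_le_liminf_of_limsup_le ?_ (htop ▸ le_top)
    refine le_trans (le_of_eq ?_) (lintegral_liminf_le fun n => hm (f n))
    exact lintegral_congr fun z => (hlim z).liminf_eq.symm

theorem tendsto_twoFrontTime (hu : AEMeasurable u volume) (hb : ∀ x, |u x| ≤ C) (x : ℝ)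
    {ι : Type*} {l : Filter ι} {p q : ι → ℝ} {v₀ v₁ : ℝ} (hp : Tendsto p l (𝓝 v₀))
    (hq : Tendsto q l (𝓝 v₁)) :
    Tendsto (fun i => twoFrontTime u (p i) (q i) x) l (𝓝 (twoFrontTime u v₀ v₁ x)) :=
  (((continuous_frontTime_speed hu hb x).tendsto v₀).comp hp).min
    (((continuous_frontTime_speed (aemeasurable_reflect hu) (fun _ => hb _) (1 - x)).tendsto
      v₁).comp hq)

theorem measurable_twoFrontTime (u : ℝ → ℝ) (v₀ v₁ : ℝ) : Measurable (twoFrontTime u v₀ v₁) :=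
  (frontTime_mono u v₀).measurable.min
    ((frontTime_mono (reflect u) v₁).measurable.comp (measurable_const.sub measurable_id))

/-- A finite maximum of the two-front time is attained at no more than two points, because each
front time is strictly increasing where finite. -/
theorem ae_exists_twoFrontTime_lt (hu : AEMeasurable u volume) (hb : ∀ x, |u x| ≤ C)
    (v₀ v₁ : ℝ) : ∀ᵐ x : ℝ, x ∈ Ioo (0 : ℝ) 1 → twoFrontTime u v₀ v₁ x < ⊤ →
      ∃ y ∈ Ioo (0 : ℝ) 1, twoFrontTime u v₀ v₁ x < twoFrontTime u v₀ v₁ y := by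
  by_cases hex : ∃ x ∈ Ioo (0 : ℝ) 1, twoFrontTime u v₀ v₁ x < ⊤ ∧
      ∀ y ∈ Ioo (0 : ℝ) 1, twoFrontTime u v₀ v₁ y ≤ twoFrontTime u v₀ v₁ x
  · obtain ⟨x₀, hx₀, hfin, hmax⟩ := hex
    set m := twoFrontTime u v₀ v₁ x₀
    have hinj : ∀ {u : ℝ → ℝ} (v : ℝ), AEMeasurable u volume → (∀ x, |u x| ≤ C) →
        (Ioo 0 1 ∩ {x | frontTime u v x = m}).Subsingleton := by
      intro u v hu hb x hx y hy
      by_contra hne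
      rcases lt_or_gt_of_ne hne with hlt | hlt
      · refine (frontTime_lt_frontTime hu hb hx.1.1.le hlt ?_).ne (hx.2.trans hy.2.symm)
        exact hx.2.trans_lt hfin |>.ne
      · refine (frontTime_lt_frontTime hu hb hy.1.1.le hlt ?_).ne (hy.2.trans hx.2.symm)
        exact hy.2.trans_lt hfin |>.ne
    have h0 := (hinj v₀ hu hb).measure_zero volume
    have h1 := (hinj v₁ (aemeasurable_reflect hu) fun _ => hb _).measure_zero volume
    rw [← measure_preimage_reflection] at h1
    filter_upwards [compl_mem_ae_iff.2 h0, compl_mem_ae_iff.2 h1] with x hx hx' hx01 hxfin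
    refine ⟨x₀, hx₀, lt_of_le_of_ne (hmax x hx01) fun he => ?_⟩
    rcases min_choice (frontTime u v₀ x) (frontTime (reflect u) v₁ (1 - x)) with hc | hc
    · exact hx ⟨hx01, hc.symm.trans he⟩
    · exact hx' ⟨⟨by linarith [hx01.2], by linarith [hx01.1]⟩, hc.symm.trans he⟩
  · push Not at hex
    exact ae_of_all _ fun x hx hfin => hex x hx hfin

/-- The explicit value `∞` beyond the stopping point is redundant: the velocity has been negative
there, so the integral of the slowness diverges anyway. -/
theorem arrival₀_eq (hu : AEMeasurable u volume) (hb : ∀ x, |u x| ≤ C) {x : ℝ}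
    (hx : x ∈ Ioo (0 : ℝ) 1) : arrival₀ u v x = frontTime u v x := by
  rcases le_or_gt x (stop₀ u v) with h | h
  · rw [arrival₀, indicator_of_mem (s := Ioc 0 (stop₀ u v)) ⟨hx.1, h⟩,
      indicator_of_notMem fun h' => not_lt.2 h h'.1, add_zero]
    rfl
  · rw [arrival₀, indicator_of_notMem fun h' => not_lt.2 h'.2 h,
      indicator_of_mem (s := Ioo (stop₀ u v) 1) ⟨h, hx.2⟩, zero_add]
    by_contra hne
    have hfin : frontTime u v x < ⊤ := lt_top_iff_ne_top.2 (Ne.symm hne)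
    obtain ⟨y, hy, hyx⟩ := exists_lt_of_csInf_lt (Set.union_singleton ▸ insert_nonempty _ _) h
    rcases hy with ⟨hy, hvy⟩ | rfl
    · have := speed_pos_of_frontTime_lt_top hu hb hx.1 hfin ⟨hy.1.le, hyx.le⟩
      linarith
    · exact lt_asymm hyx hx.2

theorem frontTime_reflect (u : ℝ → ℝ) (v x : ℝ) : frontTime (reflect u) v (1 - x) =
    ∫⁻ z in Ioc x 1, (ENNReal.ofReal (v - ∫ r in z..(1 : ℝ), (u r + 1)))⁻¹ := by
  have h1 : (fun z : ℝ => 1 - z) ⁻¹' Ico x 1 = Ioc 0 (1 - x) := by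
    ext z
    simp only [mem_preimage, mem_Ico, mem_Ioc]
    exact ⟨fun h => ⟨by linarith [h.2], by linarith [h.1]⟩,
      fun h => ⟨by linarith [h.2], by linarith [h.1]⟩⟩
  rw [← restrict_Ico_eq_restrict_Ioc, ← measurePreserving_reflection.setLIntegral_comp_preimage_emb
    (MeasurableEquiv.subLeft (1 : ℝ)).measurableEmbedding
    (fun z => (ENNReal.ofReal (v - ∫ r in z..(1 : ℝ), (u r + 1)))⁻¹), h1, frontTime]
  refine lintegral_congr fun z => ?_
  rw [← integral_reflect, sub_sub_cancel]

theorem arrival₁_eq (hu : AEMeasurable u volume) (hb : ∀ x, |u x| ≤ C) {x : ℝ}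
    (hx : x ∈ Ioo (0 : ℝ) 1) : arrival₁ u v x = frontTime (reflect u) v (1 - x) := by
  rcases le_or_gt (stop₁ u v) x with h | h
  · rw [arrival₁, indicator_of_mem (s := Ico (stop₁ u v) 1) ⟨h, hx.2⟩,
      indicator_of_notMem fun h' => not_lt.2 h h'.2, add_zero,
      frontTime_reflect]
  · rw [arrival₁, indicator_of_notMem fun h' => not_lt.2 h'.1 h,
      indicator_of_mem (s := Ioo 0 (stop₁ u v)) ⟨hx.1, h⟩, zero_add]
    by_contra hne
    have hfin : frontTime (reflect u) v (1 - x) < ⊤ := lt_top_iff_ne_top.2 (Ne.symm hne)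
    obtain ⟨y, hy, hyx⟩ := exists_lt_of_lt_csSup (Set.union_singleton ▸ insert_nonempty _ _) h
    rcases hy with ⟨hy, hvy⟩ | rfl
    · have := speed_pos_of_frontTime_lt_top (aemeasurable_reflect hu) (fun _ => hb _)
        (sub_pos.2 hx.2) hfin (z := 1 - y) ⟨by linarith [hy.2], by linarith⟩
      rw [integral_reflect] at this
      have hvy' : v < ∫ z in y..1, (u z + 1) := hvy
      linarith
    · exact lt_asymm hyx hx.1

theorem twoInterfaceArrival_of_mem (hu : AEMeasurable u volume) (hb : ∀ x, |u x| ≤ C) (v₀ v₁ : ℝ)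
    {x : ℝ} (hx : x ∈ Ioo (0 : ℝ) 1) :
    twoInterfaceArrival u v₀ v₁ x = twoFrontTime u v₀ v₁ x := by
  rw [twoInterfaceArrival, arrival₀_eq hu hb hx, arrival₁_eq hu hb hx, twoFrontTime]

theorem twoInterfaceArrival_of_mem_solid (u : ℝ → ℝ) (v₀ v₁ : ℝ) {x : ℝ} (hx : x ∈ solid) :
    twoInterfaceArrival u v₀ v₁ x = 0 := by
  rcases hx with hx | hx
  · have h0 : 0 ≤ stop₀ u v₀ := by
      refine le_csInf ⟨1, Or.inr rfl⟩ ?_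
      rintro y (hy | rfl)
      · exact hy.1.1.le
      · exact zero_le_one
    have h1 : arrival₀ u v₀ x = 0 := by
      rw [arrival₀, indicator_of_notMem fun h => not_lt.2 hx h.1,
        indicator_of_notMem fun h => not_lt.2 hx (h0.trans_lt h.1), add_zero]
    rw [twoInterfaceArrival, h1, min_eq_left zero_le]
  · have h0 : stop₁ u v₁ ≤ 1 := by
      refine csSup_le ⟨0, Or.inr rfl⟩ ?_
      rintro y (hy | rfl)
      · exact hy.1.2.le
      · exact zero_le_one
    have h1 : arrival₁ u v₁ x = 0 := by
      rw [arrival₁, indicator_of_notMem fun h => not_lt.2 hx h.2,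
        indicator_of_notMem fun h => not_lt.2 hx (h.2.trans_le h0), add_zero]
    rw [twoInterfaceArrival, h1, min_eq_right zero_le]

theorem measurable_twoInterfaceArrival (hu : AEMeasurable u volume) (hb : ∀ x, |u x| ≤ C)
    (v₀ v₁ : ℝ) : Measurable (twoInterfaceArrival u v₀ v₁) := by
  have : twoInterfaceArrival u v₀ v₁ = (Ioo 0 1).indicator (twoFrontTime u v₀ v₁) := by
    funext x
    by_cases hx : x ∈ Ioo (0 : ℝ) 1
    · rw [indicator_of_mem hx, twoInterfaceArrival_of_mem hu hb v₀ v₁ hx]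
    · rw [indicator_of_notMem hx,
        twoInterfaceArrival_of_mem_solid u v₀ v₁ (not_not.1 fun h => hx (notMem_solid.1 h))]
  rw [this]
  exact (measurable_twoFrontTime u v₀ v₁).indicator measurableSet_Ioo

end

/-! ### Convergence of capped arrival times. -/

section

theorem continuous_min_toReal (T : ℝ≥0) : Continuous fun a : ℝ≥0∞ => (min a T).toReal := by
  refine continuous_iff_continuousAt.2 fun a => ?_
  have h1 : min a (T : ℝ≥0∞) ≠ ⊤ := ne_top_of_le_ne_top ENNReal.coe_ne_top (min_le_right _ _)
  have h2 : Continuous fun a : ℝ≥0∞ => min a (T : ℝ≥0∞) := continuous_id.min continuous_const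
  exact (ENNReal.tendsto_toReal h1).comp (h2.tendsto a)

theorem enorm_min_toReal_sub_le (T : ℝ≥0) (a b : ℝ≥0∞) :
    ‖(min a T).toReal - (min b T).toReal‖ₑ ≤ T := by
  have key : ∀ a : ℝ≥0∞, (min a (T : ℝ≥0∞)).toReal ≤ T := fun a =>
    ENNReal.toReal_le_coe_of_le_coe (min_le_right _ _)
  rw [← ofReal_norm, Real.norm_eq_abs]
  refine ENNReal.ofReal_le_of_le_toReal ?_
  rw [ENNReal.coe_toReal, abs_le]
  have h1 := ENNReal.toReal_nonneg (a := min a (T : ℝ≥0∞))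
  have h2 := ENNReal.toReal_nonneg (a := min b (T : ℝ≥0∞))
  constructor <;> linarith [key a, key b]

theorem cappedL1LocTendsto_of_ae {f : ℕ → ℝ → ℝ≥0∞} {g : ℝ → ℝ≥0∞} (hf : ∀ n, Measurable (f n))
    (hg : Measurable g) (h : ∀ᵐ x, Tendsto (fun n => f n x) atTop (𝓝 (g x))) (T : ℝ≥0) :
    CappedL1LocTendsto T f g := by
  intro K hK
  have hc := continuous_min_toReal T
  have h0 : ∫⁻ x in K, (fun _ : ℝ => (0 : ℝ≥0∞)) x = 0 := lintegral_zero
  rw [← h0]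
  refine tendsto_lintegral_of_dominated_convergence (fun _ => (T : ℝ≥0∞)) (fun n => ?_)
    (fun n => ae_of_all _ fun x => enorm_min_toReal_sub_le T _ _) ?_ ?_
  · exact ((hc.measurable.comp (hf n)).sub (hc.measurable.comp hg)).enorm
  · rw [setLIntegral_const]
    exact ENNReal.mul_ne_top ENNReal.coe_ne_top hK.measure_lt_top.ne
  · refine ae_restrict_of_ae (h.mono fun x hx => ?_)
    have h1 := ((hc.tendsto (g x)).comp hx).sub_const (min (g x) (T : ℝ≥0∞)).toReal
    rw [sub_self] at h1
    simpa using h1.enorm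

/-- Limits in `L¹` are unique on each `[-m, m]` and at each integer cap, and a value in `[0, ∞]` is
determined by its truncations at all integer caps. -/
theorem ae_eq_of_cappedL1LocTendsto {f : ℕ → ℝ → ℝ≥0∞} {g w : ℝ → ℝ≥0∞}
    (hf : ∀ n, Measurable (f n)) (hg : AEMeasurable g volume) (hw : AEMeasurable w volume)
    (h : ∀ T : ℝ≥0, 0 < T → CappedL1LocTendsto T f g)
    (h' : ∀ T : ℝ≥0, 0 < T → CappedL1LocTendsto T f w) : w =ᵐ[volume] g := by
  have key : ∀ m : ℕ, ∀ᵐ x ∂volume.restrict (Icc (-(m : ℝ)) m), ∀ T : ℕ,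
      (min (w x) ((T + 1 : ℕ) : ℝ≥0)).toReal = (min (g x) ((T + 1 : ℕ) : ℝ≥0)).toReal := by
    intro m
    refine ae_all_iff.2 fun T => ?_
    have hT : (0 : ℝ≥0) < ((T + 1 : ℕ) : ℝ≥0) := by positivity
    have hK : IsCompact (Icc (-(m : ℝ)) m) := isCompact_Icc
    set S : ℝ≥0 := ((T + 1 : ℕ) : ℝ≥0)
    have hc := (continuous_min_toReal S).measurable
    have h1 := (h S hT _ hK).add (h' S hT _ hK)
    rw [add_zero] at h1
    have h2 : ∫⁻ x in Icc (-(m : ℝ)) m, ‖(min (w x) S).toReal - (min (g x) S).toReal‖ₑ = 0 := by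
      refine le_antisymm (ge_of_tendsto' h1 fun n => ?_) zero_le
      have hm : AEMeasurable (fun x => ‖(min (f n x) S).toReal - (min (g x) S).toReal‖ₑ)
          (volume.restrict (Icc (-(m : ℝ)) m)) := ((hc.comp (hf n)).aemeasurable.sub
        (hc.comp_aemeasurable hg.restrict)).enorm
      rw [← lintegral_add_left' hm]
      refine lintegral_mono fun x => ?_
      have h3 : (min (w x) S).toReal - (min (g x) S).toReal =
          ((min (f n x) S).toReal - (min (g x) S).toReal) -
            ((min (f n x) S).toReal - (min (w x) S).toReal) := by ring
      rw [h3]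
      exact enorm_sub_le
    have hm : AEMeasurable (fun x => ‖(min (w x) S).toReal - (min (g x) S).toReal‖ₑ)
        (volume.restrict (Icc (-(m : ℝ)) m)) := ((hc.comp_aemeasurable hw.restrict).sub
      (hc.comp_aemeasurable hg.restrict)).enorm
    rw [lintegral_eq_zero_iff' hm] at h2
    filter_upwards [h2] with x hx
    exact sub_eq_zero.1 (enorm_eq_zero.1 hx)
  have hun : (⋃ m : ℕ, Icc (-(m : ℝ)) m) = univ := by
    refine eq_univ_of_forall fun x => ?_
    obtain ⟨m, hm⟩ := exists_nat_ge |x|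
    exact mem_iUnion.2 ⟨m, abs_le.1 hm⟩
  have hall := (ae_restrict_iUnion_iff (fun m : ℕ => Icc (-(m : ℝ)) m) _).2 key
  rw [hun, Measure.restrict_univ] at hall
  filter_upwards [hall] with x hx
  have hx' : ∀ T : ℕ, min (w x) ((T + 1 : ℕ) : ℝ≥0) = min (g x) (((T + 1 : ℕ) : ℝ≥0) : ℝ≥0∞) :=
    fun T => (ENNReal.toReal_eq_toReal_iff' (ne_top_of_le_ne_top ENNReal.coe_ne_top (min_le_right _ _))
      (ne_top_of_le_ne_top ENNReal.coe_ne_top (min_le_right _ _))).1 (hx T)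
  have hle : ∀ a b : ℝ≥0∞, (∀ T : ℕ, min a ((T + 1 : ℕ) : ℝ≥0) = min b (((T + 1 : ℕ) : ℝ≥0) : ℝ≥0∞)) →
      a ≤ b := by
    intro a b hab
    by_contra! hlt
    obtain ⟨T, hT⟩ := ENNReal.exists_nat_gt (hlt.trans_le le_top).ne
    have hT' : b < (((T + 1 : ℕ) : ℝ≥0) : ℝ≥0∞) := hT.trans (by
      rw [ENNReal.coe_natCast]
      exact_mod_cast Nat.lt_succ_self T)
    have := hab T
    rw [min_eq_left hT'.le] at this
    exact (lt_min hlt hT').ne' this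
  exact le_antisymm (hle _ _ hx') (hle _ _ fun T => (hx' T).symm)

/-- Convergence of the arrival times, provided that the excess loss of energy vanishes in the limit
until the two interfaces meet. -/
theorem ae_tendsto_arrival {u : ℝ → ℝ} {γ C : ℝ} (hγ : 0 < γ) (hu : AEMeasurable u volume)
    (hb : ∀ x, |u x| ≤ C) {X : ℕ → Triple solid} (hX : ∀ n, (X n).IsEquilibrium γ)
    (hadm : ∀ n, (X n).IsAdmissible u) (h0 : ∀ n, γ < (X n).exitMass 0)
    (h1 : ∀ n, γ < (X n).exitMass 1) {v₀ v₁ : ℝ}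
    (hv₀ : Tendsto (fun n => (X n).exitMass 0 - γ) atTop (𝓝 v₀))
    (hv₁ : Tendsto (fun n => (X n).exitMass 1 - γ) atTop (𝓝 v₁))
    (hE : ∀ r : ℝ≥0, (∃ y ∈ Ioo (0 : ℝ) 1, r < twoFrontTime u v₀ v₁ y) → ∀ δ > 0,
      ∀ᶠ n in atTop, (X n).cumulativeExcess u r ≤ δ) :
    ∀ᵐ x, Tendsto (fun n => (X n).arrival x) atTop (𝓝 (twoInterfaceArrival u v₀ v₁ x)) := by
  choose T hT hXT using hX
  have hlow : ∀ᵐ x : ℝ, ∀ n, x ∈ Ioo (0 : ℝ) 1 →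
      twoFrontTime u ((X n).exitMass 0 - γ) ((X n).exitMass 1 - γ) x ≤ (X n).arrival x :=
    ae_all_iff.2 fun n => (hXT n).twoFrontTime_le_arrival hγ hu hb (hadm n) (h0 n) (h1 n)
  filter_upwards [hlow, ae_exists_twoFrontTime_lt hu hb v₀ v₁] with x hx hx'
  by_cases hs : x ∈ solid
  · simp only [Triple.IsCappedEquilibrium.arrival_of_mem_solid hs, twoInterfaceArrival_of_mem_solid u v₀ v₁ hs]
    exact tendsto_const_nhds
  have hx01 := notMem_solid.1 hs
  rw [twoInterfaceArrival_of_mem hu hb v₀ v₁ hx01]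
  have hW := tendsto_twoFrontTime hu hb x hv₀ hv₁
  refine tendsto_order.2 ⟨fun y hy => ?_, fun y hy => ?_⟩
  · filter_upwards [hW.eventually (lt_mem_nhds hy)] with n hn using hn.trans_le (hx n hx01)
  -- For almost every `x` some point is reached later, so `r` can be chosen after the arrival at `x`
  -- but before that of `z`, where the excess is still controlled. By continuity in the speeds, a
  -- small loss `δ` does not delay the arrival at `x` past `r`.
  · obtain ⟨z, hz, hlt⟩ := hx' hx01 (hy.trans_le le_top)
    obtain ⟨r, hr1, hr2⟩ := ENNReal.lt_iff_exists_nnreal_btwn.1 (lt_min hy hlt)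
    have hδ : ∃ δ > 0, δ < γ ∧ twoFrontTime u (v₀ - δ) (v₁ - δ) x < r := by
      have hc : ∀ v : ℝ, Tendsto (fun δ : ℝ => v - δ) (𝓝[>] 0) (𝓝 v) := fun v => by
        have : Tendsto (fun δ : ℝ => v - δ) (𝓝 0) (𝓝 (v - 0)) := tendsto_const_nhds.sub tendsto_id
        rw [sub_zero] at this
        exact this.mono_left nhdsWithin_le_nhds
      have hev := (tendsto_twoFrontTime hu hb x (hc v₀) (hc v₁)).eventually (gt_mem_nhds hr1)
      obtain ⟨δ, h2, h3, h4⟩ := (hev.and (Ioo_mem_nhdsGT hγ)).exists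
      exact ⟨δ, h3, h4, h2⟩
    obtain ⟨δ, hδ0, hδγ, hδr⟩ := hδ
    have hev := (tendsto_twoFrontTime hu hb x (hv₀.sub_const δ) (hv₁.sub_const δ)).eventually
      (gt_mem_nhds hδr)
    filter_upwards [hev, hE r ⟨z, hz, hr2.trans_le (min_le_right _ _)⟩ δ hδ0] with n hn hEn
    exact ((hXT n).arrival_le_twoFrontTime hγ hu hb (hadm n) (h0 n) (h1 n) hδγ hEn hx01 hn).trans_lt
      (hn.trans (hr2.trans_le (min_le_left _ _)))

end

/-! ### Exit masses and the initial boundary energy. -/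

section

variable {u V₀ : ℝ → ℝ} {γ C P₀ P₁ : ℝ} {X : Triple solid}

namespace Triple

theorem exitMeasure_univ (X : Triple solid) :
    X.exitMeasure univ = ENNReal.ofReal X.κ * X.Q {p | p.2 = p.1.θ} := by
  have hm : Measurable fun p : StoppedPath solid × ℝ≥0 => p.1.pos p.1.θ :=
    StoppedPath.measurable_pos_comp (StoppedPath.measurable_θ.comp
      measurable_fst).coe_nnreal_real measurable_fst
  rw [exitMeasure, Measure.smul_apply, Measure.map_apply hm MeasurableSet.univ, preimage_univ,
    Measure.restrict_apply_univ, smul_eq_mul]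

theorem IsEquilibrium.exitMeasure_eq (h : X.IsEquilibrium γ) : X.exitMeasure =
    ENNReal.ofReal (X.exitMass 0) • Measure.dirac 0 +
      ENNReal.ofReal (X.exitMass 1) • Measure.dirac 1 := by
  obtain ⟨T, -, h⟩ := h
  have hfin : ∀ B, MeasurableSet B → X.exitMeasure B ≠ ⊤ := fun B hB => by
    have := h.isProbability
    rw [h.exitMeasure_apply hB]
    exact ENNReal.mul_ne_top ENNReal.ofReal_ne_top (measure_ne_top _ _)
  have h0 : X.exitMeasure ({0, 1}ᶜ : Set ℝ) = 0 := by
    rw [h.exitMeasure_apply (toFinite _).measurableSet.compl, compl_inter_self]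
    simp
  ext B hB
  have hsplit : ∀ i : ℝ, X.exitMeasure (B ∩ {i}) =
      ENNReal.ofReal (X.exitMass i) * Measure.dirac i B := fun i => by
    rw [exitMass, ENNReal.ofReal_toReal (hfin _ (measurableSet_singleton i)),
      Measure.dirac_apply' _ hB]
    by_cases hi : i ∈ B
    · rw [inter_eq_right.2 (singleton_subset_iff.2 hi), indicator_of_mem hi, Pi.one_apply, mul_one]
    · rw [inter_singleton_eq_empty.2 hi, indicator_of_notMem hi, mul_zero, measure_empty]
  rw [Measure.add_apply, Measure.smul_apply, Measure.smul_apply, smul_eq_mul, smul_eq_mul,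
    ← hsplit, ← hsplit, ← measure_union _ (hB.inter (measurableSet_singleton 1)),
    ← inter_union_distrib_left, singleton_union]
  · refine le_antisymm ?_ (measure_mono inter_subset_left)
    calc X.exitMeasure B ≤ X.exitMeasure (B ∩ {0, 1} ∪ {0, 1}ᶜ) :=
          measure_mono fun x hx => by
            by_cases h : x ∈ ({0, 1} : Set ℝ)
            exacts [Or.inl ⟨hx, h⟩, Or.inr h]
      _ ≤ X.exitMeasure (B ∩ {0, 1}) + X.exitMeasure ({0, 1}ᶜ : Set ℝ) := measure_union_le _ _
      _ = X.exitMeasure (B ∩ {0, 1}) := by rw [h0, add_zero]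
  · exact disjoint_left.2 fun x hx hx' => zero_ne_one ((mem_singleton_iff.1 hx.2).symm.trans hx'.2)

theorem exitMass_zero_of_eq (h0 : 0 ≤ P₀)
    (h : X.exitMeasure = ENNReal.ofReal P₀ • Measure.dirac 0 + ENNReal.ofReal P₁ • Measure.dirac 1) :
    X.exitMass 0 = P₀ := by
  simp [exitMass, h, Measure.dirac_apply' _ (measurableSet_singleton (0 : ℝ)), h0]

theorem exitMass_one_of_eq (h1 : 0 ≤ P₁)
    (h : X.exitMeasure = ENNReal.ofReal P₀ • Measure.dirac 0 + ENNReal.ofReal P₁ • Measure.dirac 1) :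
    X.exitMass 1 = P₁ := by
  simp [exitMass, h, Measure.dirac_apply' _ (measurableSet_singleton (1 : ℝ)), h1]

theorem IsEquilibrium.cumulativeExcess_nonneg (h : X.IsEquilibrium γ) (hγ : 0 < γ)
    (hadm : X.IsAdmissible u) (t : ℝ≥0) : 0 ≤ X.cumulativeExcess u t := by
  obtain ⟨T, -, h⟩ := h
  exact hadm.2 _ (h.measurableSet_arrival_le hγ t)

end Triple

theorem strictlyAbove_boundaryEnergy (hγ : 0 < γ) (hV₀ : 0 ≤ V₀ 0) (hV₁ : 0 ≤ V₀ 1)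
    (h0 : γ + V₀ 0 < P₀) (h1 : γ + V₀ 1 < P₁) :
    StrictlyAbove (ENNReal.ofReal P₀ • Measure.dirac 0 + ENNReal.ofReal P₁ • Measure.dirac 1)
      (boundaryEnergy γ solid V₀) := by
  intro B hB hpos
  have l0 : ENNReal.ofReal (γ + V₀ 0) < ENNReal.ofReal P₀ :=
    (ENNReal.ofReal_lt_ofReal_iff (by linarith)).2 h0
  have l1 : ENNReal.ofReal (γ + V₀ 1) < ENNReal.ofReal P₁ :=
    (ENNReal.ofReal_lt_ofReal_iff (by linarith)).2 h1
  rw [boundaryEnergy_solid] at hpos ⊢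
  simp only [Measure.add_apply, Measure.smul_apply, smul_eq_mul, Measure.dirac_apply' _ hB] at hpos ⊢
  by_cases h0B : (0 : ℝ) ∈ B <;> by_cases h1B : (1 : ℝ) ∈ B
  · simpa [h0B, h1B] using ENNReal.add_lt_add l0 l1
  · simpa [h0B, h1B] using l0
  · simpa [h0B, h1B] using l1
  · simp [h0B, h1B] at hpos

theorem lt_exitMass (hX : X.IsEquilibrium γ) (hγ : 0 < γ) (hV₀ : 0 ≤ V₀ 0) (hV₁ : 0 ≤ V₀ 1)
    (h : StrictlyAbove X.exitMeasure (boundaryEnergy γ solid V₀)) :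
    γ + V₀ 0 < X.exitMass 0 ∧ γ + V₀ 1 < X.exitMass 1 := by
  have hex := hX.exitMeasure_eq
  have a0 : 0 < γ + V₀ 0 := by linarith
  have a1 : 0 < γ + V₀ 1 := by linarith
  have h0 := h {0} (measurableSet_singleton 0)
  have h1 := h {1} (measurableSet_singleton 1)
  rw [boundaryEnergy_solid, hex] at h0 h1
  simp only [Measure.add_apply, Measure.smul_apply, smul_eq_mul,
    Measure.dirac_apply' _ (measurableSet_singleton _), mem_singleton_iff, indicator_of_mem,
    Pi.one_apply, mul_one, zero_ne_one, one_ne_zero, not_false_eq_true, indicator_of_notMem,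
    mul_zero, add_zero, zero_add, ENNReal.ofReal_pos, a0, a1, forall_const] at h0 h1
  exact ⟨(ENNReal.ofReal_lt_ofReal_iff_of_nonneg a0.le).1 h0,
    (ENNReal.ofReal_lt_ofReal_iff_of_nonneg a1.le).1 h1⟩

theorem measure_exit_univ (h0 : 0 ≤ P₀) (h1 : 0 ≤ P₁) :
    (ENNReal.ofReal P₀ • Measure.dirac 0 + ENNReal.ofReal P₁ • Measure.dirac 1 : Measure ℝ) univ =
      ENNReal.ofReal (P₀ + P₁) := by
  simp [ENNReal.ofReal_add h0 h1]

end

/-! ### Existence and uniqueness of the minimal solution. -/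

section

variable {u V₀ : ℝ → ℝ} {γ C : ℝ}

theorem isMinimalSolution_twoInterfaceArrival (hγ : 0 < γ) (hu : AEMeasurable u volume)
    (hb : ∀ x, |u x| ≤ C) (hV₀ : 0 ≤ V₀ 0) (hV₁ : 0 ≤ V₀ 1) :
    IsMinimalSolution γ solid u V₀ (twoInterfaceArrival u (V₀ 0) (V₀ 1)) := by
  -- The surplus `1 / (n + 1)` makes the domination of `π` strict and the initial velocities
  -- positive even if `V₀` vanishes.
  set p : ℕ → ℝ := fun n => γ + V₀ 0 + 1 / ((n : ℝ) + 1) with hp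
  set q : ℕ → ℝ := fun n => γ + V₀ 1 + 1 / ((n : ℝ) + 1) with hq
  have hpos : ∀ n : ℕ, 0 < 1 / ((n : ℝ) + 1) := fun n => Nat.one_div_pos_of_nat
  have hp0 : ∀ n, γ + V₀ 0 < p n := fun n => by simp only [hp]; linarith [hpos n]
  have hq0 : ∀ n, γ + V₀ 1 < q n := fun n => by simp only [hq]; linarith [hpos n]
  have hpγ : ∀ n, γ < p n := fun n => by linarith [hp0 n]
  have hqγ : ∀ n, γ < q n := fun n => by linarith [hq0 n]
  have hlim : ∀ a : ℝ, Tendsto (fun n : ℕ => a + 1 / ((n : ℝ) + 1)) atTop (𝓝 a) := fun a => by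
    simpa using (tendsto_one_div_add_atTop_nhds_zero_nat (𝕜 := ℝ)).const_add a
  -- The horizon `n + 1` eventually exceeds any fixed time, so only the collision can end the
  -- excess-free phase.
  choose X hX hadm hex t ht htτ hE hor using fun n : ℕ =>
    exists_triple hγ hu hb (hpγ n) (hqγ n) (τ := (n : ℝ≥0) + 1) (by positivity)
  have hm0 : ∀ n, (X n).exitMass 0 = p n := fun n =>
    Triple.exitMass_zero_of_eq (hγ.trans (hpγ n)).le (hex n)
  have hm1 : ∀ n, (X n).exitMass 1 = q n := fun n =>
    Triple.exitMass_one_of_eq (hγ.trans (hqγ n)).le (hex n)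
  have hv0 : Tendsto (fun n => (X n).exitMass 0 - γ) atTop (𝓝 (V₀ 0)) := by
    simpa only [hm0, hp, add_sub_cancel_left] using (hlim (γ + V₀ 0)).sub_const γ
  have hv1 : Tendsto (fun n => (X n).exitMass 1 - γ) atTop (𝓝 (V₀ 1)) := by
    simpa only [hm1, hq, add_sub_cancel_left] using (hlim (γ + V₀ 1)).sub_const γ
  have hτ : ∀ r : ℝ≥0, ∀ᶠ n : ℕ in atTop, r < (n : ℝ≥0) + 1 := fun r => by
    obtain ⟨k, hk⟩ := exists_nat_gt r
    filter_upwards [eventually_ge_atTop k] with n hn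
    exact hk.trans_le ((Nat.cast_le.2 hn).trans (by simp))
  have hae := ae_tendsto_arrival hγ hu hb hX hadm (fun n => hm0 n ▸ hpγ n)
    (fun n => hm1 n ▸ hqγ n) hv0 hv1 fun r ⟨y, hy, hr⟩ δ hδ => by
      filter_upwards [(tendsto_twoFrontTime hu hb y hv0 hv1).eventually (lt_mem_nhds hr), hτ r]
        with n hn hn'
      have hlt : r < t n := by
        rcases hor n with h | ⟨c, h⟩
        · rwa [h]
        · rw [hm0, hm1] at hn
          exact ENNReal.coe_lt_coe.1 (hn.trans_le (h y hy).2)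
      rw [hE n r hlt]
      exact hδ.le
  refine ⟨(measurable_twoInterfaceArrival hu hb _ _).aemeasurable, X, hX, fun T hT =>
    ⟨⟨fun n => ?_, hadm, ?_, ?_⟩, fun Y hY hYex hYadm hYE r s hrs hsT => ?_⟩⟩
  · rw [hex n]
    exact strictlyAbove_boundaryEnergy hγ hV₀ hV₁ (hp0 n) (hq0 n)
  · refine cappedL1LocTendsto_of_ae (fun n => ?_) (measurable_twoInterfaceArrival hu hb _ _) hae T
    obtain ⟨S, -, hS⟩ := hX n
    exact hS.measurable_arrival hγ
  · have h1 : ∀ n, ENNReal.ofReal (X n).κ * (X n).Q {p | p.2 = p.1.θ} = ENNReal.ofReal (p n + q n) :=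
      fun n => by
        rw [← Triple.exitMeasure_univ, hex n,
          measure_exit_univ (hγ.trans (hpγ n)).le (hγ.trans (hqγ n)).le]
    simp only [h1]
    rw [boundaryEnergy_solid, measure_exit_univ (by linarith) (by linarith)]
    exact ENNReal.tendsto_ofReal ((hlim _).add (hlim _))
  · refine le_liminf_of_le (by isBoundedDefault) ?_
    filter_upwards [hτ T] with n hn
    rw [EReal.coe_nonneg]
    -- Before the collision the excess to be compared with is zero. Afterwards the competitor has
    -- also had zero excess until `t n`, hence sweeps everything by then, and both totals depend
    -- only on the common exit masses.
    rcases lt_or_ge r (t n) with hr | hr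
    · rw [hE n r hr, sub_zero]
      exact (hY n).cumulativeExcess_nonneg hγ (hYadm n) s
    · have htT : t n < T := hr.trans_lt (hrs.trans hsT)
      obtain ⟨c, hc⟩ := (hor n).resolve_left (htT.trans hn).ne
      have hYm : ∀ i, (Y n).exitMass i = (X n).exitMass i := fun i => by
        rw [Triple.exitMass, Triple.exitMass, hYex n]
      obtain ⟨S, -, hS⟩ := hX n
      obtain ⟨S', -, hS'⟩ := hY n
      have h1 := hS.cumulativeExcess_eq hγ hu hb (hadm n) (hm0 n ▸ hpγ n) (hm1 n ▸ hqγ n)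
        (fun s hs => (hE n s hs).le) (c := c) (fun x hx hxc => by
          rw [hm0, hm1]
          exact (hc x hx).1 hxc) hr
      have h2 := hS'.cumulativeExcess_eq hγ hu hb (hYadm n) (by rw [hYm, hm0]; exact hpγ n)
        (by rw [hYm, hm1]; exact hqγ n)
        (fun s hs => (hYE n s (hs.le.trans htT.le)).trans (hE n s hs).le) (c := c)
        (fun x hx hxc => by
          rw [hYm, hYm, hm0, hm1]
          exact (hc x hx).1 hxc) (hr.trans hrs.le)
      rw [h1, h2, hYm, hYm, sub_self]

theorem ae_eq_twoInterfaceArrival_of_isMinimalSolution (hγ : 0 < γ) (hu : AEMeasurable u volume)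
    (hb : ∀ x, |u x| ≤ C) (hV₀ : 0 ≤ V₀ 0) (hV₁ : 0 ≤ V₀ 1) {w : ℝ → ℝ≥0∞}
    (hw : IsMinimalSolution γ solid u V₀ w) :
    w =ᵐ[volume] twoInterfaceArrival u (V₀ 0) (V₀ 1) := by
  obtain ⟨hwm, X, hX, hmin⟩ := hw
  obtain ⟨⟨habove, hadm, -, htend⟩, -⟩ := hmin 1 one_pos
  have hP := fun n => lt_exitMass (hX n) hγ hV₀ hV₁ (habove n)
  set p : ℕ → ℝ := fun n => (X n).exitMass 0
  set q : ℕ → ℝ := fun n => (X n).exitMass 1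
  have hpγ : ∀ n, γ < p n := fun n => by linarith [(hP n).1]
  have hqγ : ∀ n, γ < q n := fun n => by linarith [(hP n).2]
  have hex : ∀ n, (X n).exitMeasure =
      ENNReal.ofReal (p n) • Measure.dirac 0 + ENNReal.ofReal (q n) • Measure.dirac 1 :=
    fun n => (hX n).exitMeasure_eq
  have hsum : Tendsto (fun n => p n + q n) atTop (𝓝 ((γ + V₀ 0) + (γ + V₀ 1))) := by
    have h1 : ∀ n, ENNReal.ofReal (X n).κ * (X n).Q {p | p.2 = p.1.θ} = ENNReal.ofReal (p n + q n) :=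
      fun n => by
        rw [← Triple.exitMeasure_univ, hex n,
          measure_exit_univ (hγ.trans (hpγ n)).le (hγ.trans (hqγ n)).le]
    simp only [h1] at htend
    rw [boundaryEnergy_solid, measure_exit_univ (by linarith) (by linarith)] at htend
    have h2 := (ENNReal.tendsto_toReal ENNReal.ofReal_ne_top).comp htend
    rw [ENNReal.toReal_ofReal (by linarith)] at h2
    refine h2.congr fun n => ?_
    rw [Function.comp_apply, ENNReal.toReal_ofReal (by linarith [hpγ n, hqγ n])]
  -- Each exit mass is bounded below by its limit and their sum converges, so both converge.
  have hp : Tendsto p atTop (𝓝 (γ + V₀ 0)) := by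
    have h1 := hsum.sub_const (γ + V₀ 1)
    rw [add_sub_cancel_right] at h1
    exact tendsto_of_tendsto_of_tendsto_of_le_of_le tendsto_const_nhds h1 (fun n => (hP n).1.le)
      fun n => by
        change p n ≤ p n + q n - (γ + V₀ 1)
        linarith [(hP n).2]
  have hq : Tendsto q atTop (𝓝 (γ + V₀ 1)) := by
    have h1 := hsum.sub hp
    rw [add_sub_cancel_left] at h1
    simpa only [add_sub_cancel_left] using h1
  have hv0 : Tendsto (fun n => (X n).exitMass 0 - γ) atTop (𝓝 (V₀ 0)) := by
    simpa only [add_sub_cancel_left] using hp.sub_const γ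
  have hv1 : Tendsto (fun n => (X n).exitMass 1 - γ) atTop (𝓝 (V₀ 1)) := by
    simpa only [add_sub_cancel_left] using hq.sub_const γ
  have hae := ae_tendsto_arrival hγ hu hb hX hadm hpγ hqγ hv0 hv1 fun r ⟨y, hy, hr⟩ δ hδ => by
    obtain ⟨T, hrT, hTy⟩ := ENNReal.lt_iff_exists_nnreal_btwn.1 hr
    obtain ⟨s, hrs, hsT⟩ := exists_between (ENNReal.coe_lt_coe.1 hrT)
    choose Z hZ hZadm hZex t ht htτ hZE hor using fun n : ℕ =>
      exists_triple hγ hu hb (hpγ n) (hqγ n) (τ := T + 1) (by positivity)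
    -- The competitor is the excess-free equilibrium with the same exit masses whenever it is
    -- excess-free beyond `T`. In the remaining cases `X n` itself is admissible as a competitor.
    classical
    have h1 := (hmin T (pos_of_gt (hrs.trans hsT))).2 (fun n => if T < t n then Z n else X n)
      (fun n => by split_ifs; exacts [hZ n, hX n])
      (fun n => by split_ifs; exacts [(hZex n).trans (hex n).symm, rfl])
      (fun n => by split_ifs; exacts [hZadm n, hadm n])
      (fun n z hz => by
        split_ifs with h
        · rw [hZE n z (hz.trans_lt h)]
          exact (hX n).cumulativeExcess_nonneg hγ (hadm n) z
        · exact le_rfl) r s hrs hsT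
    have h2 : ((-δ : ℝ) : EReal) < 0 := by
      rw [← EReal.coe_zero, EReal.coe_lt_coe_iff]
      linarith
    filter_upwards [eventually_lt_of_lt_liminf (h2.trans_le h1),
      (tendsto_twoFrontTime hu hb y hv0 hv1).eventually (lt_mem_nhds hTy)] with n hn hn'
    -- The point `y` is reached after `T` for large `n`, so no collision happens by time `T`, and
    -- the horizon `T + 1` lies beyond `T`. Thus the excess-free competitor is used for all large
    -- `n`, and minimality bounds the excess of `X n` at `r` by `δ`.
    have hlt : T < t n := by
      rcases hor n with h | ⟨c, h⟩
      · rw [h]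
        exact lt_add_one T
      · exact ENNReal.coe_lt_coe.1 (hn'.trans_le (h y hy).2)
    rw [if_pos hlt, hZE n s (hsT.trans hlt), EReal.coe_lt_coe_iff] at hn
    linarith
  have hm : ∀ n, Measurable (X n).arrival := fun n => by
    obtain ⟨S, -, hS⟩ := hX n
    exact hS.measurable_arrival hγ
  exact ae_eq_of_cappedL1LocTendsto hm (measurable_twoInterfaceArrival hu hb _ _).aemeasurable hwm
    (fun T _ => cappedL1LocTendsto_of_ae hm (measurable_twoInterfaceArrival hu hb _ _) hae T)
    fun T hT => (hmin T hT).1.2.2.1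

end

end

end Cascade

theorem proposition5p2 (γ : ℝ) (hγ : 0 < γ)
    (u : ℝ → ℝ) (hu : AEMeasurable u volume) (hu_bdd : ∃ C : ℝ, ∀ x, |u x| ≤ C)
    (V₀ : ℝ → ℝ) (hV₀ : 0 ≤ V₀ 0) (hV₁ : 0 ≤ V₀ 1) :
    Cascade.IsMinimalSolution γ (Iic (0 : ℝ) ∪ Ici 1) u V₀
        (Cascade.twoInterfaceArrival u (V₀ 0) (V₀ 1)) ∧
      ∀ w : ℝ → ℝ≥0∞, Cascade.IsMinimalSolution γ (Iic (0 : ℝ) ∪ Ici 1) u V₀ w →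
        w =ᵐ[volume] Cascade.twoInterfaceArrival u (V₀ 0) (V₀ 1) := by
  obtain ⟨C, hb⟩ := hu_bdd
  exact ⟨Cascade.isMinimalSolution_twoInterfaceArrival hγ hu hb hV₀ hV₁, fun w hw =>
    Cascade.ae_eq_twoInterfaceArrival_of_isMinimalSolution hγ hu hb hV₀ hV₁ hw⟩
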